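/- **Setting.** Let $n\ge 1$ and let $\Delta$ be the fan of a smooth complete toric variety of dimension $n$: the maximal cones cover $\mathbb R^n$, meet along common faces, and each is spanned by a $\mathbb Z$-basis of $\mathbb Z^n$. Let $\nu$ be the strictly convex function on $\mathbb R^n$, integral linear on each cone, of an ample line bundle. Let $R$ be the set of primitive generators of the rays, $A=R\cup\{0\}$, and $$Q=\{y\in\mathbb R^n:\langle\alpha,y\rangle\le\nu(\alpha)\ \text{for all }\alpha\in R\},$$ and assume that $0$ is an interior point of $Q$. For $\alpha\in A$ let $C_\alpha\subset\mathbb R^n$ be the set where $\langle\alpha,u\rangle-\nu(\alpha)$ is maximal among all elements of $A$. Write $(\mathbb C^*)^n=T^*\mathbb R^n/2\pi\mathbb Z^n$ with coordinates $(u,\theta)$, symplectic form $\omega=\sum d\theta_i\wedge du_i$ and primitive $-\sum u_i\,d\theta_i$. For $\varepsilon>0$, $B\in\mathbb R$ and $t>0$, choose for each $\alpha\in R$ a smooth function $\phi_\alpha\ge 0$ on $\mathbb R^n$ with $\phi_\alpha(u)=0\iff d(u,C_\alpha)\le\varepsilon/2$, $\phi_\alpha(u)=1\iff d(u,C_\alpha)\ge\varepsilon$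 and $|d\phi_\alpha|\le B$, and put $$W(u,\theta)=-1+\sum_{\alpha\in R}(1-\phi_\alpha(u))\,t^{\langle\alpha,u\rangle-\nu(\alpha)}e^{i\langle\alpha,\theta\rangle}.$$ Let $M=W^{-1}(0)$, let $B_{\mathcal L}=\{u\in Q: W(u,0)\le 0\}$, and let $\mathcal L=\{(u,0):u\in B_{\mathcal L}\}$, the compact piece of the zero section over $Q$ bounded by its intersection with $M$. A compact, oriented, exact Lagrangian submanifold $S$ with boundary in $M$ is *admissible* if $\partial S=\emptyset$ or there is a smooth curve $\gamma$ in $\mathbb C$ with $\gamma(0)=0$, $\gamma'(0)\ne0$, such that over a neighbourhood of $0\in\mathbb C$ the set $S$ agrees with the parallel transport of $\partial S$ along $\gamma$, for the connection of $W$ given by the symplectic orthogonal complements of the tangent spaces of the fibres. A pair of admissible Lagrangians with nonempty boundaries is *positively oriented* if the angle from $v_1=\gamma_1'(0)$ to $v_2=\gamma_2'(0)$ lies in $(0,\pi/2)$. The *interior intersection points* of a pair are the points of $(S_1\setminus\partial S_1)\cap(S_2\setminus\partial S_2)$. **Proposition.** For every integer $j$ and every $\eta>0$ there are a real number $\varepsilon'$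 with $|\varepsilon'|<\eta$, and with $j\varepsilon'>0$ if $j\neq 0$, and a number $\varepsilon_0>0$ such that, for all $0<\varepsilon<\varepsilon_0$ and all $B$, for all sufficiently large $t$ (how large depending on $\varepsilon$ and $B$, but not on the $\phi_\alpha$) and all choices of $(\phi_\alpha)$ as above, there is an admissible Lagrangian $\mathcal L(j)$ with the following properties. 1. $\mathcal L(j)$ is the graph over $B_{\mathcal L}$ of the differential, modulo $2\pi\mathbb Z^n$, of a smooth function $H$ on $\mathbb R^n$, and $\langle\alpha,\nabla H(u)\rangle=-2\pi j\,\nu(\alpha)$ for all $u\in\partial B_{\mathcal L}$ and all $\alpha\in R$ with $\phi_\alpha(u)\ne1$ (so near a face $\sigma$ of $Q$ the boundary of $\mathcal L(j)$ lies in the affine span of $-2\pi j\sigma$). 2. The pair $(\mathcal L,\mathcal L(j))$ is positively oriented. 3. The map $(u,\theta)\mapsto(1+\varepsilon')u$ is a bijection from the set of interior intersection points of $\mathcal L$ and $\mathcal L(j)$ onto $\tfrac1j\mathbb Z^n\cap Q$ if $j>0$, and onto $\tfrac1j\mathbb Z^n\cap(Q\setminus\partial Q)$ if $j<0$. 4.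 There is an open set $V\subset\mathbb R^n$ whose closure lies in the interior of $B_{\mathcal L}$, such that every point of $B_{\mathcal L}\setminus V$ has distance less than $\eta$ from $\partial B_{\mathcal L}$, all interior intersection points lie over $V$ (over $\overline V$ if $j=0$), and over $V$ the Lagrangian $\mathcal L(j)$ is the graph of the differential, modulo $2\pi\mathbb Z^n$, of $-j\pi(1+\varepsilon')\langle u,u\rangle$. -/

import Mathlib

open Set Filter Topology
open scoped ContDiff

namespace ToricMirror

/-! ### The symplectic manifold `(ℂ*)ⁿ = T*ℝⁿ / 2πℤⁿ` -/

/-- The base `ℝⁿ` with its Euclidean metric; cotangent vectors are identified with vectors. -/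
abbrev Base (n : ℕ) := EuclideanSpace ℝ (Fin n)

/-- The cotangent bundle `T*ℝⁿ`, with coordinates `(u, θ)`. -/
abbrev Cover (n : ℕ) := Base n × Base n

/-- `(ℂ*)ⁿ`, as the quotient of `T*ℝⁿ` by the lattice `2πℤⁿ` in each cotangent fibre: a point is
`(u, θ)` with `u ∈ ℝⁿ` and `θ ∈ (ℝ/2πℤ)ⁿ`, that is the point with `i`-th coordinate
`exp (u i + √-1 * θ i)`. -/
abbrev Torus (n : ℕ) := Base n × (Fin n → Real.Angle)

variable {n : ℕ}

/-- The covering `T*ℝⁿ → (ℂ*)ⁿ`, a local symplectomorphism. Differential notions for subsets of and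
functions on `(ℂ*)ⁿ` are read in the cover. -/
noncomputable def cov (p : Cover n) : Torus n := (p.1, fun i => (p.2 i : Real.Angle))

/-- The preimage in the cover of a subset of `(ℂ*)ⁿ`. -/
def lift (S : Set (Torus n)) : Set (Cover n) := cov ⁻¹' S

/-- The symplectic form `∑ i, dθ_i ∧ du_i = ∑ i, dz_i ∧ dz̄_i / (2 √-1 |z_i|²)`. -/
noncomputable def omega (v w : Cover n) : ℝ := inner ℝ v.2 w.1 - inner ℝ v.1 w.2

/-- The primitive `- ∑ i, u_i dθ_i` of the symplectic form (it is defined on the quotient). -/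
noncomputable def primitive (p v : Cover n) : ℝ := -inner ℝ p.1 v.2

/-! ### Lagrangian submanifolds with boundary -/

/-- Near `p`, the set `S` is an `n`-dimensional smooth submanifold without boundary: the zero set
of `n` independent smooth functions. -/
def IsInteriorPoint (S : Set (Cover n)) (p : Cover n) : Prop :=
  ∃ F : Cover n → Base n, ContDiff ℝ ∞ F ∧ F p = 0 ∧ Function.Surjective (fderiv ℝ F p) ∧
    ∀ᶠ q in 𝓝 p, (q ∈ S ↔ F q = 0)

/-- Near `p`, the set `S` is an `n`-dimensional smooth submanifold with boundary, and `p` is one of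
its boundary points: `S` is cut out by `F = 0`, `0 ≤ g` with `(F, g)` a submersion at `p`. -/
def IsBoundaryPoint (S : Set (Cover n)) (p : Cover n) : Prop :=
  ∃ (F : Cover n → Base n) (g : Cover n → ℝ), ContDiff ℝ ∞ F ∧ ContDiff ℝ ∞ g ∧
    F p = 0 ∧ g p = 0 ∧ Function.Surjective (fun v => (fderiv ℝ F p v, fderiv ℝ g p v)) ∧
    ∀ᶠ q in 𝓝 p, (q ∈ S ↔ F q = 0 ∧ 0 ≤ g q)

/-- The tangent space of a submanifold (possibly with boundary) at one of its points. -/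
def tangentAt (S : Set (Cover n)) (p : Cover n) : Submodule ℝ (Cover n) :=
  Submodule.span ℝ (tangentConeAt ℝ S p)

/-- The boundary of a submanifold with boundary of `(ℂ*)ⁿ`. -/
def bdry (S : Set (Torus n)) : Set (Torus n) :=
  {x | x ∈ S ∧ ∃ p, cov p = x ∧ IsBoundaryPoint (lift S) p}

/-- `S` is a Lagrangian submanifold of `(ℂ*)ⁿ`, possibly with boundary. -/
def IsLagrangian (S : Set (Torus n)) : Prop :=
  (∀ p ∈ lift S, IsInteriorPoint (lift S) p ∨ IsBoundaryPoint (lift S) p) ∧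
  ∀ p ∈ lift S, ∀ v ∈ tangentAt (lift S) p, ∀ w ∈ tangentAt (lift S) p, omega v w = 0

/-- `S` is exact: the primitive restricts on `S` to the differential of a smooth function `h`. -/
def IsExact (S : Set (Torus n)) : Prop :=
  ∃ h : Torus n → ℝ, ∀ p ∈ lift S, ∃ k : Cover n → ℝ, ContDiff ℝ ∞ k ∧
    (∀ᶠ q in 𝓝[lift S] p, h (cov q) = k q) ∧
    ∀ v ∈ tangentAt (lift S) p, fderiv ℝ k p v = primitive p v

/-- `S` admits an orientation: there is a continuous `n`-form along `S` which is nonzero on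
every tangent space. -/
def IsOrientable (S : Set (Torus n)) : Prop :=
  ∃ μ : Torus n → Cover n [⋀^Fin n]→L[ℝ] ℝ, ContinuousOn μ S ∧
    ∀ p ∈ lift S, ∃ v : Fin n → Cover n, (∀ i, v i ∈ tangentAt (lift S) p) ∧ μ (cov p) v ≠ 0

/-! ### Parallel transport and admissibility -/

/-- `c`, on `[0, s]`, is a horizontal lift of the curve `γ` for the connection of `f` whose
horizontal spaces are the symplectic orthogonal complements of the tangent spaces of the fibres. -/
def IsHorizontalLift (f : Torus n → ℂ) (γ : ℝ → ℂ) (s : ℝ) (c : ℝ → Cover n) : Prop :=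
  ∀ r ∈ Icc 0 s, ∃ w : Cover n, HasDerivWithinAt c w (Icc 0 s) r ∧
    fderiv ℝ (f ∘ cov) (c r) w = deriv γ r ∧
    ∀ y, fderiv ℝ (f ∘ cov) (c r) y = 0 → omega w y = 0

/-- The points (in the cover) swept by the parallel transport of `Λ` along `γ`, up to time `s₀`. -/
def transport (f : Torus n → ℂ) (γ : ℝ → ℂ) (s₀ : ℝ) (Λ : Set (Torus n)) : Set (Cover n) :=
  {q | ∃ s ∈ Icc 0 s₀, ∃ c : ℝ → Cover n, c 0 ∈ lift Λ ∧ IsHorizontalLift f γ s c ∧ c s = q}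

/-- `γ` is a smooth curve with `γ 0 = 0` and `γ' 0 ≠ 0`, and over some neighbourhood of `0 ∈ ℂ`
the set `S` agrees with the parallel transport of its boundary along `γ`. -/
def AgreesWithTransport (f : Torus n → ℂ) (S : Set (Torus n)) (γ : ℝ → ℂ) : Prop :=
  ContDiff ℝ ∞ γ ∧ γ 0 = 0 ∧ deriv γ 0 ≠ 0 ∧
  ∃ s₀ > 0, ∃ δ > 0, ∀ q : Cover n, ‖f (cov q)‖ < δ →
    (q ∈ lift S ↔ q ∈ transport f γ s₀ (bdry S))

/-- Admissible Lagrangians: compact oriented exact Lagrangians with boundary on `f⁻¹(0)` which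
agree, over a neighbourhood of the origin of `ℂ`, with the parallel transport of their boundary
along some curve (a condition that is void when the boundary is empty). -/
structure IsAdmissible (f : Torus n → ℂ) (S : Set (Torus n)) : Prop where
  compact : IsCompact S
  lagrangian : IsLagrangian S
  exact : IsExact S
  orientable : IsOrientable S
  bdry_subset : ∀ x ∈ bdry S, f x = 0
  transport : bdry S = ∅ ∨ ∃ γ : ℝ → ℂ, AgreesWithTransport f S γ

/-- Positively oriented pairs: the angle from `v₁ = γ₁'(0)` to `v₂ = γ₂'(0)` is in `(0, π/2)`. -/
def PositivelyOriented (f : Torus n → ℂ) (S₁ S₂ : Set (Torus n)) : Prop :=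
  IsAdmissible f S₁ ∧ IsAdmissible f S₂ ∧ (bdry S₁).Nonempty ∧ (bdry S₂).Nonempty ∧
  ∃ γ₁ γ₂ : ℝ → ℂ, AgreesWithTransport f S₁ γ₁ ∧ AgreesWithTransport f S₂ γ₂ ∧
    Complex.arg (deriv γ₂ 0 / deriv γ₁ 0) ∈ Ioo 0 (Real.pi / 2)

/-- The interior intersection points of two Lagrangians with boundary. -/
def interiorIntersection (S₁ S₂ : Set (Torus n)) : Set (Torus n) :=
  (S₁ \ bdry S₁) ∩ (S₂ \ bdry S₂)

/-! ### Toric data -/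

/-- An integral vector, as a vector of `ℝⁿ`. -/
noncomputable def vec (α : Fin n → ℤ) : Base n := WithLp.toLp 2 (fun i => (α i : ℝ))

/-- The cone spanned by a finite set of integral vectors. -/
def cone (τ : Finset (Fin n → ℤ)) : Set (Base n) :=
  {x | ∃ c : (Fin n → ℤ) → ℝ, (∀ v, 0 ≤ c v) ∧ x = ∑ v ∈ τ, c v • vec v}

/-- The fan of a smooth complete toric variety, given by the primitive generators of its
`1`-cones and by the sets of generators of its maximal cones. -/
structure SmoothCompleteFan (n : ℕ) where
  rays : Finset (Fin n → ℤ)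
  maxCones : Finset (Finset (Fin n → ℤ))
  subset_rays : ∀ τ ∈ maxCones, τ ⊆ rays
  ray_mem : ∀ v ∈ rays, ∃ τ ∈ maxCones, v ∈ τ
  smooth : ∀ τ ∈ maxCones, ∃ b : Module.Basis (Fin n) ℤ (Fin n → ℤ), Set.range b = ↑τ
  inter : ∀ τ ∈ maxCones, ∀ τ' ∈ maxCones, cone τ ∩ cone τ' = cone (τ ∩ τ')
  complete : ∀ x : Base n, ∃ τ ∈ maxCones, x ∈ cone τ

/-- The strictly convex functions on the support of the fan which are integral linear on each
maximal cone; these describe the ample line bundles. -/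
def IsAmple (F : SmoothCompleteFan n) (ν : Base n → ℝ) : Prop :=
  ∀ τ ∈ F.maxCones, ∃ m : Fin n → ℤ,
    (∀ x ∈ cone τ, ν x = inner ℝ (vec m) x) ∧ ∀ x ∉ cone τ, inner ℝ (vec m) x < ν x

/-- The polytope `Q` of the ample line bundle. -/
def polytope (F : SmoothCompleteFan n) (ν : Base n → ℝ) : Set (Base n) :=
  {y | ∀ v ∈ F.rays, inner ℝ (vec v) y ≤ ν (vec v)}

/-- The region `C_α` of `ℝⁿ` where `⟨α, u⟩ - ν α` is maximal among all `α ∈ A = rays ∪ {0}`. -/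
def dominance (F : SmoothCompleteFan n) (ν : Base n → ℝ) (α : Fin n → ℤ) : Set (Base n) :=
  {u | ∀ β ∈ insert 0 F.rays,
    inner ℝ (vec β) u - ν (vec β) ≤ inner ℝ (vec α) u - ν (vec α)}

/-- Cutoff functions `χ α` of width `ε` around the regions `C_α`, `0 ≠ α ∈ A`, with gradient
bounded by `B`, in the rescaled coordinate `u = Log z / log t`. -/
structure IsCutoffFamily (F : SmoothCompleteFan n) (ν : Base n → ℝ) (ε B : ℝ)
    (χ : (Fin n → ℤ) → Base n → ℝ) : Prop where
  smooth : ∀ α ∈ F.rays, ContDiff ℝ ∞ (χ α)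
  nonneg : ∀ α ∈ F.rays, ∀ u, 0 ≤ χ α u
  eq_zero : ∀ α ∈ F.rays, ∀ u, χ α u = 0 ↔ Metric.infDist u (dominance F ν α) ≤ ε / 2
  eq_one : ∀ α ∈ F.rays, ∀ u, χ α u = 1 ↔ ε ≤ Metric.infDist u (dominance F ν α)
  bound : ∀ α ∈ F.rays, ∀ u, ‖fderiv ℝ (χ α) u‖ ≤ B

/-- The tropical localization `W = -1 + ∑ t^(-ν α) (1 - χ_α) z^α` of the mirror Laurent polynomial,
in the coordinates `z = t^u e^{iθ}`. -/
noncomputable def superpotential (F : SmoothCompleteFan n) (ν : Base n → ℝ) (t : ℝ)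
    (χ : (Fin n → ℤ) → Base n → ℝ) (x : Torus n) : ℂ :=
  -1 + ∑ α ∈ F.rays,
    (((1 - χ α x.1) * t ^ (inner ℝ (vec α) x.1 - ν (vec α)) : ℝ) : ℂ) *
      ((∑ i, α i • x.2 i : Real.Angle).toCircle : ℂ)

/-! ### The Lagrangians -/

/-- The projection to `ℝⁿ` of `ℒ`: the part of the component `Q` where `W`, which is
real on the zero section, is not positive. -/
def ballBase (F : SmoothCompleteFan n) (ν : Base n → ℝ) (t : ℝ)
    (χ : (Fin n → ℤ) → Base n → ℝ) : Set (Base n) :=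
  {u | u ∈ polytope F ν ∧ (superpotential F ν t χ (u, 0)).re ≤ 0}

/-- The graph in `(ℂ*)ⁿ` of the differential of `H`, over the subset `D` of `ℝⁿ`. -/
noncomputable def graphOver (D : Set (Base n)) (H : Base n → ℝ) : Set (Torus n) :=
  {x | x.1 ∈ D ∧ ∀ i, x.2 i = (gradient H x.1 i : Real.Angle)}

/-- The Lagrangian ball `ℒ`: the compact piece of the zero section bounded by the component of
its intersection with `W⁻¹(0)` near `∂Q`. -/
def zeroBall (F : SmoothCompleteFan n) (ν : Base n → ℝ) (t : ℝ)
    (χ : (Fin n → ℤ) → Base n → ℝ) : Set (Torus n) :=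
  {x | x.1 ∈ ballBase F ν t χ ∧ x.2 = 0}

/-- `S` is an exact section over `ℒ` whose boundary is a boundary for `ℒ(j)`: over the points of
`∂ℒ` near a face `σ` of `Q` (those where `χ α ≠ 1` exactly for the facets `α` containing `σ`)
the section takes values in the affine span of `-2πj σ`. -/
def IsTwist (F : SmoothCompleteFan n) (ν : Base n → ℝ) (t : ℝ)
    (χ : (Fin n → ℤ) → Base n → ℝ) (j : ℤ) (S : Set (Torus n)) : Prop :=
  ∃ H : Base n → ℝ, ContDiff ℝ ∞ H ∧ S = graphOver (ballBase F ν t χ) H ∧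
    ∀ u ∈ frontier (ballBase F ν t χ), ∀ α ∈ F.rays, χ α u ≠ 1 →
      inner ℝ (vec α) (gradient H u) = -(2 * Real.pi * j * ν (vec α))

/-- `(1/j) ℤⁿ`, for `j ≠ 0`. -/
def fracLattice (n : ℕ) (j : ℤ) : Set (Base n) :=
  {y | ∃ k : Fin n → ℤ, (j : ℝ) • y = vec k}

end ToricMirror

/-! Both Lagrangians are graphs over the ball `{f ≤ 0}`, where `f` (`potBase`) is the restriction of
`W` to the zero section. The generating function `H` of the twisted one must satisfy three demands:
parallel transport at the boundary, a prescribed quadratic form in the interior, and no intersection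
with the zero section in between.

Boundary. Let `F = cos ψ · Im W - sin ψ · Re W`. The Hamiltonian field of `F` is tangent to every
Lagrangian graph contained in `{F = 0}`, and it is proportional to the horizontal field over the ray
`-s e^{iψ}`. Hence a graph along which `W` has phase `ψ` near the boundary, and on whose boundary
all monomials have trivial phase, agrees with the transport of that boundary
(`agreesWithTransport_graphOver`). Such a graph is obtained from a solution of the Hamilton-Jacobi
equation `F(u, ∇K) = 0` with `K` and `∇K` zero on `{f = 0}`. For large `t` the gradient of `f` pairs
positively with `∑ w_α α` (`exists_nondegenerate`), so the initial data are noncharacteristic, and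
`K` is the action of the trajectories of `F` that leave the zero section over `{f = 0}`
(`exists_hamiltonJacobi`). The action is nonnegative, so `K` also serves as the collar coordinate
with which the solution is flattened towards the interior (`exists_collar`).

Twist. `W` does not change along a graph if the phase of every monomial present changes by a
multiple of `2π`. As `ν(α)` is an integer, adding `-2πj ∇g` is harmless if `⟨α, ∇g⟩ = ν(α)` near the
facet normal to `α`. A smooth `g` of this kind, within `O(e²)` of `|u|²/2`, is given by
`exists_facetAffine`: take the supremum over `y ∈ Q` of `⟨z, y⟩ - |y|²/2` plus a bonus that grows
with the number of facets through `y`, then mollify. Near a facet the bonus allows the supremum to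
be taken over that facet alone, so the function is affine in the normal direction.

Interpolation. Cutoffs lead from `g` to `(1 + ε')|u|²/2` and from the collar solution to a locally
constant function. An intersection point outside `V` would make every `⟨α, ∇H⟩ + 2πjν(α)` a multiple
of `2π`, whereas for some `α` this number lies strictly between `-2π` and `0`
(`exists_twistFunction`). All its terms have the same sign because `ε'` has the sign of `j` and the
constants and cutoffs are chosen accordingly; they are small because `e = |ε'|` is.

Counting. Over `V` an intersection means `j(1 + ε')u ∈ ℤⁿ`. On `(1/j)ℤⁿ` the facet functions take
values in `(1/j)ℤ`, so no lattice point lies in the thin shell between `(1 + ε')V` and `Q`, or the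
interior of `Q`. Expansion for `j > 0` retains the lattice points of `∂Q`, contraction for `j < 0`
loses them (`bijOn_fracLattice`). -/

namespace ToricMirror

/-! ### Composition operators on spaces of continuous curves -/

/-- The composition operator `y ↦ X ∘ y` on continuous curves. -/
def compOp {I A A' : Type*} [TopologicalSpace I] [TopologicalSpace A] [TopologicalSpace A']
    (X : C(A, A')) (y : C(I, A)) : C(I, A') := X.comp y

section CompositionOperator

variable {I : Type*} [TopologicalSpace I] [CompactSpace I]
variable {A A' : Type} [NormedAddCommGroup A] [NormedSpace ℝ A]
  [NormedAddCommGroup A'] [NormedSpace ℝ A']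

/-- The pointwise application of a curve of operators to a curve of vectors. -/
noncomputable def pointwiseApply : C(I, A →L[ℝ] A') →L[ℝ] C(I, A) →L[ℝ] C(I, A') :=
  LinearMap.mkContinuous₂
    (LinearMap.mk₂ ℝ (fun (Φ : C(I, A →L[ℝ] A')) (h : C(I, A)) =>
        (⟨fun r => Φ r (h r), by fun_prop⟩ : C(I, A')))
      (fun _ _ _ => by ext; simp) (fun _ _ _ => by ext; simp)
      (fun _ _ _ => by ext; simp) (fun _ _ _ => by ext; simp)) 1
    (fun Φ h => by
      rw [one_mul]
      refine (ContinuousMap.norm_le _ (by positivity)).2 fun r => ?_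
      exact ((Φ r).le_opNorm _).trans
        (mul_le_mul (Φ.norm_coe_le_norm r) (h.norm_coe_le_norm r) (norm_nonneg (h r)) (norm_nonneg Φ)))

/-- The derivative of a smooth map, as a continuous map. -/
noncomputable def fderivMap (X : C(A, A')) (hX : ContDiff ℝ ∞ X) : C(A, A →L[ℝ] A') :=
  ⟨fderiv ℝ X, hX.continuous_fderiv (by simp)⟩

/-- Continuity of the derivative of `X` is uniform at the compact range of `y`, so the mean value
inequality holds with one constant for all parameters of the curve. -/
lemma hasFDerivAt_compOp (X : C(A, A')) (hX : ContDiff ℝ ∞ X) (y : C(I, A)) :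
    HasFDerivAt (compOp X : C(I, A) → C(I, A')) (pointwiseApply (compOp (fderivMap X hX) y)) y := by
  rw [hasFDerivAt_iff_isLittleO, Asymptotics.isLittleO_iff]
  intro c hc
  have hK : IsCompact (range y) := isCompact_range y.continuous
  have hu := hK.uniformContinuousAt_of_continuousAt (fderiv ℝ X)
    (fun a _ => (hX.continuous_fderiv (by simp)).continuousAt) (Metric.dist_mem_uniformity hc)
  obtain ⟨δ, hδ, hδ'⟩ := Metric.mem_uniformity_dist.1 hu
  filter_upwards [Metric.ball_mem_nhds y hδ] with z hz
  refine (ContinuousMap.norm_le _ (by positivity)).2 fun r => ?_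
  have hzr : dist (z r) (y r) < δ := (ContinuousMap.dist_apply_le_dist r).trans_lt hz
  have := (convex_ball (y r) δ).norm_image_sub_le_of_norm_fderiv_le' (𝕜 := ℝ) (f := X)
    (φ := fderiv ℝ X (y r)) (C := c) (x := y r) (y := z r)
    (fun a _ => hX.differentiable (by simp) a)
    (fun a ha => by
      have := hδ' (a := y r) (b := a) (by rw [dist_comm]; exact ha) ⟨r, rfl⟩
      rw [← dist_eq_norm, dist_comm]; exact le_of_lt this)
    (Metric.mem_ball_self hδ) hzr
  exact this.trans (mul_le_mul_of_nonneg_left ((z - y).norm_coe_le_norm r) hc.le)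

/-- The derivative of a composition operator is again one, followed by a continuous linear map. The
target changes at each step of the induction and is therefore quantified. -/
lemma contDiff_compOp_nat (m : ℕ) : ∀ {A' : Type} [NormedAddCommGroup A'] [NormedSpace ℝ A']
    (X : C(A, A')), ContDiff ℝ ∞ X → ContDiff ℝ m (compOp X : C(I, A) → C(I, A')) := by
  induction m with
  | zero => exact fun X _ => contDiff_zero.2 (ContinuousMap.continuous_postcomp X)
  | succ m ih =>
    intro A' _ _ X hX
    push_cast
    rw [contDiff_succ_iff_hasFDerivAt]
    exact ⟨_, pointwiseApply.contDiff.comp (ih (fderivMap X hX) (hX.fderiv_right (by simp))),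
      hasFDerivAt_compOp X hX⟩

lemma contDiff_compOp (X : C(A, A')) (hX : ContDiff ℝ ∞ X) :
    ContDiff ℝ ∞ (compOp X : C(I, A) → C(I, A')) :=
  contDiff_infty.2 fun m => contDiff_compOp_nat m X hX

/-- Primitives of continuous curves. -/
noncomputable def primOp [CompleteSpace A] : C(Icc (0 : ℝ) 1, A) →L[ℝ] C(Icc (0 : ℝ) 1, A) :=
  LinearMap.mkContinuous
    { toFun := fun Y => ⟨fun r => ∫ x in (0 : ℝ)..r, Y (projIcc 0 1 zero_le_one x), by
        have : Continuous fun b : ℝ => ∫ x in (0 : ℝ)..b, Y (projIcc 0 1 zero_le_one x) :=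
          intervalIntegral.continuous_primitive
            (fun a b => (Y.continuous.comp continuous_projIcc).intervalIntegrable a b) 0
        exact this.comp continuous_subtype_val⟩
      map_add' := fun Y Y' => by
        ext r
        exact intervalIntegral.integral_add
          ((Y.continuous.comp continuous_projIcc).intervalIntegrable _ _)
          ((Y'.continuous.comp continuous_projIcc).intervalIntegrable _ _)
      map_smul' := fun c Y => by
        ext r
        exact intervalIntegral.integral_smul _ _ } 1
    (fun Y => by
      rw [one_mul]
      refine (ContinuousMap.norm_le _ (by positivity)).2 fun r => ?_
      refine (intervalIntegral.norm_integral_le_of_norm_le_const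
        (fun x _ => Y.norm_coe_le_norm _)).trans ?_
      have h1 : |(r : ℝ) - 0| ≤ 1 := by
        rw [sub_zero, abs_of_nonneg r.2.1]; exact r.2.2
      nlinarith [norm_nonneg Y])

lemma primOp_apply [CompleteSpace A] (Y : C(Icc (0 : ℝ) 1, A)) (r : Icc (0 : ℝ) 1) :
    primOp Y r = ∫ x in (0 : ℝ)..r, Y (projIcc 0 1 zero_le_one x) := rfl

end CompositionOperator

/-! ### The inverse function theorem near a compact set -/

/-- A smooth map which is injective on a compact set, with invertible derivative at its points, is
a diffeomorphism near this set. -/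
lemma exists_contDiffOn_inverse {M M' : Type*} [NormedAddCommGroup M] [NormedSpace ℝ M]
    [CompleteSpace M] [NormedAddCommGroup M'] [NormedSpace ℝ M'] [CompleteSpace M']
    {Ω : M → M'} (hΩ : ContDiff ℝ ∞ Ω)
    {T : Set M} (hT : IsCompact T) (hinj : InjOn Ω T) (hinv : ∀ v ∈ T, (fderiv ℝ Ω v).IsInvertible)
    {O : Set M} (hO : IsOpen O) (hTO : T ⊆ O) :
    ∃ (W : Set M') (g : M' → M), IsOpen W ∧ Ω '' T ⊆ W ∧ ContDiffOn ℝ ∞ g W ∧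
      (∀ w ∈ W, g w ∈ O ∧ Ω (g w) = w) ∧ ∀ v ∈ T, g (Ω v) = v := by
  have hstrict : ∀ v, (fderiv ℝ Ω v).IsInvertible → ∃ L : M ≃L[ℝ] M',
      HasStrictFDerivAt Ω (L : M →L[ℝ] M') v := fun v ⟨L, hL⟩ =>
    ⟨L, by rw [hL]; exact hΩ.contDiffAt.hasStrictFDerivAt (by simp)⟩
  have hloc : ∀ v ∈ T, ∃ u ∈ 𝓝 v, InjOn Ω u := fun v hv => by
    obtain ⟨L, hL⟩ := hstrict v (hinv v hv)
    exact ⟨_, (hL.toOpenPartialHomeomorph Ω).open_source.mem_nhds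
      hL.mem_toOpenPartialHomeomorph_source, (hL.toOpenPartialHomeomorph Ω).injOn⟩
  -- Injectivity on a compact set and local injectivity at its points give injectivity near the set.
  obtain ⟨U₀, hU₀, hinj₀⟩ := hinj.exists_mem_nhdsSet hT
    (fun v _ => hΩ.continuous.continuousAt) hloc
  obtain ⟨U₁, hU₁, hTU₁, hU₁₀⟩ := mem_nhdsSet_iff_exists.1 hU₀
  have hopen : IsOpen {v | (fderiv ℝ Ω v).IsInvertible} :=
    ContinuousLinearEquiv.isOpen.preimage (hΩ.continuous_fderiv (by simp))
  set U := (U₁ ∩ O) ∩ {v | (fderiv ℝ Ω v).IsInvertible} with hU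
  have hUo : IsOpen U := (hU₁.inter hO).inter hopen
  have hTU : T ⊆ U := fun v hv => ⟨⟨hTU₁ hv, hTO hv⟩, hinv v hv⟩
  have hUinj : InjOn Ω U := hinj₀.mono fun v hv => hU₁₀ hv.1.1
  by_cases hne : Nonempty M
  swap
  · exact ⟨∅, fun _ => 0, isOpen_empty, by
      rintro _ ⟨v, _⟩; exact (hne ⟨v⟩).elim, contDiffOn_empty, by simp, fun v => (hne ⟨v⟩).elim⟩
  have hleft : ∀ v ∈ U, Function.invFunOn Ω U (Ω v) = v := fun v hv =>
    hUinj.leftInvOn_invFunOn hv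
  refine ⟨Ω '' U, Function.invFunOn Ω U, ?_, image_mono hTU, ?_, ?_, fun v hv => hleft v (hTU hv)⟩
  · rw [isOpen_iff_mem_nhds]
    rintro _ ⟨v, hv, rfl⟩
    obtain ⟨L, hL⟩ := hstrict v hv.2
    rw [← hL.map_nhds_eq_of_equiv]
    exact image_mem_map (hUo.mem_nhds hv)
  · rintro _ ⟨v, hv, rfl⟩
    obtain ⟨L, hL⟩ := hstrict v hv.2
    have hsm : ContDiffAt ℝ ∞ (hΩ.contDiffAt.localInverse hL.hasFDerivAt (by simp)) (Ω v) :=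
      ContDiffAt.to_localInverse hΩ.contDiffAt hL.hasFDerivAt (by simp)
    -- By injectivity on `U`, the global inverse coincides near `Ω v` with the local one, which is
    -- smooth.
    refine (hsm.congr_of_eventuallyEq ?_).contDiffWithinAt
    have h1 : ∀ᶠ w in 𝓝 (Ω v), Ω (hL.localInverse Ω L v w) = w := hL.eventually_right_inverse
    have h2 : ∀ᶠ w in 𝓝 (Ω v), hL.localInverse Ω L v w ∈ U := by
      have := hL.localInverse_continuousAt
      rw [ContinuousAt, hL.localInverse_apply_image] at this
      exact this (hUo.mem_nhds hv)
    filter_upwards [h1, h2] with w hw1 hw2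
    have := hleft _ hw2
    rw [hw1] at this
    exact this
  · rintro _ ⟨v, hv, rfl⟩
    rw [hleft v hv]
    exact ⟨hv.1.2, rfl⟩

/-! ### The Hamilton-Jacobi equation -/

section HamiltonJacobi

variable {E : Type} [NormedAddCommGroup E] [InnerProductSpace ℝ E] [CompleteSpace E]

/-- The Riesz isomorphism as a real-linear map. -/
noncomputable def riesz : (E →L[ℝ] ℝ) →L[ℝ] E :=
  LinearMap.mkContinuous
    { toFun := (InnerProductSpace.toDual ℝ E).symm
      map_add' := fun a b => by simp
      map_smul' := fun c a => by simp } 1 (fun a => by simp)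

lemma inner_riesz (L : E →L[ℝ] ℝ) (x : E) : inner ℝ (riesz L) x = L x :=
  InnerProductSpace.toDual_symm_apply

/-- The partial gradient of a function of `(q, p)` in the first variable. -/
noncomputable def gradQ (F : E × E → ℝ) (z : E × E) : E :=
  riesz ((fderiv ℝ F z).comp (ContinuousLinearMap.inl ℝ E E))

/-- The partial gradient of a function of `(q, p)` in the second variable. -/
noncomputable def gradP (F : E × E → ℝ) (z : E × E) : E :=
  riesz ((fderiv ℝ F z).comp (ContinuousLinearMap.inr ℝ E E))

lemma fderiv_eq_gradQ_add_gradP (F : E × E → ℝ) (z v : E × E) :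
    fderiv ℝ F z v = inner ℝ (gradQ F z) v.1 + inner ℝ (gradP F z) v.2 := by
  rw [gradQ, gradP, inner_riesz, inner_riesz, ContinuousLinearMap.comp_apply,
    ContinuousLinearMap.comp_apply, ← map_add]
  simp

lemma contDiff_gradQ {F : E × E → ℝ} (hF : ContDiff ℝ ∞ F) : ContDiff ℝ ∞ (gradQ F) :=
  riesz.contDiff.comp ((hF.fderiv_right (by simp)).clm_comp contDiff_const)

lemma contDiff_gradP {F : E × E → ℝ} (hF : ContDiff ℝ ∞ F) : ContDiff ℝ ∞ (gradP F) :=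
  riesz.contDiff.comp ((hF.fderiv_right (by simp)).clm_comp contDiff_const)

/-- The Hamiltonian vector field of `F`. -/
noncomputable def hamField (F : E × E → ℝ) (z : E × E) : E × E := (gradP F z, -gradQ F z)

lemma contDiff_hamField {F : E × E → ℝ} (hF : ContDiff ℝ ∞ F) : ContDiff ℝ ∞ (hamField F) :=
  (contDiff_gradP hF).prodMk (contDiff_gradQ hF).neg

lemma fderiv_hamField (F : E × E → ℝ) (z : E × E) : fderiv ℝ F z (hamField F z) = 0 := by
  rw [fderiv_eq_gradQ_add_gradP, hamField, inner_neg_right, real_inner_comm]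
  simp

/-- Constant curves. -/
noncomputable def constOp {A : Type} [NormedAddCommGroup A] [NormedSpace ℝ A] :
    A →L[ℝ] C(Icc (0 : ℝ) 1, A) :=
  LinearMap.mkContinuous
    { toFun := fun a => ContinuousMap.const _ a
      map_add' := fun a b => rfl
      map_smul' := fun c a => rfl } 1
    (fun a => by
      rw [one_mul]
      exact (ContinuousMap.norm_le _ (norm_nonneg a)).2 fun r => le_rfl)

@[simp] lemma constOp_apply {A : Type} [NormedAddCommGroup A] [NormedSpace ℝ A] (a : A)
    (r : Icc (0 : ℝ) 1) : constOp a r = a := rfl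

/-- Primitives of curves in `E × E`, normalized so that the first component vanishes at `1` and
the second one vanishes at `0`. -/
noncomputable def mixedPrim : C(Icc (0 : ℝ) 1, E × E) →L[ℝ] C(Icc (0 : ℝ) 1, E × E) :=
  primOp - constOp ∘L (ContinuousLinearMap.inl ℝ E E ∘L ContinuousLinearMap.fst ℝ E E ∘L
    ContinuousMap.evalCLM ℝ (1 : Icc (0 : ℝ) 1) ∘L primOp)

lemma mixedPrim_apply (Y : C(Icc (0 : ℝ) 1, E × E)) (r : Icc (0 : ℝ) 1) :
    mixedPrim Y r = primOp Y r - ((primOp Y 1).1, 0) := rfl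

lemma hasDerivAt_prim {A : Type} [NormedAddCommGroup A] [NormedSpace ℝ A] [CompleteSpace A]
    (Y : C(Icc (0 : ℝ) 1, A)) (r : ℝ) :
    HasDerivAt (fun r => ∫ x in (0 : ℝ)..r, Y (projIcc 0 1 zero_le_one x))
      (Y (projIcc 0 1 zero_le_one r)) r :=
  ((Y.continuous.comp continuous_projIcc).integral_hasStrictDerivAt 0 r).hasDerivAt

@[simp] lemma primOp_zero {A : Type} [NormedAddCommGroup A] [NormedSpace ℝ A] [CompleteSpace A]
    (Y : C(Icc (0 : ℝ) 1, A)) : primOp Y 0 = 0 := by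
  simp [primOp_apply]

/-- The Hamiltonian vector field as a continuous map. -/
noncomputable def hamMap {F : E × E → ℝ} (hF : ContDiff ℝ ∞ F) : C(E × E, E × E) :=
  ⟨hamField F, (contDiff_hamField hF).continuous⟩

/-- A time-rescaled Hamiltonian trajectory from the zero section to the cotangent fibre at `u`. -/
def IsTrajectory {F : E × E → ℝ} (hF : ContDiff ℝ ∞ F) (u : E) (τ : ℝ)
    (y : C(Icc (0 : ℝ) 1, E × E)) : Prop :=
  y = constOp (u, 0) + τ • mixedPrim (compOp (hamMap hF) y)

lemma IsTrajectory.apply {F : E × E → ℝ} {hF : ContDiff ℝ ∞ F} {u : E} {τ : ℝ}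
    {y : C(Icc (0 : ℝ) 1, E × E)} (h : IsTrajectory hF u τ y) (r : Icc (0 : ℝ) 1) :
    y r = (u, 0) + τ • (primOp (compOp (hamMap hF) y) r -
      ((primOp (compOp (hamMap hF) y) 1).1, 0)) := by
  conv_lhs => rw [h]
  rfl

lemma IsTrajectory.apply_one {F : E × E → ℝ} {hF : ContDiff ℝ ∞ F} {u : E} {τ : ℝ}
    {y : C(Icc (0 : ℝ) 1, E × E)} (h : IsTrajectory hF u τ y) : (y 1).1 = u := by
  rw [h.apply]; simp

lemma IsTrajectory.apply_zero {F : E × E → ℝ} {hF : ContDiff ℝ ∞ F} {u : E} {τ : ℝ}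
    {y : C(Icc (0 : ℝ) 1, E × E)} (h : IsTrajectory hF u τ y) : (y 0).2 = 0 := by
  rw [h.apply]; simp

/-- The integrand is extended constantly beyond `[0, 1]`, which makes two-sided derivatives
available at the endpoints. -/
lemma IsTrajectory.hasDerivAt {F : E × E → ℝ} {hF : ContDiff ℝ ∞ F} {u : E} {τ : ℝ}
    {y : C(Icc (0 : ℝ) 1, E × E)} (h : IsTrajectory hF u τ y) :
    ∃ Y : ℝ → E × E, (∀ r : Icc (0 : ℝ) 1, Y r = y r) ∧
      ∀ r : ℝ, HasDerivAt Y (τ • hamField F (y (projIcc 0 1 zero_le_one r))) r := by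
  refine ⟨fun r => (u, 0) + τ • ((∫ x in (0 : ℝ)..r,
    compOp (hamMap hF) y (projIcc 0 1 zero_le_one x)) -
      ((primOp (compOp (hamMap hF) y) 1).1, 0)), fun r => ?_, fun r => ?_⟩
  · exact (h.apply r).symm
  · exact (((hasDerivAt_prim (compOp (hamMap hF) y) r).sub_const _).const_smul τ).const_add _

lemma IsTrajectory.energy {F : E × E → ℝ} {hF : ContDiff ℝ ∞ F} {u : E} {τ : ℝ}
    {y : C(Icc (0 : ℝ) 1, E × E)} (h : IsTrajectory hF u τ y) (r : Icc (0 : ℝ) 1) :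
    F (y r) = F ((y 0).1, 0) := by
  obtain ⟨Y, hY, hd⟩ := h.hasDerivAt
  have h0 : ((y 0).1, 0) = Y 0 := by
    rw [show Y 0 = y 0 from hY 0, ← h.apply_zero]
  have hdF : ∀ x ∈ Ico (0 : ℝ) 1, HasDerivWithinAt (fun r => F (Y r)) 0 (Ici x) x := by
    intro x hx
    have := (hF.differentiable (by simp) (Y x)).hasFDerivAt.comp_hasDerivAt x (hd x)
    have hx' : Y x = y (projIcc 0 1 zero_le_one x) := by
      rw [← hY, projIcc_of_mem zero_le_one ⟨hx.1, hx.2.le⟩]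
    rw [← hx', map_smul, fderiv_hamField, smul_zero] at this
    exact this.hasDerivWithinAt
  have hc : ContinuousOn (fun r => F (Y r)) (Icc 0 1) := fun x _ =>
    (hF.continuous.continuousAt.comp (hd x).continuousAt).continuousWithinAt
  have := constant_of_has_deriv_right_zero hc hdF r r.2
  rw [← hY, this, h0]

/-- The integral of a curve. -/
noncomputable def integralOp {A : Type} [NormedAddCommGroup A] [NormedSpace ℝ A]
    [CompleteSpace A] : C(Icc (0 : ℝ) 1, A) →L[ℝ] A :=
  (ContinuousMap.evalCLM ℝ (1 : Icc (0 : ℝ) 1)).comp primOp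

/-- The action of a curve. -/
noncomputable def action {F : E × E → ℝ} (hF : ContDiff ℝ ∞ F) (τ : ℝ)
    (y : C(Icc (0 : ℝ) 1, E × E)) : ℝ :=
  τ * integralOp (compOp (⟨fun z => inner ℝ z.2 (gradP F z),
    continuous_snd.inner (contDiff_gradP hF).continuous⟩ : C(E × E, ℝ)) y)

lemma action_eq {F : E × E → ℝ} (hF : ContDiff ℝ ∞ F) (τ : ℝ) (y : C(Icc (0 : ℝ) 1, E × E)) :
    action hF τ y = τ * ∫ r in (0 : ℝ)..1, inner ℝ (y (projIcc 0 1 zero_le_one r)).2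
      (gradP F (y (projIcc 0 1 zero_le_one r))) := rfl

lemma contDiff_action {F : E × E → ℝ} (hF : ContDiff ℝ ∞ F) :
    ContDiff ℝ ∞ (fun v : ℝ × C(Icc (0 : ℝ) 1, E × E) => action hF v.1 v.2) := by
  refine contDiff_fst.mul ?_
  refine (integralOp (A := ℝ)).contDiff.comp
    ((contDiff_compOp _ ?_).comp contDiff_snd)
  exact contDiff_snd.inner ℝ (contDiff_gradP hF)

/-- The action of a family of trajectories of zero energy has differential `p dq`. -/
lemma hasFDerivAt_action {F : E × E → ℝ} (hF : ContDiff ℝ ∞ F) {u : E} {τ : E → ℝ}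
    {y : E → C(Icc (0 : ℝ) 1, E × E)} (hτ : DifferentiableAt ℝ τ u) (hy : DifferentiableAt ℝ y u)
    (htraj : ∀ᶠ v in 𝓝 u, IsTrajectory hF v (τ v) (y v))
    (hE : ∀ᶠ v in 𝓝 u, F ((y v 0).1, 0) = 0) :
    HasFDerivAt (fun v => action hF (τ v) (y v)) (innerSL ℝ (y u 1).2) u := by
  set Y := compOp (hamMap hF) (y u) with hYdef
  set k : C(E × E, ℝ) := ⟨fun z => inner ℝ z.2 (gradP F z),
    continuous_snd.inner (contDiff_gradP hF).continuous⟩ with hk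
  have hksm : ContDiff ℝ ∞ k := contDiff_snd.inner ℝ (contDiff_gradP hF)
  set DY := pointwiseApply (compOp (fderivMap (hamMap hF) (contDiff_hamField hF)) (y u)) with hDY
  have hcY : HasFDerivAt (fun v => compOp (hamMap hF) (y v)) (DY ∘L fderiv ℝ y u) u :=
    (hasFDerivAt_compOp (hamMap hF) (contDiff_hamField hF) (y u)).comp u hy.hasFDerivAt
  have hk1 : HasFDerivAt (fun v => compOp k (y v))
      (pointwiseApply (compOp (fderivMap k hksm) (y u)) ∘L fderiv ℝ y u) u :=
    (hasFDerivAt_compOp k hksm (y u)).comp u hy.hasFDerivAt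
  have hK : HasFDerivAt (fun v => action hF (τ v) (y v)) _ u :=
    hτ.hasFDerivAt.mul ((integralOp (A := ℝ)).hasFDerivAt.comp u hk1)
  have hyd : HasFDerivAt y (constOp ∘L ContinuousLinearMap.inl ℝ E E +
      (τ u • (mixedPrim ∘L (DY ∘L fderiv ℝ y u)) +
        (fderiv ℝ τ u).smulRight (mixedPrim Y))) u := by
    have h1 : HasFDerivAt (fun v => (constOp (v, (0 : E)) : C(Icc (0 : ℝ) 1, E × E)))
        (constOp ∘L ContinuousLinearMap.inl ℝ E E) u :=
      (constOp ∘L ContinuousLinearMap.inl ℝ E E).hasFDerivAt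
    have h2 := hτ.hasFDerivAt.smul ((mixedPrim (E := E)).hasFDerivAt.comp u hcY)
    refine (h1.add h2).congr_of_eventuallyEq ?_
    filter_upwards [htraj] with v hv
    exact hv
  refine hK.congr_fderiv ?_
  ext δ
  set dy := fderiv ℝ y u δ with hdy
  set Z := fderiv ℝ τ u δ • Y + τ u • DY dy with hZ
  -- The linearized trajectory equation; `Z` is the variation of the rescaled field `τ X_F`.
  have hdyZ : dy = constOp (δ, 0) + mixedPrim Z := by
    have h1 : dy = constOp (δ, 0) +
        (τ u • mixedPrim (DY (fderiv ℝ y u δ)) + fderiv ℝ τ u δ • mixedPrim Y) := by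
      rw [hdy]
      exact congrArg (fun L => L δ) hyd.fderiv
    rw [h1, hZ, map_add, map_smul, map_smul, add_comm (τ u • _)]
  -- The whole family lies in `{F = 0}`, so `dF` kills the variation. This is why `∫ p dq`, without
  -- an energy term, has the right differential.
  have hen : ∀ r, inner ℝ (gradQ F (y u r)) (dy r).1 + inner ℝ (gradP F (y u r)) (dy r).2 = 0 := by
    intro r
    rw [← fderiv_eq_gradQ_add_gradP]
    have h1 : HasFDerivAt (fun v => F (y v r)) ((fderiv ℝ F (y u r)) ∘L
        ((ContinuousMap.evalCLM ℝ r) ∘L fderiv ℝ y u)) u :=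
      HasFDerivAt.comp u (hF.differentiable (by simp) (y u r)).hasFDerivAt
        (HasFDerivAt.comp (g := fun z : C(Icc (0 : ℝ) 1, E × E) => z r) u
          (ContinuousMap.evalCLM ℝ r :
            C(Icc (0 : ℝ) 1, E × E) →L[ℝ] E × E).hasFDerivAt hy.hasFDerivAt)
    have h2 : HasFDerivAt (fun v => F (y v r)) (0 : E →L[ℝ] ℝ) u := by
      refine (hasFDerivAt_const (0 : ℝ) u).congr_of_eventuallyEq ?_
      filter_upwards [htraj, hE] with v hv hv'
      rw [hv.energy, hv']
    exact congrArg (fun L => L δ) (h1.unique h2)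
  obtain ⟨P, hP, hPd⟩ := htraj.self_of_nhds.hasDerivAt
  set π := projIcc (0 : ℝ) 1 zero_le_one with hπ
  set Q : ℝ → E := fun r => δ + ((∫ x in (0 : ℝ)..r, Z (π x)) - ((primOp Z 1).1, 0)).1 with hQ
  have hQd : ∀ r, HasDerivAt Q (Z (π r)).1 r := fun r =>
    ((ContinuousLinearMap.fst ℝ E E).hasFDerivAt.comp_hasDerivAt r
      ((hasDerivAt_prim Z r).sub_const ((primOp Z 1).1, 0))).const_add δ
  have hQdy : ∀ r : Icc (0 : ℝ) 1, Q r = (dy r).1 := fun r => by rw [hdyZ]; rfl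
  -- The variation of the integrand is the time derivative of `⟨p, δq⟩`; only the end term at time
  -- `1` survives, as `p` vanishes at time `0`.
  have hΦ : ∀ r ∈ uIcc (0 : ℝ) 1, HasDerivAt (fun r => inner ℝ (P r).2 (Q r))
      (fderiv ℝ τ u δ * k (y u (π r)) + τ u * fderiv ℝ k (y u (π r)) (dy (π r))) r := by
    intro r hr
    rw [uIcc_of_le zero_le_one] at hr
    have hr' : π r = ⟨r, hr⟩ := projIcc_of_mem zero_le_one hr
    have h1 := (hasFDerivAt_snd.comp_hasDerivAt r (hPd r)).inner ℝ (hQd r)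
    refine h1.congr_deriv ?_
    have hkd : fderiv ℝ k (y u (π r)) (dy (π r)) =
        inner ℝ (dy (π r)).2 (gradP F (y u (π r))) +
          inner ℝ (y u (π r)).2 (DY dy (π r)).1 := by
      have hXd : HasFDerivAt (gradP F) ((ContinuousLinearMap.fst ℝ E E) ∘L
          fderiv ℝ (hamField F) (y u (π r))) (y u (π r)) :=
        HasFDerivAt.comp (g := Prod.fst) _ hasFDerivAt_fst
          ((contDiff_hamField hF).differentiable (by simp) _).hasFDerivAt
      have : HasFDerivAt k _ (y u (π r)) := hasFDerivAt_snd.inner ℝ hXd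
      rw [this.fderiv]
      simp only [ContinuousLinearMap.comp_apply, fderivInnerCLM_apply,
        ContinuousLinearMap.prod_apply, ContinuousLinearMap.coe_snd', ContinuousLinearMap.coe_fst']
      rw [add_comm]
      rfl
    rw [hkd]
    have hPr : P r = y u (π r) := by rw [hr']; exact hP ⟨r, hr⟩
    have hQr : Q r = (dy (π r)).1 := by rw [hr']; exact hQdy ⟨r, hr⟩
    have hZr : (Z (π r)).1 = fderiv ℝ τ u δ • gradP F (y u (π r)) + τ u • (DY dy (π r)).1 := rfl
    have hkr : k (y u (π r)) = inner ℝ (y u (π r)).2 (gradP F (y u (π r))) := rfl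
    have := hen (π r)
    simp only [Function.comp_apply, ContinuousLinearMap.coe_snd', Prod.smul_snd, hamField]
    rw [hPr, hQr, hZr, hkr, inner_add_right, inner_smul_right, inner_smul_right, inner_smul_left,
      inner_neg_left, real_inner_comm (gradP F (y u (π r))) (dy (π r)).2]
    simp only [conj_trivial]
    linear_combination (- τ u) * this
  have hπc : Continuous π := continuous_projIcc
  have hyc : Continuous fun r => y u (π r) := (y u).continuous.comp hπc
  have hc1 : Continuous fun r => fderiv ℝ τ u δ * k (y u (π r)) :=
    continuous_const.mul (k.continuous.comp hyc)
  have hc2 : Continuous fun r => τ u * fderiv ℝ k (y u (π r)) (dy (π r)) :=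
    continuous_const.mul
      (((hksm.continuous_fderiv (by simp)).comp hyc).clm_apply (dy.continuous.comp hπc))
  have hint := intervalIntegral.integral_eq_sub_of_hasDerivAt hΦ ((hc1.add hc2).intervalIntegrable 0 1)
  have hP1 : P 1 = y u 1 := hP 1
  have hP0 : (P 0).2 = 0 := by rw [show P 0 = y u 0 from hP 0, htraj.self_of_nhds.apply_zero]
  have hQ1 : Q 1 = δ := by
    rw [show Q 1 = (dy 1).1 from hQdy 1, hdyZ]
    simp [mixedPrim_apply]
  rw [hP0, hP1, hQ1, inner_zero_left, sub_zero] at hint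
  rw [innerSL_apply_apply, ← hint]
  rw [intervalIntegral.integral_add (hc1.intervalIntegrable _ _) (hc2.intervalIntegrable _ _),
    intervalIntegral.integral_const_mul, intervalIntegral.integral_const_mul, add_comm,
    mul_comm (fderiv ℝ τ u δ)]
  rfl

/-- Since `p(r) = -τ ∫₀ʳ ∂F/∂q`, the integrand `τ⟨p, ∂F/∂p⟩` is `τ²` times an integral of positive
numbers, whatever the sign of `τ`. It pairs gradients taken at two different times. -/
lemma IsTrajectory.action_pos {F : E × E → ℝ} {hF : ContDiff ℝ ∞ F} {u : E} {τ : ℝ}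
    {y : C(Icc (0 : ℝ) 1, E × E)} (h : IsTrajectory hF u τ y) (hτ : τ ≠ 0)
    (hneg : ∀ r r', inner ℝ (gradQ F (y r)) (gradP F (y r')) < 0) : 0 < action hF τ y := by
  set π := projIcc (0 : ℝ) 1 zero_le_one with hπ
  have hyc : Continuous fun r => y (π r) := y.continuous.comp continuous_projIcc
  have hQc : Continuous fun r => gradQ F (y (π r)) := (contDiff_gradQ hF).continuous.comp hyc
  have hPc : Continuous fun r => gradP F (y (π r)) := (contDiff_gradP hF).continuous.comp hyc
  have hp : ∀ r ∈ Ioo (0 : ℝ) 1, 0 < τ * inner ℝ (y (π r)).2 (gradP F (y (π r))) := by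
    intro r hr
    have hr' : π r = ⟨r, hr.1.le, hr.2.le⟩ := projIcc_of_mem zero_le_one ⟨hr.1.le, hr.2.le⟩
    have h1 : (y (π r)).2 = τ • ∫ x in (0 : ℝ)..r, -gradQ F (y (π x)) := by
      have h2 : (∫ x in (0 : ℝ)..r, compOp (hamMap hF) y (π x)).2 =
          ∫ x in (0 : ℝ)..r, -gradQ F (y (π x)) :=
        ((ContinuousLinearMap.snd ℝ E E).intervalIntegral_comp_comm
          ((((compOp (hamMap hF) y).continuous.comp continuous_projIcc)).intervalIntegrable 0 r)).symm
      have h3 : ((π r : Icc (0 : ℝ) 1) : ℝ) = r := by rw [hr']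
      rw [h.apply, primOp_apply, h3, ← h2]
      simp only [Prod.snd_add, Prod.smul_snd, Prod.snd_sub, sub_zero, zero_add, hπ]
    rw [h1, inner_smul_left, real_inner_comm]
    have h3 : inner ℝ (gradP F (y (π r))) (∫ x in (0 : ℝ)..r, -gradQ F (y (π x))) =
        ∫ x in (0 : ℝ)..r, inner ℝ (gradP F (y (π r))) (-gradQ F (y (π x))) :=
      ((innerSL ℝ (gradP F (y (π r)))).intervalIntegral_comp_comm
        (hQc.neg.intervalIntegrable 0 r)).symm
    rw [h3]
    have h4 : 0 < ∫ x in (0 : ℝ)..r, inner ℝ (gradP F (y (π r))) (-gradQ F (y (π x))) := by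
      refine intervalIntegral.intervalIntegral_pos_of_pos
        ((continuous_const.inner hQc.neg).intervalIntegrable _ _) (fun x => ?_) hr.1
      rw [inner_neg_right, real_inner_comm]
      exact neg_pos.2 (hneg _ _)
    have : 0 < τ * τ := mul_self_pos.2 hτ
    simp only [conj_trivial]
    rw [← mul_assoc]
    positivity
  rw [action_eq, ← intervalIntegral.integral_const_mul]
  refine intervalIntegral.intervalIntegral_pos_of_pos_on
    ((continuous_const.mul ((continuous_snd.comp hyc).inner hPc)).intervalIntegrable _ _) hp
    zero_lt_one

/-- The map whose local inverse parametrizes Hamiltonian trajectories by their endpoints. -/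
noncomputable def trajMap {F : E × E → ℝ} (hF : ContDiff ℝ ∞ F)
    (v : E × ℝ × C(Icc (0 : ℝ) 1, E × E)) : E × ℝ × C(Icc (0 : ℝ) 1, E × E) :=
  (v.1, F ((v.2.2 0).1, 0),
    v.2.2 - (constOp (v.1, 0) + v.2.1 • mixedPrim (compOp (hamMap hF) v.2.2)))

lemma contDiff_trajMap {F : E × E → ℝ} (hF : ContDiff ℝ ∞ F) : ContDiff ℝ ∞ (trajMap hF) := by
  refine contDiff_fst.prodMk (ContDiff.prodMk ?_ ?_)
  · refine hF.comp (ContDiff.prodMk ?_ contDiff_const)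
    exact contDiff_fst.comp ((ContinuousMap.evalCLM ℝ (0 : Icc (0 : ℝ) 1) :
      C(Icc (0 : ℝ) 1, E × E) →L[ℝ] E × E).contDiff.comp (contDiff_snd.comp contDiff_snd))
  · have h1 : ContDiff ℝ ∞ fun v : E × ℝ × C(Icc (0 : ℝ) 1, E × E) => v.2.1 :=
      contDiff_fst.comp contDiff_snd
    have h2 : ContDiff ℝ ∞ fun v : E × ℝ × C(Icc (0 : ℝ) 1, E × E) =>
        mixedPrim (compOp (hamMap hF) v.2.2) := (mixedPrim (E := E)).contDiff.comp
        ((contDiff_compOp _ (contDiff_hamField hF)).comp (contDiff_snd.comp contDiff_snd))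
    exact (contDiff_snd.comp contDiff_snd).sub (((constOp (A := E × E)).contDiff.comp
      (contDiff_fst.prodMk contDiff_const)).add (h1.smul h2))

/-- At `τ = 0` the linearization of the vector field drops out, and only its value at the constant
curve remains. -/
lemma fderiv_trajMap {F : E × E → ℝ} (hF : ContDiff ℝ ∞ F) (x : E)
    (v : E × ℝ × C(Icc (0 : ℝ) 1, E × E)) :
    fderiv ℝ (trajMap hF) (x, 0, constOp (x, 0)) v =
      (v.1, inner ℝ (gradQ F (x, 0)) (v.2.2 0).1,
        v.2.2 - (constOp (v.1, 0) + v.2.1 • mixedPrim (constOp (hamField F (x, 0))))) := by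
  have hev : ∀ z, HasFDerivAt (fun z : C(Icc (0 : ℝ) 1, E × E) => z 0)
      (ContinuousMap.evalCLM ℝ (0 : Icc (0 : ℝ) 1) :
        C(Icc (0 : ℝ) 1, E × E) →L[ℝ] E × E) z := fun z =>
    (ContinuousMap.evalCLM ℝ (0 : Icc (0 : ℝ) 1) :
      C(Icc (0 : ℝ) 1, E × E) →L[ℝ] E × E).hasFDerivAt
  set t : E × ℝ × C(Icc (0 : ℝ) 1, E × E) := (x, 0, constOp (x, 0)) with ht
  have h22 : HasFDerivAt (fun v : E × ℝ × C(Icc (0 : ℝ) 1, E × E) => v.2.2)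
      (ContinuousLinearMap.snd ℝ ℝ _ ∘L ContinuousLinearMap.snd ℝ E _) t :=
    (ContinuousLinearMap.snd ℝ ℝ C(Icc (0 : ℝ) 1, E × E) ∘L
      ContinuousLinearMap.snd ℝ E _).hasFDerivAt
  have h21 : HasFDerivAt (fun v : E × ℝ × C(Icc (0 : ℝ) 1, E × E) => v.2.1)
      (ContinuousLinearMap.fst ℝ ℝ _ ∘L ContinuousLinearMap.snd ℝ E _) t :=
    (ContinuousLinearMap.fst ℝ ℝ C(Icc (0 : ℝ) 1, E × E) ∘L
      ContinuousLinearMap.snd ℝ E _).hasFDerivAt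
  have h1 : HasFDerivAt (fun v : E × ℝ × C(Icc (0 : ℝ) 1, E × E) => (((v.2.2 0).1, 0) : E × E)) _
      t := ((ContinuousLinearMap.fst ℝ E E).hasFDerivAt.comp t ((hev _).comp t h22)).prodMk
        (hasFDerivAt_const (0 : E) t)
  have h2 : HasFDerivAt (fun v : E × ℝ × C(Icc (0 : ℝ) 1, E × E) => F ((v.2.2 0).1, 0)) _ t :=
    HasFDerivAt.comp (g := F) t (hF.differentiable (by simp) (x, 0)).hasFDerivAt h1
  have h3 : HasFDerivAt (fun v : E × ℝ × C(Icc (0 : ℝ) 1, E × E) =>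
      mixedPrim (compOp (hamMap hF) v.2.2)) _ t :=
    (mixedPrim (E := E)).hasFDerivAt.comp t
      ((hasFDerivAt_compOp (hamMap hF) (contDiff_hamField hF) _).comp t h22)
  have h4 : HasFDerivAt (fun v : E × ℝ × C(Icc (0 : ℝ) 1, E × E) =>
      (constOp (v.1, 0) : C(Icc (0 : ℝ) 1, E × E)))
      (constOp ∘L ContinuousLinearMap.inl ℝ E E ∘L ContinuousLinearMap.fst ℝ E _) t :=
    (constOp ∘L ContinuousLinearMap.inl ℝ E E ∘L
      ContinuousLinearMap.fst ℝ E (ℝ × C(Icc (0 : ℝ) 1, E × E))).hasFDerivAt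
  have h5 : HasFDerivAt (trajMap hF) _ t :=
    hasFDerivAt_fst.prodMk (h2.prodMk (h22.sub (h4.add (h21.smul h3))))
  rw [h5.fderiv]
  have h6 : inner ℝ (gradQ F (x, 0)) (v.2.2 0).1 = fderiv ℝ F (x, 0) ((v.2.2 0).1, 0) := by
    rw [fderiv_eq_gradQ_add_gradP]; simp
  rw [h6]
  refine Prod.ext rfl (Prod.ext rfl ?_)
  change v.2.2 - (constOp (v.1, 0) + ((0 : ℝ) • _ + v.2.1 • _)) = _
  rw [zero_smul, zero_add]
  rfl

/-- Up to identity blocks, the linearization is the effect of `τ` on the energy at the start of the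
curve. The start moves by `-τ ∂F/∂p`, so the energy changes by `-τ⟨∂F/∂q, ∂F/∂p⟩`. -/
lemma isInvertible_fderiv_trajMap {F : E × E → ℝ} (hF : ContDiff ℝ ∞ F) (x : E)
    (hx : inner ℝ (gradQ F (x, 0)) (gradP F (x, 0)) ≠ 0) :
    (fderiv ℝ (trajMap hF) (x, 0, constOp (x, 0))).IsInvertible := by
  set c := inner ℝ (gradQ F (x, 0)) (gradP F (x, 0)) with hc
  set Y : C(Icc (0 : ℝ) 1, E × E) := mixedPrim (constOp (hamField F (x, 0))) with hY
  have hY0 : (Y 0).1 = -gradP F (x, 0) := by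
    rw [hY, mixedPrim_apply, primOp_zero]
    simp [primOp_apply, hamField]
  have hinj : (fderiv ℝ (trajMap hF) (x, 0, constOp (x, 0))).ker = ⊥ := by
    rw [LinearMap.ker_eq_bot']
    intro v hv
    change fderiv ℝ (trajMap hF) (x, 0, constOp (x, 0)) v = 0 at hv
    rw [fderiv_trajMap] at hv
    have h1 : v.1 = 0 := congrArg Prod.fst hv
    have h2 : inner ℝ (gradQ F (x, 0)) (v.2.2 0).1 = 0 := congrArg (fun z => z.2.1) hv
    have h3 : v.2.2 - (constOp (v.1, 0) + v.2.1 • Y) = 0 := congrArg (fun z => z.2.2) hv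
    rw [h1, Prod.mk_zero_zero, map_zero, zero_add, sub_eq_zero] at h3
    have h4 : v.2.1 = 0 := by
      have : (v.2.2 0).1 = v.2.1 • -gradP F (x, 0) := by rw [h3, ← hY0]; rfl
      rw [this, inner_smul_right, inner_neg_right, ← hc] at h2
      simpa [hx] using h2
    rw [h4, zero_smul] at h3
    exact Prod.ext h1 (Prod.ext h4 h3)
  have hsurj : (fderiv ℝ (trajMap hF) (x, 0, constOp (x, 0))).range = ⊤ := by
    rw [LinearMap.range_eq_top]
    intro w
    set s : ℝ := (inner ℝ (gradQ F (x, 0)) ((w.2.2 0).1 + w.1) - w.2.1) / c with hs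
    refine ⟨(w.1, s, w.2.2 + (constOp (w.1, 0) + s • Y)), ?_⟩
    change fderiv ℝ (trajMap hF) (x, 0, constOp (x, 0)) _ = w
    rw [fderiv_trajMap]
    refine Prod.ext rfl (Prod.ext ?_ ?_)
    · have : ((w.2.2 + (constOp (w.1, 0) + s • Y) : C(Icc (0 : ℝ) 1, E × E)) 0).1 =
          (w.2.2 0).1 + w.1 + s • -gradP F (x, 0) := by
        rw [← hY0, add_assoc]; rfl
      change inner ℝ (gradQ F (x, 0)) ((w.2.2 + (constOp (w.1, 0) + s • Y) : C(Icc (0 : ℝ) 1, E × E)) 0).1 = w.2.1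
      rw [this, inner_add_right, inner_smul_right, inner_neg_right, ← hc, hs]
      field_simp
      ring
    · exact add_sub_cancel_right _ _
  exact ⟨ContinuousLinearEquiv.ofBijective _ hinj hsurj, rfl⟩

/-- Local solvability of the Hamilton-Jacobi equation `F (u, ∇K) = 0` near a compact set of
noncharacteristic points of the zero section with `F = 0`. -/
theorem exists_hamiltonJacobi {F : E × E → ℝ} (hF : ContDiff ℝ ∞ F) {Z : Set E} (hZ : IsCompact Z)
    (h0 : ∀ x ∈ Z, F (x, 0) = 0)
    (hneg : ∀ x ∈ Z, inner ℝ (gradQ F (x, 0)) (gradP F (x, 0)) < 0) :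
    ∃ (N : Set E) (K : E → ℝ), IsOpen N ∧ Z ⊆ N ∧ ContDiffOn ℝ ∞ K N ∧
      (∀ u ∈ N, F (u, gradient K u) = 0 ∧ 0 ≤ K u ∧ (K u = 0 → F (u, 0) = 0)) ∧
      ∀ x ∈ Z, K x = 0 ∧ gradient K x = 0 := by
  set pt : E → E × ℝ × C(Icc (0 : ℝ) 1, E × E) := fun x => (x, 0, constOp (x, 0)) with hpt
  have hptc : Continuous pt := continuous_id.prodMk (continuous_const.prodMk
    (constOp.continuous.comp (continuous_id.prodMk continuous_const)))
  have hΩpt : ∀ x ∈ Z, trajMap hF (pt x) = (x, 0, 0) := fun x hx => by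
    simp [trajMap, hpt, h0 x hx]
  have hU : ∀ x ∈ Z, ∃ U : Set (E × E), IsOpen U ∧ (x, 0) ∈ U ∧ ∀ z ∈ U, ∀ z' ∈ U,
      inner ℝ (gradQ F z) (gradP F z') < 0 := by
    intro x hx
    have hc : Continuous fun p : (E × E) × (E × E) => inner ℝ (gradQ F p.1) (gradP F p.2) :=
      ((contDiff_gradQ hF).continuous.comp continuous_fst).inner
        ((contDiff_gradP hF).continuous.comp continuous_snd)
    have hopen := (isOpen_Iio (a := (0 : ℝ))).preimage hc
    obtain ⟨V, W, hV, hW, hxV, hxW, hVW⟩ := isOpen_prod_iff.1 hopen (x, 0) (x, 0) (hneg x hx)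
    exact ⟨V ∩ W, hV.inter hW, ⟨hxV, hxW⟩, fun z hz z' hz' =>
      hVW (mk_mem_prod hz.1 hz'.2)⟩
  choose! U hUo hUx hUneg using hU
  -- Confining each curve to one of the sets `U x` makes the sign condition of
  -- `IsTrajectory.action_pos` hold for every pair of its times.
  set O : Set (E × ℝ × C(Icc (0 : ℝ) 1, E × E)) :=
    ⋃ x ∈ Z, {v | MapsTo v.2.2 univ (U x)} with hO
  have hOo : IsOpen O := isOpen_biUnion fun x hx =>
    (ContinuousMap.isOpen_setOfPred_mapsTo isCompact_univ (hUo x hx)).preimage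
      (continuous_snd.comp continuous_snd)
  obtain ⟨W, g, hWo, hTW, hg, hgW, hgT⟩ := exists_contDiffOn_inverse (contDiff_trajMap hF)
    (hZ.image hptc) (O := O)
    (by
      rintro _ ⟨x, hx, rfl⟩ _ ⟨x', hx', rfl⟩ h
      rw [hΩpt x hx, hΩpt x' hx'] at h
      rw [show x = x' from congrArg Prod.fst h])
    (by
      rintro _ ⟨x, hx, rfl⟩
      exact isInvertible_fderiv_trajMap hF x (hneg x hx).ne) hOo
    (by
      rintro _ ⟨x, hx, rfl⟩
      exact mem_biUnion hx fun r _ => hUx x hx)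
  have hιc : Continuous fun u : E => ((u, 0, 0) : E × ℝ × C(Icc (0 : ℝ) 1, E × E)) := by fun_prop
  set N : Set E := (fun u : E => ((u, 0, 0) : E × ℝ × C(Icc (0 : ℝ) 1, E × E))) ⁻¹' W with hN
  have hNo : IsOpen N := hWo.preimage hιc
  -- The preimage of `(u, 0, 0)` is a trajectory that ends over `u` and starts on the zero section
  -- at energy zero.
  set G : E → E × ℝ × C(Icc (0 : ℝ) 1, E × E) := fun u => g (u, 0, 0) with hG
  have hGs : ContDiffOn ℝ ∞ G N :=
    hg.comp (contDiff_id.prodMk contDiff_const).contDiffOn fun u hu => hu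
  have hGN : ∀ u ∈ N, G u ∈ O ∧ F (((G u).2.2 0).1, 0) = 0 ∧
      IsTrajectory hF u (G u).2.1 (G u).2.2 := by
    intro u hu
    obtain ⟨h1, h2⟩ := hgW _ hu
    have h3 : (G u).1 = u := congrArg Prod.fst h2
    refine ⟨h1, congrArg (fun z => z.2.1) h2, ?_⟩
    have h4 := sub_eq_zero.1 (congrArg (fun z => z.2.2) h2)
    change (G u).2.2 = constOp ((G u).1, 0) + _ at h4
    rwa [h3] at h4
  have hGZ : ∀ x ∈ Z, G x = pt x := fun x hx => by
    have := hgT (pt x) ⟨x, hx, rfl⟩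
    rwa [hΩpt x hx] at this
  have hZN : Z ⊆ N := fun x hx => by
    have := hTW ⟨pt x, ⟨x, hx, rfl⟩, rfl⟩
    rwa [hΩpt x hx] at this
  set K : E → ℝ := fun u => action hF (G u).2.1 (G u).2.2 with hK
  have hgrad : ∀ u ∈ N, gradient K u = ((G u).2.2 1).2 := by
    intro u hu
    have hGd : DifferentiableAt ℝ G u := (hGs.differentiableOn (by simp)).differentiableAt
      (hNo.mem_nhds hu)
    have hev : ∀ᶠ v in 𝓝 u, v ∈ N := hNo.mem_nhds hu
    have := hasFDerivAt_action hF (τ := fun v => (G v).2.1) (y := fun v => (G v).2.2)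
      (differentiableAt_fst.comp u (hGd.snd)) hGd.snd.snd
      (hev.mono fun v hv => (hGN v hv).2.2) (hev.mono fun v hv => (hGN v hv).2.1)
    refine HasGradientAt.gradient ?_
    rw [hasGradientAt_iff_hasFDerivAt]
    exact this
  refine ⟨N, K, hNo, hZN, (contDiff_action hF).comp_contDiffOn hGs.snd, fun u hu => ?_,
    fun x hx => ⟨?_, ?_⟩⟩
  · obtain ⟨hO', hE, htr⟩ := hGN u hu
    have hz : (u, ((G u).2.2 1).2) = (G u).2.2 1 := Prod.ext htr.apply_one.symm rfl
    rw [hgrad u hu, hz, htr.energy]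
    obtain ⟨x, hx, hxm⟩ := mem_iUnion₂.1 hO'
    have hpos : (G u).2.1 ≠ 0 → 0 < K u := fun hτ => htr.action_pos hτ
      fun r r' => hUneg x hx _ (hxm (mem_univ r)) _ (hxm (mem_univ r'))
    have hzero : (G u).2.1 = 0 → K u = 0 := fun hτ => by rw [hK]; simp [action, hτ]
    refine ⟨hE, ?_, fun hKu => ?_⟩
    · by_cases hτ : (G u).2.1 = 0
      · exact (hzero hτ).ge
      · exact (hpos hτ).le
    -- Zero action forces zero time; the trajectory is then constant, and its starting condition is
    -- a statement about `u` itself.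
    · have hτ : (G u).2.1 = 0 := by
        by_contra hτ
        exact (hpos hτ).ne' hKu
      have := htr.apply 0
      rw [hτ, zero_smul, add_zero] at this
      rwa [this] at hE
  · rw [hK]; simp [hGZ x hx, hpt, action]
  · rw [hgrad x (hZN hx), hGZ x hx]; rfl

end HamiltonJacobi
variable {n : ℕ}

/-! ### Graphs of exact one-forms over sublevel sets -/

section Graphs

lemma gradient_eq_riesz {E : Type} [NormedAddCommGroup E] [InnerProductSpace ℝ E]
    [CompleteSpace E] (H : E → ℝ) (u : E) : gradient H u = riesz (fderiv ℝ H u) := rfl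

lemma inner_gradient {E : Type} [NormedAddCommGroup E] [InnerProductSpace ℝ E]
    [CompleteSpace E] (H : E → ℝ) (u δ : E) : inner ℝ (gradient H u) δ = fderiv ℝ H u δ := by
  rw [gradient_eq_riesz, inner_riesz]

lemma contDiff_gradient {E : Type} [NormedAddCommGroup E] [InnerProductSpace ℝ E]
    [CompleteSpace E] {H : E → ℝ} (hH : ContDiff ℝ ∞ H) : ContDiff ℝ ∞ (gradient H) :=
  riesz.contDiff.comp (hH.fderiv_right (by simp))

lemma inner_fderiv_gradient_comm {E : Type} [NormedAddCommGroup E] [InnerProductSpace ℝ E]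
    [CompleteSpace E] {H : E → ℝ} (hH : ContDiff ℝ ∞ H) (u δ δ' : E) :
    inner ℝ (fderiv ℝ (gradient H) u δ) δ' = inner ℝ (fderiv ℝ (gradient H) u δ') δ := by
  have h1 : HasFDerivAt (gradient H) (riesz ∘L fderiv ℝ (fderiv ℝ H) u) u :=
    riesz.hasFDerivAt.comp u
      (((hH.fderiv_right (m := ∞) (by simp)).differentiable (by simp)) u).hasFDerivAt
  rw [h1.fderiv, ContinuousLinearMap.comp_apply, ContinuousLinearMap.comp_apply, inner_riesz,
    inner_riesz]
  have h2 : minSmoothness ℝ 2 ≤ ∞ := by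
    rw [minSmoothness_of_isRCLikeNormedField]
    exact WithTop.coe_le_coe.2 (le_top : (2 : ℕ∞) ≤ ⊤)
  exact (hH.contDiffAt.isSymmSndFDerivAt h2).eq _ _

lemma vec_apply (α : Fin n → ℤ) (i : Fin n) : vec α i = α i := rfl

lemma mem_lift_graphOver {D : Set (Base n)} {H : Base n → ℝ} {q : Cover n} :
    q ∈ lift (graphOver D H) ↔
      q.1 ∈ D ∧ ∃ k : Fin n → ℤ, q.2 = gradient H q.1 + (2 * Real.pi) • vec k := by
  refine and_congr Iff.rfl ?_
  simp only [cov, Real.Angle.angle_eq_iff_two_pi_dvd_sub]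
  constructor
  · intro h
    choose k hk using h
    refine ⟨k, ?_⟩
    ext i
    have := hk i
    simp only [PiLp.add_apply, PiLp.smul_apply, vec_apply, smul_eq_mul]
    linarith
  · rintro ⟨k, hk⟩ i
    refine ⟨k i, ?_⟩
    rw [hk]
    simp only [PiLp.add_apply, PiLp.smul_apply, vec_apply, smul_eq_mul]
    ring

/-- Different sheets differ by at least `2π` in some coordinate, so only the sheet of `p` is visible
near `p`. -/
lemma eventually_mem_lift_graphOver {D : Set (Base n)} {H : Base n → ℝ} (hH : ContDiff ℝ ∞ H)
    {p : Cover n} {k : Fin n → ℤ} (hp : p.2 = gradient H p.1 + (2 * Real.pi) • vec k) :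
    ∀ᶠ q in 𝓝 p, q ∈ lift (graphOver D H) ↔
      q.1 ∈ D ∧ q.2 - gradient H q.1 - (2 * Real.pi) • vec k = 0 := by
  have hc : Continuous fun q : Cover n => q.2 - gradient H q.1 - (2 * Real.pi) • vec k :=
    (continuous_snd.sub ((contDiff_gradient hH).continuous.comp continuous_fst)).sub
      continuous_const
  have hev : ∀ᶠ q in 𝓝 p, ∀ i, |(q.2 - gradient H q.1 - (2 * Real.pi) • vec k) i| <
      2 * Real.pi := by
    rw [eventually_all]
    intro i
    have hci : Continuous fun q : Cover n =>
        |(q.2 - gradient H q.1 - (2 * Real.pi) • vec k) i| :=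
      ((EuclideanSpace.proj (𝕜 := ℝ) i).continuous.comp hc).abs
    refine hci.continuousAt.eventually_lt continuousAt_const ?_
    have : p.2 - gradient H p.1 - (2 * Real.pi) • vec k = 0 := by rw [hp]; abel
    rw [this]
    simpa using Real.pi_pos
  filter_upwards [hev] with q hq
  rw [mem_lift_graphOver]
  refine and_congr Iff.rfl ⟨?_, fun h => ⟨k, ?_⟩⟩
  · rintro ⟨m, hm⟩
    ext i
    have h1 := hq i
    rw [hm] at h1 ⊢
    have h2 : (gradient H q.1 + (2 * Real.pi) • vec m - gradient H q.1 -
        (2 * Real.pi) • vec k) i = 2 * Real.pi * ((m i - k i : ℤ) : ℝ) := by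
      simp only [PiLp.add_apply, PiLp.sub_apply, PiLp.smul_apply, vec_apply, smul_eq_mul]
      push_cast; ring
    rw [h2] at h1 ⊢
    have h3 : |((m i - k i : ℤ) : ℝ)| < 1 := by
      rw [abs_mul, abs_of_pos Real.two_pi_pos] at h1
      exact lt_of_mul_lt_mul_left (by simpa using h1) Real.two_pi_pos.le
    have h4 : m i - k i = 0 := by
      rw [← Int.abs_lt_one_iff]
      exact_mod_cast h3
    rw [h4]; simp
  · rw [sub_eq_zero, sub_eq_iff_eq_add] at h
    rw [h, add_comm]

/-- The local defining function of the graph of the differential of `H`. -/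
lemma hasFDerivAt_graph_equation {H : Base n → ℝ} (hH : ContDiff ℝ ∞ H) (k : Fin n → ℤ)
    (p : Cover n) :
    HasFDerivAt (fun q : Cover n => q.2 - gradient H q.1 - (2 * Real.pi) • vec k)
      (ContinuousLinearMap.snd ℝ (Base n) (Base n) -
        fderiv ℝ (gradient H) p.1 ∘L ContinuousLinearMap.fst ℝ (Base n) (Base n)) p :=
  (hasFDerivAt_snd.sub (HasFDerivAt.comp (g := gradient H) p
    ((contDiff_gradient hH).differentiable (by simp) p.1).hasFDerivAt hasFDerivAt_fst)).sub_const _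

lemma contDiff_graph_equation {H : Base n → ℝ} (hH : ContDiff ℝ ∞ H) (k : Fin n → ℤ) :
    ContDiff ℝ ∞ (fun q : Cover n => q.2 - gradient H q.1 - (2 * Real.pi) • vec k) :=
  (contDiff_snd.sub ((contDiff_gradient hH).comp contDiff_fst)).sub contDiff_const

lemma tangentAt_graphOver_le {D : Set (Base n)} {H : Base n → ℝ} (hH : ContDiff ℝ ∞ H)
    {p : Cover n} (hp : p ∈ lift (graphOver D H)) {v : Cover n}
    (hv : v ∈ tangentAt (lift (graphOver D H)) p) : v.2 = fderiv ℝ (gradient H) p.1 v.1 := by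
  obtain ⟨_, k, hk⟩ := mem_lift_graphOver.1 hp
  set L := ContinuousLinearMap.snd ℝ (Base n) (Base n) -
        fderiv ℝ (gradient H) p.1 ∘L ContinuousLinearMap.fst ℝ (Base n) (Base n) with hL
  have hle : tangentAt (lift (graphOver D H)) p ≤ LinearMap.ker L.toLinearMap := by
    refine Submodule.span_le.2 fun v hv => ?_
    have h1 := (hasFDerivAt_graph_equation hH k p).hasFDerivWithinAt
      (s := lift (graphOver D H))
    have h2 : HasFDerivWithinAt (fun q : Cover n => q.2 - gradient H q.1 - (2 * Real.pi) • vec k)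
        (0 : Cover n →L[ℝ] Base n) (lift (graphOver D H)) p := by
      refine (hasFDerivWithinAt_const (0 : Base n) p _).congr_of_eventuallyEq ?_ ?_
      · filter_upwards [self_mem_nhdsWithin,
          mem_nhdsWithin_of_mem_nhds (eventually_mem_lift_graphOver (D := D) hH hk)] with q hq hq'
        exact (hq'.1 hq).2
      · rw [hk]; abel
    exact h1.unique_on h2 hv
  have := hle hv
  rw [LinearMap.mem_ker] at this
  exact sub_eq_zero.1 this

/-- The sheet of the graph which is labelled by the integral vector `k`. -/
noncomputable def sheet (H : Base n → ℝ) (k : Fin n → ℤ) (u : Base n) : Cover n :=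
  (u, gradient H u + (2 * Real.pi) • vec k)

lemma hasFDerivAt_sheet {H : Base n → ℝ} (hH : ContDiff ℝ ∞ H) (k : Fin n → ℤ) (u : Base n) :
    HasFDerivAt (sheet H k) ((ContinuousLinearMap.id ℝ (Base n)).prod
      (fderiv ℝ (gradient H) u)) u :=
  (hasFDerivAt_id u).prodMk
    (((contDiff_gradient hH).differentiable (by simp) u).hasFDerivAt.add_const _)

lemma tangentCone_subset_tangentAt {D : Set (Base n)} {H : Base n → ℝ} (hH : ContDiff ℝ ∞ H)
    {p : Cover n} (hp : p ∈ lift (graphOver D H)) {δ : Base n} (hδ : δ ∈ tangentConeAt ℝ D p.1) :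
    (δ, fderiv ℝ (gradient H) p.1 δ) ∈ tangentAt (lift (graphOver D H)) p := by
  obtain ⟨_, k, hk⟩ := mem_lift_graphOver.1 hp
  have h1 := (hasFDerivAt_sheet hH k p.1).hasFDerivWithinAt.mapsTo_tangent_cone (s := D) hδ
  have h2 : sheet H k p.1 = p := Prod.ext rfl hk.symm
  rw [h2] at h1
  refine Submodule.subset_span (tangentConeAt_mono ?_ h1)
  rintro _ ⟨u, hu, rfl⟩
  exact mem_lift_graphOver.2 ⟨hu, k, rfl⟩

variable {f : Base n → ℝ}

lemma mem_tangentConeAt_sublevel (hf : ContDiff ℝ ∞ f) {u δ : Base n} (hu : f u ≤ 0)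
    (hδ : fderiv ℝ f u δ < 0) : δ ∈ tangentConeAt ℝ {u | f u ≤ 0} u := by
  have hl : Tendsto (fun t : ℝ => t) (𝓝[>] 0) (𝓝[≠] 0) :=
    tendsto_id.mono_left (nhdsWithin_mono _ fun t ht => ne_of_gt ht)
  refine mem_tangentConeAt_of_add_smul_mem hl ?_
  have hline : HasDerivAt (fun t : ℝ => u + t • δ) δ 0 := by
    simpa using ((hasDerivAt_id (0 : ℝ)).smul_const δ).const_add u
  have hd : HasDerivAt (fun t : ℝ => f (u + t • δ)) (fderiv ℝ f u δ) 0 := by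
    have := (hf.differentiable (by simp) (u + (0 : ℝ) • δ)).hasFDerivAt.comp_hasDerivAt 0 hline
    rw [zero_smul, add_zero] at this
    exact this
  have hev := (hasDerivAt_iff_tendsto_slope.1 hd).eventually (eventually_lt_nhds hδ)
  filter_upwards [hl.eventually hev, self_mem_nhdsWithin] with t ht ht0
  rw [slope_def_field, zero_smul, add_zero, sub_zero] at ht
  have h2 := (div_neg_iff.1 ht).resolve_left (fun h => absurd h.2 (not_lt.2 (le_of_lt ht0)))
  exact (lt_of_lt_of_le (sub_neg.1 h2.1) hu).le

/-- At a boundary point the tangent cone of the sublevel set contains an open half-space, and any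
direction is a difference of two directions in it. -/
lemma exists_tangentAt_fst (hf : ContDiff ℝ ∞ f) (hreg : ∀ u, f u = 0 → fderiv ℝ f u ≠ 0)
    {H : Base n → ℝ} (hH : ContDiff ℝ ∞ H) {p : Cover n}
    (hp : p ∈ lift (graphOver {u | f u ≤ 0} H)) (δ : Base n) :
    (δ, fderiv ℝ (gradient H) p.1 δ) ∈ tangentAt (lift (graphOver {u | f u ≤ 0} H)) p := by
  rcases lt_or_eq_of_le (show f p.1 ≤ 0 from (mem_lift_graphOver.1 hp).1) with hlt | heq
  · refine tangentCone_subset_tangentAt hH hp ?_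
    have : {u | f u ≤ 0} ∈ 𝓝 p.1 := by
      filter_upwards [hf.continuous.continuousAt.eventually_lt continuousAt_const hlt] with u hu
      exact hu.le
    rw [tangentConeAt_of_mem_nhds this]
    trivial
  · obtain ⟨e, he⟩ : ∃ e, fderiv ℝ f p.1 e < 0 := by
      by_contra! hcon
      refine hreg _ heq (ContinuousLinearMap.ext fun e => le_antisymm ?_ (hcon e))
      have := hcon (-e)
      rw [map_neg] at this
      simpa using this
    have hneg : ∀ δ, fderiv ℝ f p.1 δ < 0 → (δ, fderiv ℝ (gradient H) p.1 δ) ∈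
        tangentAt (lift (graphOver {u | f u ≤ 0} H)) p := fun δ hδ =>
      tangentCone_subset_tangentAt hH hp (mem_tangentConeAt_sublevel hf heq.le hδ)
    obtain ⟨c, hc⟩ : ∃ c : ℝ, fderiv ℝ f p.1 δ + c * fderiv ℝ f p.1 e < 0 ∧ 0 < c := by
      refine ⟨(|fderiv ℝ f p.1 δ| + 1) / (-fderiv ℝ f p.1 e), ?_, ?_⟩
      · have : (|fderiv ℝ f p.1 δ| + 1) / (-fderiv ℝ f p.1 e) * fderiv ℝ f p.1 e =
            -(|fderiv ℝ f p.1 δ| + 1) := by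
          rw [div_neg, neg_mul, div_mul_cancel₀ _ he.ne]
        rw [this]
        linarith [le_abs_self (fderiv ℝ f p.1 δ)]
      · exact div_pos (by positivity) (neg_pos.2 he)
    have h1 := hneg (δ + c • e) (by rw [map_add, map_smul, smul_eq_mul]; exact hc.1)
    have h2 := hneg (c • e) (by rw [map_smul, smul_eq_mul]; exact mul_neg_of_pos_of_neg hc.2 he)
    have := Submodule.sub_mem _ h1 h2
    simpa using this

lemma isInteriorPoint_graphOver (hf : ContDiff ℝ ∞ f) {H : Base n → ℝ} (hH : ContDiff ℝ ∞ H)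
    {p : Cover n} (hp : p ∈ lift (graphOver {u | f u ≤ 0} H)) (hlt : f p.1 < 0) :
    IsInteriorPoint (lift (graphOver {u | f u ≤ 0} H)) p := by
  obtain ⟨_, k, hk⟩ := mem_lift_graphOver.1 hp
  refine ⟨_, contDiff_graph_equation hH k, ?_, ?_, ?_⟩
  · rw [hk]; abel
  · rw [(hasFDerivAt_graph_equation hH k p).fderiv]
    exact fun y => ⟨(0, y), by simp⟩
  · filter_upwards [eventually_mem_lift_graphOver (D := {u | f u ≤ 0}) hH hk,
      (hf.continuous.comp continuous_fst).continuousAt.eventually_lt continuousAt_const hlt]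
      with q hq hq'
    rw [hq]
    exact ⟨fun h => h.2, fun h => ⟨le_of_lt hq', h⟩⟩

lemma isBoundaryPoint_graphOver (hf : ContDiff ℝ ∞ f) {H : Base n → ℝ} (hH : ContDiff ℝ ∞ H)
    {p : Cover n} (hp : p ∈ lift (graphOver {u | f u ≤ 0} H)) (h0 : f p.1 = 0)
    (hreg : fderiv ℝ f p.1 ≠ 0) :
    IsBoundaryPoint (lift (graphOver {u | f u ≤ 0} H)) p := by
  obtain ⟨_, k, hk⟩ := mem_lift_graphOver.1 hp
  have hg : HasFDerivAt (fun q : Cover n => -f q.1)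
      (-(fderiv ℝ f p.1 ∘L ContinuousLinearMap.fst ℝ (Base n) (Base n))) p :=
    (HasFDerivAt.comp (g := f) p (hf.differentiable (by simp) p.1).hasFDerivAt hasFDerivAt_fst).neg
  refine ⟨_, fun q => -f q.1, contDiff_graph_equation hH k, (hf.comp contDiff_fst).neg, ?_, ?_, ?_,
    ?_⟩
  · rw [hk]; abel
  · simp [h0]
  · rw [(hasFDerivAt_graph_equation hH k p).fderiv, hg.fderiv]
    rintro ⟨y, s⟩
    obtain ⟨e, he⟩ : ∃ e, fderiv ℝ f p.1 e ≠ 0 := by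
      by_contra! hcon
      exact hreg (ContinuousLinearMap.ext hcon)
    refine ⟨((-s / fderiv ℝ f p.1 e) • e,
      y + fderiv ℝ (gradient H) p.1 ((-s / fderiv ℝ f p.1 e) • e)), ?_⟩
    refine Prod.ext ?_ ?_
    · simp
    · simp [he]
  · filter_upwards [eventually_mem_lift_graphOver (D := {u | f u ≤ 0}) hH hk] with q hq
    rw [hq, and_comm, neg_nonneg]

/-- A count of dimensions. Over an interior point `F` vanishes and `g` has a minimum along the whole
sheet, so both differentials kill an `n`-dimensional space, while the kernel of a surjection from
dimension `2n` onto dimension `n + 1` has dimension `n - 1`. -/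
lemma not_isBoundaryPoint_graphOver (hf : ContDiff ℝ ∞ f) {H : Base n → ℝ} (hH : ContDiff ℝ ∞ H)
    {p : Cover n} (hp : p ∈ lift (graphOver {u | f u ≤ 0} H)) (hlt : f p.1 < 0) :
    ¬ IsBoundaryPoint (lift (graphOver {u | f u ≤ 0} H)) p := by
  rintro ⟨F, g, hF, hg, hFp, hgp, hsurj, hev⟩
  obtain ⟨_, k, hk⟩ := mem_lift_graphOver.1 hp
  have hsp : sheet H k p.1 = p := Prod.ext rfl hk.symm
  have hs := hasFDerivAt_sheet hH k p.1
  set σ := (ContinuousLinearMap.id ℝ (Base n)).prod (fderiv ℝ (gradient H) p.1) with hσ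
  have hS : ∀ᶠ u in 𝓝 p.1, F (sheet H k u) = 0 ∧ 0 ≤ g (sheet H k u) := by
    have h1 : Tendsto (sheet H k) (𝓝 p.1) (𝓝 p) := by
      have := hs.continuousAt
      rwa [ContinuousAt, hsp] at this
    filter_upwards [h1.eventually hev, hf.continuous.continuousAt.eventually_lt
      continuousAt_const hlt] with u hu hu'
    exact hu.1 (mem_lift_graphOver.2 ⟨le_of_lt hu', k, rfl⟩)
  have hFd : HasFDerivAt (fun u => F (sheet H k u)) (fderiv ℝ F p ∘L σ) p.1 :=
    HasFDerivAt.comp p.1 (by rw [hsp]; exact (hF.differentiable (by simp) p).hasFDerivAt) hs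
  have hgd : HasFDerivAt (fun u => g (sheet H k u)) (fderiv ℝ g p ∘L σ) p.1 :=
    HasFDerivAt.comp p.1 (by rw [hsp]; exact (hg.differentiable (by simp) p).hasFDerivAt) hs
  have hF0 : fderiv ℝ F p ∘L σ = 0 := hFd.unique
    ((hasFDerivAt_const (0 : Base n) p.1).congr_of_eventuallyEq (hS.mono fun u hu => hu.1))
  have hg0 : fderiv ℝ g p ∘L σ = 0 := by
    refine IsLocalMin.hasFDerivAt_eq_zero ?_ hgd
    filter_upwards [hS] with u hu
    rw [hsp, hgp]
    exact hu.2
  set Φ : Cover n →ₗ[ℝ] Base n × ℝ := ((fderiv ℝ F p).prod (fderiv ℝ g p)).toLinearMap with hΦ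
  have hΦs : Function.Surjective Φ := hsurj
  have h1 := LinearMap.finrank_range_add_finrank_ker Φ
  rw [LinearMap.range_eq_top.2 hΦs, finrank_top] at h1
  have h2 : Module.finrank ℝ (Base n) ≤ Module.finrank ℝ (LinearMap.ker Φ) := by
    refine LinearMap.finrank_le_finrank_of_injective (f := LinearMap.codRestrict (LinearMap.ker Φ)
      σ.toLinearMap fun e => ?_) ?_
    · rw [LinearMap.mem_ker]
      exact Prod.ext (congrArg (fun L => L e) hF0) (congrArg (fun L => L e) hg0)
    · intro e e' hee
      exact congrArg (fun z => z.1.1) hee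
  simp only [Module.finrank_prod, Module.finrank_self, finrank_euclideanSpace,
    Fintype.card_fin] at h1 h2
  omega

lemma bdry_graphOver (hf : ContDiff ℝ ∞ f) (hreg : ∀ u, f u = 0 → fderiv ℝ f u ≠ 0)
    {H : Base n → ℝ} (hH : ContDiff ℝ ∞ H) :
    bdry (graphOver {u | f u ≤ 0} H) = {x | x ∈ graphOver {u | f u ≤ 0} H ∧ f x.1 = 0} := by
  ext x
  refine and_congr_right fun hx => ⟨?_, fun h0 => ?_⟩
  · rintro ⟨p, rfl, hp⟩
    refine le_antisymm hx.1 (not_lt.1 fun hlt => ?_)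
    exact not_isBoundaryPoint_graphOver hf hH hx hlt hp
  · have hp : cov (x.1, gradient H x.1) = x := Prod.ext rfl (funext fun i => (hx.2 i).symm)
    refine ⟨_, hp, isBoundaryPoint_graphOver hf hH ?_ h0 (hreg _ h0)⟩
    change cov _ ∈ graphOver _ H
    rwa [hp]

lemma isCompact_graphOver {D : Set (Base n)} (hD : IsCompact D) {H : Base n → ℝ}
    (hH : ContDiff ℝ ∞ H) : IsCompact (graphOver D H) := by
  have hc : Continuous fun u : Base n =>
      ((u, fun i => (gradient H u i : Real.Angle)) : Torus n) := by
    refine continuous_id.prodMk (continuous_pi fun i => Real.Angle.continuous_coe.comp ?_)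
    exact (EuclideanSpace.proj (𝕜 := ℝ) i).continuous.comp (contDiff_gradient hH).continuous
  convert hD.image hc using 1
  ext x
  constructor
  · exact fun hx => ⟨x.1, hx.1, Prod.ext rfl (funext fun i => (hx.2 i).symm)⟩
  · rintro ⟨u, hu, rfl⟩
    exact ⟨hu, fun i => rfl⟩

lemma isLagrangian_graphOver (hf : ContDiff ℝ ∞ f) (hreg : ∀ u, f u = 0 → fderiv ℝ f u ≠ 0)
    {H : Base n → ℝ} (hH : ContDiff ℝ ∞ H) : IsLagrangian (graphOver {u | f u ≤ 0} H) := by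
  refine ⟨fun p hp => ?_, fun p hp v hv w hw => ?_⟩
  · rcases lt_or_eq_of_le (show f p.1 ≤ 0 from hp.1) with hlt | heq
    · exact Or.inl (isInteriorPoint_graphOver hf hH hp hlt)
    · exact Or.inr (isBoundaryPoint_graphOver hf hH hp heq (hreg _ heq))
  · rw [omega, tangentAt_graphOver_le hH hp hv, tangentAt_graphOver_le hH hp hw,
      inner_fderiv_gradient_comm hH, real_inner_comm v.1]
    exact sub_self _

/-- The function `H - ⟨u, ∇H⟩` has differential `-⟨u, d∇H⟩`; it depends on `u` only, so it is
defined on the quotient. -/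
lemma isExact_graphOver {D : Set (Base n)} {H : Base n → ℝ} (hH : ContDiff ℝ ∞ H) :
    IsExact (graphOver D H) := by
  refine ⟨fun x => H x.1 - inner ℝ x.1 (gradient H x.1), fun p hp =>
    ⟨fun q => H q.1 - inner ℝ q.1 (gradient H q.1), ?_, ?_, fun v hv => ?_⟩⟩
  · exact (hH.comp contDiff_fst).sub
      (contDiff_fst.inner ℝ ((contDiff_gradient hH).comp contDiff_fst))
  · exact Eventually.of_forall fun q => rfl
  · have h1 : HasFDerivAt (fun q : Cover n => H q.1) _ p :=
      HasFDerivAt.comp (g := H) p (hH.differentiable (by simp) p.1).hasFDerivAt hasFDerivAt_fst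
    have h2 : HasFDerivAt (fun q : Cover n => gradient H q.1) _ p :=
      HasFDerivAt.comp (g := gradient H) p
        ((contDiff_gradient hH).differentiable (by simp) p.1).hasFDerivAt hasFDerivAt_fst
    have h3 : HasFDerivAt (fun q : Cover n => H q.1 - inner ℝ q.1 (gradient H q.1)) _ p :=
      h1.sub ((hasFDerivAt_fst (p := p)).inner ℝ h2)
    rw [h3.fderiv, primitive, tangentAt_graphOver_le hH hp hv]
    change fderiv ℝ H p.1 v.1 - (inner ℝ p.1 (fderiv ℝ (gradient H) p.1 v.1) +
      inner ℝ v.1 (gradient H p.1)) = _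
    rw [real_inner_comm (gradient H p.1), inner_gradient]
    ring

/-- The standard volume form of the base, pulled back to the cover. -/
noncomputable def baseVolume (n : ℕ) : Cover n [⋀^Fin n]→L[ℝ] ℝ :=
  ContinuousAlternatingMap.compContinuousLinearMap
    { (EuclideanSpace.basisFun (Fin n) ℝ).toBasis.det with
      cont := by
        change Continuous fun v : Fin n → Base n => (EuclideanSpace.basisFun (Fin n) ℝ).toBasis.det v
        simp only [Module.Basis.det_apply]
        refine Continuous.matrix_det (continuous_matrix fun i j => ?_)
        simp only [Module.Basis.toMatrix_apply]
        exact (EuclideanSpace.proj (𝕜 := ℝ) i).continuous.comp (continuous_apply j) }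
    (ContinuousLinearMap.fst ℝ (Base n) (Base n))

/-- The tangent spaces of a graph project onto the base, also at the boundary, so the volume form of
the base does not vanish on them. -/
lemma isOrientable_graphOver (hf : ContDiff ℝ ∞ f) (hreg : ∀ u, f u = 0 → fderiv ℝ f u ≠ 0)
    {H : Base n → ℝ} (hH : ContDiff ℝ ∞ H) : IsOrientable (graphOver {u | f u ≤ 0} H) := by
  refine ⟨fun _ => baseVolume n, continuousOn_const, fun p hp => ⟨fun i =>
    (EuclideanSpace.basisFun (Fin n) ℝ i, fderiv ℝ (gradient H) p.1
      (EuclideanSpace.basisFun (Fin n) ℝ i)), fun i => exists_tangentAt_fst hf hreg hH hp _, ?_⟩⟩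
  have : baseVolume n (fun i => (EuclideanSpace.basisFun (Fin n) ℝ i, fderiv ℝ (gradient H) p.1
      (EuclideanSpace.basisFun (Fin n) ℝ i))) =
      (EuclideanSpace.basisFun (Fin n) ℝ).toBasis.det (EuclideanSpace.basisFun (Fin n) ℝ).toBasis :=
    congrArg (EuclideanSpace.basisFun (Fin n) ℝ).toBasis.det (funext fun i => by simp)
  rw [this, Module.Basis.det_self]
  exact one_ne_zero

end Graphs

/-! ### Superpotentials with nonnegative weights -/

section Potential

/-- A superpotential whose monomials have weights depending on the point of the base. -/
noncomputable def pot (R : Finset (Fin n → ℤ)) (w : (Fin n → ℤ) → Base n → ℝ) (x : Torus n) : ℂ :=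
  -1 + ∑ α ∈ R, ((w α x.1 : ℝ) : ℂ) * ((∑ i, α i • x.2 i : Real.Angle).toCircle : ℂ)

/-- The real part of the superpotential, on the cover. -/
noncomputable def potRe (R : Finset (Fin n → ℤ)) (w : (Fin n → ℤ) → Base n → ℝ)
    (q : Cover n) : ℝ := -1 + ∑ α ∈ R, w α q.1 * Real.cos (inner ℝ (vec α) q.2)

/-- The imaginary part of the superpotential, on the cover. -/
noncomputable def potIm (R : Finset (Fin n → ℤ)) (w : (Fin n → ℤ) → Base n → ℝ)
    (q : Cover n) : ℝ := ∑ α ∈ R, w α q.1 * Real.sin (inner ℝ (vec α) q.2)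

/-- The restriction of the superpotential to the zero section. -/
noncomputable def potBase (R : Finset (Fin n → ℤ)) (w : (Fin n → ℤ) → Base n → ℝ)
    (u : Base n) : ℝ := -1 + ∑ α ∈ R, w α u

/-- The weighted sum of the exponents. -/
noncomputable def potDir (R : Finset (Fin n → ℤ)) (w : (Fin n → ℤ) → Base n → ℝ)
    (u : Base n) : Base n := ∑ α ∈ R, w α u • vec α

lemma inner_vec (α : Fin n → ℤ) (θ : Base n) : inner ℝ (vec α) θ = ∑ i, α i * θ i := by
  rw [PiLp.inner_apply]
  refine Finset.sum_congr rfl fun i _ => ?_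
  rw [vec_apply]
  simp [mul_comm]

lemma inner_vec_vec (α k : Fin n → ℤ) : inner ℝ (vec α) (vec k) = ((∑ i, α i * k i : ℤ) : ℝ) := by
  rw [inner_vec]
  push_cast
  rfl

variable {R : Finset (Fin n → ℤ)} {w : (Fin n → ℤ) → Base n → ℝ}

lemma pot_cov (q : Cover n) : pot R w (cov q) = potRe R w q + potIm R w q * Complex.I := by
  have h : ∀ α : Fin n → ℤ, (∑ i, α i • (cov q).2 i : Real.Angle) =
      ((inner ℝ (vec α) q.2 : ℝ) : Real.Angle) := by
    intro α
    rw [inner_vec]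
    simp only [cov]
    rw [← Real.Angle.coe_coeHom, map_sum]
    refine Finset.sum_congr rfl fun i _ => ?_
    rw [Real.Angle.coe_coeHom, ← Real.Angle.coe_zsmul, zsmul_eq_mul]
  simp only [pot, potRe, potIm, h, Real.Angle.coe_toCircle, Real.Angle.cos_coe, Real.Angle.sin_coe]
  push_cast
  rw [Finset.sum_mul, add_assoc, ← Finset.sum_add_distrib]
  congr 1
  refine Finset.sum_congr rfl fun α _ => ?_
  change ((w α q.1 : ℝ) : ℂ) * _ = _
  ring

lemma contDiff_potBase (hw : ∀ α ∈ R, ContDiff ℝ ∞ (w α)) : ContDiff ℝ ∞ (potBase R w) :=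
  contDiff_const.add (ContDiff.sum fun α hα => hw α hα)

lemma contDiff_phase (α : Fin n → ℤ) :
    ContDiff ℝ ∞ fun q : Cover n => (inner ℝ (vec α) q.2 : ℝ) :=
  contDiff_const.inner ℝ contDiff_snd

lemma contDiff_potRe (hw : ∀ α ∈ R, ContDiff ℝ ∞ (w α)) : ContDiff ℝ ∞ (potRe R w) :=
  contDiff_const.add (ContDiff.sum fun α hα =>
    ((hw α hα).comp contDiff_fst).mul (Real.contDiff_cos.comp (contDiff_phase α)))

lemma contDiff_potIm (hw : ∀ α ∈ R, ContDiff ℝ ∞ (w α)) : ContDiff ℝ ∞ (potIm R w) :=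
  ContDiff.sum fun α hα =>
    ((hw α hα).comp contDiff_fst).mul (Real.contDiff_sin.comp (contDiff_phase α))

lemma fderiv_pot_cov (hw : ∀ α ∈ R, ContDiff ℝ ∞ (w α)) (q v : Cover n) :
    fderiv ℝ (pot R w ∘ cov) q v =
      fderiv ℝ (potRe R w) q v + fderiv ℝ (potIm R w) q v * Complex.I := by
  have h1 : (pot R w ∘ cov) = fun q => ((potRe R w q : ℝ) : ℂ) +
      ((potIm R w q : ℝ) : ℂ) * Complex.I := funext pot_cov
  have hA := Complex.ofRealCLM.hasFDerivAt.comp q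
    ((contDiff_potRe hw).differentiable (by simp) q).hasFDerivAt
  have hB := Complex.ofRealCLM.hasFDerivAt.comp q
    ((contDiff_potIm hw).differentiable (by simp) q).hasFDerivAt
  rw [h1]
  have h2 : HasFDerivAt (fun q => ((potRe R w q : ℝ) : ℂ) + ((potIm R w q : ℝ) : ℂ) * Complex.I) _
    q := hA.add (hB.mul_const Complex.I)
  rw [h2.fderiv]
  simp [mul_comm]

lemma hasFDerivAt_phase (α : Fin n → ℤ) (q : Cover n) :
    HasFDerivAt (fun q : Cover n => (inner ℝ (vec α) q.2 : ℝ))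
      (innerSL ℝ (vec α) ∘L ContinuousLinearMap.snd ℝ (Base n) (Base n)) q :=
  (innerSL ℝ (vec α) ∘L ContinuousLinearMap.snd ℝ (Base n) (Base n)).hasFDerivAt

lemma fderiv_potRe (hw : ∀ α ∈ R, ContDiff ℝ ∞ (w α)) (q v : Cover n) :
    fderiv ℝ (potRe R w) q v = ∑ α ∈ R, (Real.cos (inner ℝ (vec α) q.2) * fderiv ℝ (w α) q.1 v.1 -
      w α q.1 * Real.sin (inner ℝ (vec α) q.2) * inner ℝ (vec α) v.2) := by
  have h : HasFDerivAt (potRe R w) _ q := (HasFDerivAt.fun_sum fun α hα =>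
    (HasFDerivAt.comp (g := w α) q ((hw α hα).differentiable (by simp) q.1).hasFDerivAt
      hasFDerivAt_fst).mul (hasFDerivAt_phase α q).cos).const_add (-1)
  rw [h.fderiv]
  simp only [sum_apply]
  refine Finset.sum_congr rfl fun α _ => ?_
  change w α q.1 * (-Real.sin (inner ℝ (vec α) q.2) * inner ℝ (vec α) v.2) +
    Real.cos (inner ℝ (vec α) q.2) * fderiv ℝ (w α) q.1 v.1 = _
  ring

lemma fderiv_potIm (hw : ∀ α ∈ R, ContDiff ℝ ∞ (w α)) (q v : Cover n) :
    fderiv ℝ (potIm R w) q v = ∑ α ∈ R, (Real.sin (inner ℝ (vec α) q.2) * fderiv ℝ (w α) q.1 v.1 +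
      w α q.1 * Real.cos (inner ℝ (vec α) q.2) * inner ℝ (vec α) v.2) := by
  have h : HasFDerivAt (potIm R w) _ q := (HasFDerivAt.fun_sum fun α hα =>
    (HasFDerivAt.comp (g := w α) q ((hw α hα).differentiable (by simp) q.1).hasFDerivAt
      hasFDerivAt_fst).mul (hasFDerivAt_phase α q).sin)
  rw [h.fderiv]
  simp only [sum_apply]
  refine Finset.sum_congr rfl fun α _ => ?_
  change w α q.1 * (Real.cos (inner ℝ (vec α) q.2) * inner ℝ (vec α) v.2) +
    Real.sin (inner ℝ (vec α) q.2) * fderiv ℝ (w α) q.1 v.1 = _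
  ring

lemma fderiv_potBase (hw : ∀ α ∈ R, ContDiff ℝ ∞ (w α)) (u δ : Base n) :
    fderiv ℝ (potBase R w) u δ = ∑ α ∈ R, fderiv ℝ (w α) u δ := by
  have h : HasFDerivAt (potBase R w) _ u := (HasFDerivAt.fun_sum fun α hα =>
    ((hw α hα).differentiable (by simp) u).hasFDerivAt).const_add (-1)
  rw [h.fderiv]
  simp

lemma gradP_eq_of_fderiv {F : Cover n → ℝ} {q : Cover n} {a : Base n}
    (h : ∀ v : Base n, fderiv ℝ F q (0, v) = inner ℝ a v) : gradP F q = a := by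
  refine ext_inner_right ℝ fun v => ?_
  rw [← h, fderiv_eq_gradQ_add_gradP]
  simp

lemma gradQ_eq_of_fderiv {F : Cover n → ℝ} {q : Cover n} {a : Base n}
    (h : ∀ v : Base n, fderiv ℝ F q (v, 0) = inner ℝ a v) : gradQ F q = a := by
  refine ext_inner_right ℝ fun v => ?_
  rw [← h, fderiv_eq_gradQ_add_gradP]
  simp

/-- The phases of the nonvanishing monomials are trivial at `q`. -/
def PhasesTrivial (R : Finset (Fin n → ℤ)) (w : (Fin n → ℤ) → Base n → ℝ) (q : Cover n) : Prop :=
  ∀ α ∈ R, w α q.1 ≠ 0 → ∃ m : ℤ, inner ℝ (vec α) q.2 = 2 * Real.pi * m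

lemma PhasesTrivial.cos {q : Cover n} (h : PhasesTrivial R w q) {α : Fin n → ℤ} (hα : α ∈ R)
    (hw : w α q.1 ≠ 0) : Real.cos (inner ℝ (vec α) q.2) = 1 := by
  obtain ⟨m, hm⟩ := h α hα hw
  rw [hm, mul_comm]
  exact Real.cos_int_mul_two_pi m

lemma PhasesTrivial.sin {q : Cover n} (h : PhasesTrivial R w q) {α : Fin n → ℤ} (hα : α ∈ R)
    (hw : w α q.1 ≠ 0) : Real.sin (inner ℝ (vec α) q.2) = 0 := by
  obtain ⟨m, hm⟩ := h α hα hw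
  rw [hm, show 2 * Real.pi * m = ((2 * m : ℤ) : ℝ) * Real.pi by push_cast; ring]
  exact Real.sin_int_mul_pi _

lemma PhasesTrivial.potRe {q : Cover n} (h : PhasesTrivial R w q) :
    potRe R w q = potBase R w q.1 := by
  rw [ToricMirror.potRe, potBase]
  congr 1
  refine Finset.sum_congr rfl fun α hα => ?_
  by_cases hw : w α q.1 = 0
  · rw [hw, zero_mul]
  · rw [h.cos hα hw, mul_one]

lemma PhasesTrivial.potIm {q : Cover n} (h : PhasesTrivial R w q) : potIm R w q = 0 := by
  refine Finset.sum_eq_zero fun α hα => ?_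
  by_cases hw : w α q.1 = 0
  · rw [hw, zero_mul]
  · rw [h.sin hα hw, mul_zero]

lemma PhasesTrivial.gradP_potRe {q : Cover n} (h : PhasesTrivial R w q)
    (hw : ∀ α ∈ R, ContDiff ℝ ∞ (w α)) : gradP (ToricMirror.potRe R w) q = 0 := by
  refine gradP_eq_of_fderiv fun v => ?_
  rw [fderiv_potRe hw, inner_zero_left]
  refine Finset.sum_eq_zero fun α hα => ?_
  by_cases hwα : w α q.1 = 0
  · simp [hwα]
  · simp [h.sin hα hwα]

lemma PhasesTrivial.gradP_potIm {q : Cover n} (h : PhasesTrivial R w q)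
    (hw : ∀ α ∈ R, ContDiff ℝ ∞ (w α)) : gradP (ToricMirror.potIm R w) q = potDir R w q.1 := by
  refine gradP_eq_of_fderiv fun v => ?_
  rw [fderiv_potIm hw, potDir, sum_inner]
  refine Finset.sum_congr rfl fun α hα => ?_
  rw [inner_smul_left]
  by_cases hwα : w α q.1 = 0
  · simp [hwα]
  · simp [h.sin hα hwα, h.cos hα hwα]

/-- A zero of a nonnegative weight is a minimum. Monomials that are absent at a point thus do not
contribute to first derivatives there either. -/
lemma fderiv_weight_eq_zero (hpos : ∀ α ∈ R, ∀ u, 0 ≤ w α u) {α : Fin n → ℤ} (hα : α ∈ R)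
    {u : Base n} (h : w α u = 0) : fderiv ℝ (w α) u = 0 :=
  IsLocalMin.fderiv_eq_zero (Eventually.of_forall fun v => by rw [h]; exact hpos α hα v)

lemma PhasesTrivial.gradQ_potRe {q : Cover n} (h : PhasesTrivial R w q)
    (hw : ∀ α ∈ R, ContDiff ℝ ∞ (w α)) (hpos : ∀ α ∈ R, ∀ u, 0 ≤ w α u) :
    gradQ (ToricMirror.potRe R w) q = gradient (potBase R w) q.1 := by
  refine gradQ_eq_of_fderiv fun v => ?_
  rw [inner_gradient, fderiv_potRe hw, fderiv_potBase hw]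
  refine Finset.sum_congr rfl fun α hα => ?_
  by_cases hwα : w α q.1 = 0
  · simp [hwα, fderiv_weight_eq_zero hpos hα hwα]
  · simp [h.cos hα hwα]

lemma cos_inner_shift (α k : Fin n → ℤ) (θ : Base n) :
    Real.cos (inner ℝ (vec α) (θ + (2 * Real.pi) • vec k)) = Real.cos (inner ℝ (vec α) θ) := by
  rw [inner_add_right, inner_smul_right, inner_vec_vec, mul_comm (2 * Real.pi)]
  exact Real.cos_add_int_mul_two_pi _ _

lemma sin_inner_shift (α k : Fin n → ℤ) (θ : Base n) :
    Real.sin (inner ℝ (vec α) (θ + (2 * Real.pi) • vec k)) = Real.sin (inner ℝ (vec α) θ) := by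
  rw [inner_add_right, inner_smul_right, inner_vec_vec, mul_comm (2 * Real.pi)]
  exact Real.sin_add_int_mul_two_pi _ _

lemma potRe_shift (k : Fin n → ℤ) (q : Cover n) :
    potRe R w (q + (0, (2 * Real.pi) • vec k)) = potRe R w q := by
  simp [potRe, cos_inner_shift]

lemma potIm_shift (k : Fin n → ℤ) (q : Cover n) :
    potIm R w (q + (0, (2 * Real.pi) • vec k)) = potIm R w q := by
  simp [potIm, sin_inner_shift]

lemma gradQ_shift {F : Cover n → ℝ} {c : Cover n} (h : ∀ q, F (q + c) = F q) (q : Cover n) :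
    gradQ F (q + c) = gradQ F q := by
  rw [gradQ, gradQ, ← fderiv_comp_add_right]
  simp only [h]

lemma gradP_shift {F : Cover n → ℝ} {c : Cover n} (h : ∀ q, F (q + c) = F q) (q : Cover n) :
    gradP F (q + c) = gradP F q := by
  rw [gradP, gradP, ← fderiv_comp_add_right]
  simp only [h]

/-- The Poisson bracket of the real and imaginary parts of the superpotential. -/
noncomputable def bracket (R : Finset (Fin n → ℤ)) (w : (Fin n → ℤ) → Base n → ℝ)
    (q : Cover n) : ℝ :=
  inner ℝ (gradQ (potRe R w) q) (gradP (potIm R w) q) -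
    inner ℝ (gradP (potRe R w) q) (gradQ (potIm R w) q)

/-- The horizontal vector field which covers the constant vector field `-(a + b √-1)`. -/
noncomputable def horField (R : Finset (Fin n → ℤ)) (w : (Fin n → ℤ) → Base n → ℝ) (a b : ℝ)
    (q : Cover n) : Cover n :=
  (bracket R w q)⁻¹ • (b • hamField (potRe R w) q - a • hamField (potIm R w) q)

lemma bracket_shift (k : Fin n → ℤ) (q : Cover n) :
    bracket R w (q + (0, (2 * Real.pi) • vec k)) = bracket R w q := by
  simp only [bracket, gradQ_shift (potRe_shift k), gradQ_shift (potIm_shift k),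
    gradP_shift (potRe_shift k), gradP_shift (potIm_shift k)]

lemma horField_shift (a b : ℝ) (k : Fin n → ℤ) (q : Cover n) :
    horField R w a b (q + (0, (2 * Real.pi) • vec k)) = horField R w a b q := by
  simp only [horField, bracket_shift, hamField, gradQ_shift (potRe_shift k),
    gradQ_shift (potIm_shift k), gradP_shift (potRe_shift k), gradP_shift (potIm_shift k)]

lemma contDiff_bracket (hw : ∀ α ∈ R, ContDiff ℝ ∞ (w α)) : ContDiff ℝ ∞ (bracket R w) :=
  ((contDiff_gradQ (contDiff_potRe hw)).inner ℝ (contDiff_gradP (contDiff_potIm hw))).sub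
    ((contDiff_gradP (contDiff_potRe hw)).inner ℝ (contDiff_gradQ (contDiff_potIm hw)))

lemma contDiffAt_horField (hw : ∀ α ∈ R, ContDiff ℝ ∞ (w α)) (a b : ℝ) {q : Cover n}
    (hq : bracket R w q ≠ 0) : ContDiffAt ℝ ∞ (horField R w a b) q := by
  have h1 : ContDiff ℝ ∞ fun q => hamField (potRe R w) q := contDiff_hamField (contDiff_potRe hw)
  have h2 : ContDiff ℝ ∞ fun q => hamField (potIm R w) q := contDiff_hamField (contDiff_potIm hw)
  have h3 : ContDiff ℝ ∞ fun q => b • hamField (potRe R w) q - a • hamField (potIm R w) q :=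
    (h1.const_smul b).sub (h2.const_smul a)
  have h4 : ContDiffAt ℝ ∞ (fun q => (bracket R w q)⁻¹) q :=
    (contDiff_bracket hw).contDiffAt.inv hq
  exact h4.smul h3.contDiffAt

lemma fderiv_potRe_hamField_potIm (q : Cover n) :
    fderiv ℝ (potRe R w) q (hamField (potIm R w) q) = bracket R w q := by
  rw [fderiv_eq_gradQ_add_gradP, hamField, bracket, inner_neg_right]
  ring

lemma fderiv_potIm_hamField_potRe (q : Cover n) :
    fderiv ℝ (potIm R w) q (hamField (potRe R w) q) = -bracket R w q := by
  rw [fderiv_eq_gradQ_add_gradP, hamField, bracket, inner_neg_right,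
    real_inner_comm (gradP (potRe R w) q), real_inner_comm (gradQ (potRe R w) q)]
  ring

lemma fderiv_potRe_horField (a b : ℝ) {q : Cover n} (hq : bracket R w q ≠ 0) :
    fderiv ℝ (potRe R w) q (horField R w a b q) = -a := by
  rw [horField, map_smul, map_sub, map_smul, map_smul, fderiv_hamField,
    fderiv_potRe_hamField_potIm, smul_eq_mul, smul_eq_mul, smul_eq_mul]
  field_simp
  ring

lemma fderiv_potIm_horField (a b : ℝ) {q : Cover n} (hq : bracket R w q ≠ 0) :
    fderiv ℝ (potIm R w) q (horField R w a b q) = -b := by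
  rw [horField, map_smul, map_sub, map_smul, map_smul, fderiv_hamField,
    fderiv_potIm_hamField_potRe, smul_eq_mul, smul_eq_mul, smul_eq_mul]
  field_simp
  ring

lemma omega_hamField (F : Cover n → ℝ) (q y : Cover n) :
    omega (hamField F q) y = -fderiv ℝ F q y := by
  rw [fderiv_eq_gradQ_add_gradP, hamField, omega, inner_neg_left]
  ring

lemma omega_add_left (v v' y : Cover n) : omega (v + v') y = omega v y + omega v' y := by
  simp only [omega, Prod.fst_add, Prod.snd_add, inner_add_left]
  ring

lemma omega_smul_left (c : ℝ) (v y : Cover n) : omega (c • v) y = c * omega v y := by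
  simp only [omega, Prod.smul_fst, Prod.smul_snd, inner_smul_left, conj_trivial]
  ring

lemma omega_comm (v y : Cover n) : omega v y = -omega y v := by
  simp only [omega, real_inner_comm]
  ring

lemma omega_horField (a b : ℝ) {q y : Cover n} (hA : fderiv ℝ (potRe R w) q y = 0)
    (hB : fderiv ℝ (potIm R w) q y = 0) : omega (horField R w a b q) y = 0 := by
  rw [horField, omega_smul_left, sub_eq_add_neg, ← neg_smul, omega_add_left, omega_smul_left,
    omega_smul_left, omega_hamField, omega_hamField, hA, hB]
  simp

/-- Horizontal lifts of tangent vectors are unique where the connection is nondegenerate. -/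
lemma eq_horField {a b : ℝ} {q v : Cover n} (hq : bracket R w q ≠ 0)
    (hA : fderiv ℝ (potRe R w) q v = -a) (hB : fderiv ℝ (potIm R w) q v = -b)
    (hom : ∀ y, fderiv ℝ (potRe R w) q y = 0 → fderiv ℝ (potIm R w) q y = 0 → omega v y = 0) :
    v = horField R w a b q := by
  set d := v + (-1 : ℝ) • horField R w a b q with hd
  have hdA : fderiv ℝ (potRe R w) q d = 0 := by
    rw [hd, map_add, map_smul, hA, fderiv_potRe_horField a b hq, smul_eq_mul]; ring
  have hdB : fderiv ℝ (potIm R w) q d = 0 := by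
    rw [hd, map_add, map_smul, hB, fderiv_potIm_horField a b hq, smul_eq_mul]; ring
  have hker : ∀ y, fderiv ℝ (potRe R w) q y = 0 → fderiv ℝ (potIm R w) q y = 0 →
      omega d y = 0 := fun y h1 h2 => by
    rw [hd, omega_add_left, omega_smul_left, hom y h1 h2, omega_horField a b h1 h2]
    ring
  -- As the bracket is nonzero, the Hamiltonian fields of `Re W` and `Im W` complement the common
  -- kernel of the two differentials; `d` is symplectically orthogonal to both parts.
  have hall : ∀ y, omega d y = 0 := by
    intro y
    set κ := bracket R w q with hκ
    set x := (fderiv ℝ (potIm R w) q y / κ) • hamField (potRe R w) q +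
      (-(fderiv ℝ (potRe R w) q y / κ)) • hamField (potIm R w) q with hx
    have h1 : omega d (y + x) = 0 := by
      refine hker _ ?_ ?_
      · rw [hx, map_add, map_add, map_smul, map_smul, fderiv_hamField,
          fderiv_potRe_hamField_potIm, smul_eq_mul, smul_eq_mul]
        field_simp
        ring
      · rw [hx, map_add, map_add, map_smul, map_smul, fderiv_hamField,
          fderiv_potIm_hamField_potRe, smul_eq_mul, smul_eq_mul]
        field_simp
        ring
    have h2 : omega x d = 0 := by
      rw [hx, omega_add_left, omega_smul_left, omega_smul_left, omega_hamField, omega_hamField,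
        hdA, hdB]
      ring
    rw [omega_comm, omega_add_left, h2, add_zero] at h1
    rw [omega_comm]
    exact h1
  -- Nondegeneracy of the symplectic form, tested on the rotation of `d`.
  have hd0 : d = 0 := by
    have h1 := hall (d.2, -d.1)
    rw [omega, inner_neg_right, real_inner_self_eq_norm_sq, real_inner_self_eq_norm_sq] at h1
    have h2 : d.1 = 0 := norm_eq_zero.1 (by nlinarith [sq_nonneg ‖d.1‖, sq_nonneg ‖d.2‖])
    have h3 : d.2 = 0 := norm_eq_zero.1 (by nlinarith [sq_nonneg ‖d.1‖, sq_nonneg ‖d.2‖])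
    exact Prod.ext h2 h3
  rw [hd, neg_one_smul, ← sub_eq_add_neg, sub_eq_zero] at hd0
  exact hd0

end Potential

/-! ### Flows near compact sets and uniqueness of integral curves -/

section Flow

variable {E : Type} [NormedAddCommGroup E] [NormedSpace ℝ E]

/-- Integral curves near a point, with arbitrary initial time in a fixed interval, which stay in a
prescribed neighbourhood. -/
lemma exists_localFlow [CompleteSpace E] {X : E → E} {x₀ : E} (hX : ContDiffAt ℝ 1 X x₀) {U : Set E}
    (hU : U ∈ 𝓝 x₀) : ∃ ρ > 0, ∃ ε > 0, ∀ x ∈ Metric.ball x₀ ρ, ∀ r₀ ∈ Icc 0 ε, ∃ c : ℝ → E,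
      c r₀ = x ∧ ∀ r ∈ Icc 0 ε, c r ∈ U ∧ HasDerivWithinAt c (X (c r)) (Icc 0 ε) r := by
  obtain ⟨K, s, hs, hK⟩ := hX.exists_lipschitzOnWith
  obtain ⟨L, hL⟩ : ∃ L : ℝ, ‖X x₀‖ < L := ⟨_, lt_add_one _⟩
  have hL0 : 0 < L := (norm_nonneg _).trans_lt hL
  have hb : {x | ‖X x‖ < L} ∈ 𝓝 x₀ :=
    hX.continuousAt.norm.eventually_lt continuousAt_const hL
  obtain ⟨a, ha, hball⟩ := Metric.nhds_basis_closedBall.mem_iff.1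
    (inter_mem hU (inter_mem hs hb))
  -- Half of the radius `a` is spent on the initial point, the other half on moving at speed at most
  -- `L`.
  refine ⟨a / 2, by positivity, a / 2 / L, by positivity, fun x hx r₀ hr₀ => ?_⟩
  lift a to NNReal using ha.le
  lift L to NNReal using hL0.le
  have hpl : IsPicardLindelof (fun _ => X) (tmin := 0) (tmax := (a : ℝ) / 2 / L) ⟨r₀, hr₀⟩ x₀
      a (a / 2) L K := by
    refine IsPicardLindelof.of_time_independent (fun y hy => (hball hy).2.2.le)
      (hK.mono fun y hy => (hball hy).2.1) ?_
    have h1 : max ((a : ℝ) / 2 / L - r₀) (r₀ - 0) ≤ (a : ℝ) / 2 / L :=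
      max_le (by linarith [hr₀.1]) (by linarith [hr₀.2])
    calc (L : ℝ) * max ((a : ℝ) / 2 / L - r₀) (r₀ - 0) ≤ L * ((a : ℝ) / 2 / L) := by gcongr
      _ = a - (a / 2 : NNReal) := by
        push_cast
        field_simp
        ring
  have hx' : x ∈ Metric.closedBall x₀ ((a / 2 : NNReal) : ℝ) := by
    push_cast
    exact Metric.ball_subset_closedBall hx
  obtain ⟨α, hα⟩ := ODE.FunSpace.exists_isFixedPt_next hpl hx'
  refine ⟨α.compProj, ?_, fun t ht => ⟨(hball (α.compProj_mem_closedBall hpl.mul_max_le)).1, ?_⟩⟩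
  · exact (α.compProj_val (t := ⟨r₀, hr₀⟩)).trans
      (by rw [← hα, ODE.FunSpace.next_apply₀])
  · apply ODE.hasDerivWithinAt_picard_Icc hr₀ hpl.continuousOn_uncurry
      α.continuous_compProj.continuousOn (fun _ ht' ↦ α.compProj_mem_closedBall hpl.mul_max_le)
      x ht |>.congr_of_mem _ ht
    intro t' ht'
    nth_rw 1 [← hα]
    rw [ODE.FunSpace.compProj_of_mem ht', ODE.FunSpace.next_apply]

/-- Compactness makes the existence time uniform. The initial time is free so that a curve can be
run backwards from a point inside to the boundary. -/
lemma exists_flow_of_isCompact [CompleteSpace E] {X : E → E} {U Z : Set E} (hU : IsOpen U)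
    (hX : ContDiffOn ℝ 1 X U) (hZ : IsCompact Z) (hZU : Z ⊆ U) :
    ∃ U', IsOpen U' ∧ Z ⊆ U' ∧ ∃ ε > 0, ∀ x ∈ U', ∀ r₀ ∈ Icc 0 ε, ∃ c : ℝ → E,
      c r₀ = x ∧ ∀ r ∈ Icc 0 ε, c r ∈ U ∧ HasDerivWithinAt c (X (c r)) (Icc 0 ε) r := by
  refine hZ.induction_on (p := fun Z => ∃ U', IsOpen U' ∧ Z ⊆ U' ∧ ∃ ε > 0, ∀ x ∈ U',
    ∀ r₀ ∈ Icc 0 ε, ∃ c : ℝ → E,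
      c r₀ = x ∧ ∀ r ∈ Icc 0 ε, c r ∈ U ∧ HasDerivWithinAt c (X (c r)) (Icc 0 ε) r) ?_ ?_ ?_ ?_
  · exact ⟨∅, isOpen_empty, Subset.rfl, 1, one_pos, fun x hx => hx.elim⟩
  · rintro s t hst ⟨U', h1, h2, h3⟩
    exact ⟨U', h1, hst.trans h2, h3⟩
  · rintro s t ⟨U₁, h1, h2, ε₁, h3, h4⟩ ⟨U₂, k1, k2, ε₂, k3, k4⟩
    refine ⟨U₁ ∪ U₂, h1.union k1, union_subset_union h2 k2, min ε₁ ε₂, lt_min h3 k3, ?_⟩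
    have e1 : Icc 0 (min ε₁ ε₂) ⊆ Icc 0 ε₁ := Icc_subset_Icc_right (min_le_left _ _)
    have e2 : Icc 0 (min ε₁ ε₂) ⊆ Icc 0 ε₂ := Icc_subset_Icc_right (min_le_right _ _)
    rintro x (hx | hx) r₀ hr₀
    · obtain ⟨c, hc, h⟩ := h4 x hx r₀ (e1 hr₀)
      exact ⟨c, hc, fun r hr => ⟨(h r (e1 hr)).1, (h r (e1 hr)).2.mono e1⟩⟩
    · obtain ⟨c, hc, h⟩ := k4 x hx r₀ (e2 hr₀)
      exact ⟨c, hc, fun r hr => ⟨(h r (e2 hr)).1, (h r (e2 hr)).2.mono e2⟩⟩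
  · intro x hx
    obtain ⟨ρ, hρ, ε, hε, h⟩ := exists_localFlow (hX.contDiffAt (hU.mem_nhds (hZU hx)))
      (hU.mem_nhds (hZU hx))
    exact ⟨Metric.ball x ρ, mem_nhdsWithin_of_mem_nhds (Metric.ball_mem_nhds x hρ),
      Metric.ball x ρ, Metric.isOpen_ball, Subset.rfl, ε, hε, h⟩

/-- Two curves, one of them an integral curve, the other one an integral curve as long as it stays
in the domain, agree if they start at the same point. -/
lemma eqOn_of_integralCurve {X : E → E} {U : Set E} (hU : IsOpen U) (hX : ContDiffOn ℝ 1 X U)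
    {c g : ℝ → E} {s : ℝ}
    (hg : ∀ r ∈ Icc 0 s, g r ∈ U ∧ HasDerivWithinAt g (X (g r)) (Icc 0 s) r)
    (hc : ContinuousOn c (Icc 0 s))
    (hc' : ∀ r ∈ Icc 0 s, c r ∈ U → HasDerivWithinAt c (X (c r)) (Icc 0 s) r) (h0 : c 0 = g 0) :
    EqOn c g (Icc 0 s) := by
  have hgc : ContinuousOn g (Icc 0 s) := fun r hr => (hg r hr).2.continuousWithinAt
  have hcl : IsClosed ({r | c r = g r} ∩ Icc 0 s) := by
    have := (hc.prodMk hgc).preimage_isClosed_of_isClosed isClosed_Icc (isClosed_diagonal (X := E))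
    rwa [inter_comm] at this
  suffices Icc 0 s ⊆ {r | c r = g r} from this
  -- Nothing confines `c` to `U` in advance; it is there as long as it agrees with `g`. Hence a
  -- continuation argument: agreement is closed and propagates to the right.
  refine hcl.Icc_subset_of_forall_exists_gt h0 fun r hr y hy => ?_
  have hrI : r ∈ Icc 0 s := ⟨hr.2.1, hr.2.2.le⟩
  have hr1 : c r = g r := hr.1
  obtain ⟨K, N, hN, hK⟩ := (hX.contDiffAt (hU.mem_nhds (hg r hrI).1)).exists_lipschitzOnWith
  have hNU : N ∩ U ∈ 𝓝 (g r) := inter_mem hN (hU.mem_nhds (hg r hrI).1)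
  have e1 : ∀ᶠ x in 𝓝[Icc 0 s] r, g x ∈ N ∩ U := hgc r hrI hNU
  have e2 : ∀ᶠ x in 𝓝[Icc 0 s] r, c x ∈ N ∩ U := by
    refine hc r hrI ?_
    rw [hr1]
    exact hNU
  have hle : 𝓝[≥] r ≤ 𝓝[Icc 0 s] r := by
    rw [← nhdsWithin_Icc_eq_nhdsGE hr.2.2]
    exact nhdsWithin_mono _ (Icc_subset_Icc_left hr.2.1)
  obtain ⟨b, hb, hsub⟩ := (mem_nhdsGE_iff_exists_mem_Ioc_Ico_subset (show r < min y s from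
    lt_min hy hr.2.2)).1 (hle (e1.and e2))
  have hbs : ∀ x ∈ Ico r b, x ∈ Icc 0 s := fun x hx =>
    ⟨hr.2.1.trans hx.1, hx.2.le.trans (hb.2.trans (min_le_right _ _))⟩
  have hder : ∀ {d : ℝ → E} {v : E} {x : ℝ}, x ∈ Ico r b →
      HasDerivWithinAt d v (Icc 0 s) x → HasDerivWithinAt d v (Ici x) x := by
    intro d v x hx hd
    refine hd.mono_of_mem_nhdsWithin ?_
    have hxs : x < s := hx.2.trans_le (hb.2.trans (min_le_right _ _))
    exact mem_of_superset (Icc_mem_nhdsGE hxs) (Icc_subset_Icc_left (hbs x hx).1)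
  have hI : Icc r b ⊆ Icc 0 s := Icc_subset_Icc hr.2.1 (hb.2.trans (min_le_right _ _))
  have := ODE_solution_unique_of_mem_Icc_right (v := fun _ => X) (s := fun _ => N) (K := K)
    (a := r) (b := b) (f := c) (g := g) (fun _ _ => hK) (hc.mono hI)
    (fun x hx => hder hx (hc' x (hbs x hx) (hsub hx).2.2)) (fun x hx => (hsub hx).2.1)
    (hgc.mono hI) (fun x hx => hder hx (hg x (hbs x hx)).2) (fun x hx => (hsub hx).1.1) hr1
  exact ⟨b, this ⟨hb.1.le, le_rfl⟩, hb.1, hb.2.trans (min_le_left _ _)⟩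

end Flow

/-! ### Graphs of constant phase and parallel transport -/

section Transport

variable {R : Finset (Fin n → ℤ)} {w : (Fin n → ℤ) → Base n → ℝ}

/-- The point of the graph of `dH` over `u`. -/
noncomputable def graphPt (H : Base n → ℝ) (u : Base n) : Cover n := (u, gradient H u)

lemma sheet_eq_graphPt (H : Base n → ℝ) (k : Fin n → ℤ) (u : Base n) :
    sheet H k u = graphPt H u + (0, (2 * Real.pi) • vec k) := by
  simp [sheet, graphPt]

lemma contDiff_graphPt {H : Base n → ℝ} (hH : ContDiff ℝ ∞ H) : ContDiff ℝ ∞ (graphPt H) :=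
  contDiff_id.prodMk (contDiff_gradient hH)

lemma hasFDerivAt_graphPt {H : Base n → ℝ} (hH : ContDiff ℝ ∞ H) (u : Base n) :
    HasFDerivAt (graphPt H) ((ContinuousLinearMap.id ℝ (Base n)).prod
      (fderiv ℝ (gradient H) u)) u :=
  (hasFDerivAt_id u).prodMk ((contDiff_gradient hH).differentiable (by simp) u).hasFDerivAt

/-- The Hamiltonian vector field of `F` is tangent to a Lagrangian graph on which `F` vanishes. -/
lemma hamField_graphPt {F : Cover n → ℝ} (hF : ContDiff ℝ ∞ F) {H : Base n → ℝ}
    (hH : ContDiff ℝ ∞ H) {u : Base n} (h : ∀ᶠ v in 𝓝 u, F (graphPt H v) = 0) :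
    (hamField F (graphPt H u)).2 =
      fderiv ℝ (gradient H) u (hamField F (graphPt H u)).1 := by
  have h1 : HasFDerivAt (fun v => F (graphPt H v)) _ u :=
    HasFDerivAt.comp (g := F) u (hF.differentiable (by simp) _).hasFDerivAt
      (hasFDerivAt_graphPt hH u)
  have h2 : HasFDerivAt (fun v => F (graphPt H v)) (0 : Base n →L[ℝ] ℝ) u :=
    (hasFDerivAt_const (0 : ℝ) u).congr_of_eventuallyEq h
  refine ext_inner_right ℝ fun δ => ?_
  have h3 := congrArg (fun L => L δ) (h1.unique h2)
  simp only [ContinuousLinearMap.comp_apply, ContinuousLinearMap.prod_apply,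
    ContinuousLinearMap.id_apply, zero_apply] at h3
  rw [fderiv_eq_gradQ_add_gradP] at h3
  simp only [hamField]
  rw [inner_neg_left, inner_fderiv_gradient_comm hH, real_inner_comm]
  rw [real_inner_comm] at h3
  linarith [real_inner_comm (gradP F (graphPt H u)) (fderiv ℝ (gradient H) u δ)]

lemma hamField_const_smul_sub {F G : Cover n → ℝ} (hF : ContDiff ℝ ∞ F) (hG : ContDiff ℝ ∞ G)
    (a b : ℝ) (q : Cover n) :
    hamField (fun q => a * F q - b * G q) q = a • hamField F q - b • hamField G q := by
  have h : fderiv ℝ (fun q => a * F q - b * G q) q = a • fderiv ℝ F q - b • fderiv ℝ G q :=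
    (((hF.differentiable (by simp) q).hasFDerivAt.const_mul a).sub
      ((hG.differentiable (by simp) q).hasFDerivAt.const_mul b)).fderiv
  have hP : gradP (fun q => a * F q - b * G q) q = a • gradP F q - b • gradP G q := by
    refine gradP_eq_of_fderiv fun v => ?_
    rw [h, sub_apply, smul_apply, smul_apply,
      fderiv_eq_gradQ_add_gradP, fderiv_eq_gradQ_add_gradP]
    simp [inner_sub_left, inner_smul_left]
  have hQ : gradQ (fun q => a * F q - b * G q) q = a • gradQ F q - b • gradQ G q := by
    refine gradQ_eq_of_fderiv fun v => ?_
    rw [h, sub_apply, smul_apply, smul_apply,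
      fderiv_eq_gradQ_add_gradP, fderiv_eq_gradQ_add_gradP]
    simp [inner_sub_left, inner_smul_left]
  rw [hamField, hP, hQ]
  refine Prod.ext rfl ?_
  simp only [hamField, Prod.snd_sub, Prod.smul_snd, smul_neg]
  abel

/-- Where the phase of the superpotential on a graph is constant, the horizontal vector field is
tangent to the graph. -/
lemma horField_graphPt (hw : ∀ α ∈ R, ContDiff ℝ ∞ (w α)) {H : Base n → ℝ} (hH : ContDiff ℝ ∞ H)
    {a b : ℝ} {u : Base n}
    (h : ∀ᶠ v in 𝓝 u, potIm R w (graphPt H v) * a = potRe R w (graphPt H v) * b) :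
    (horField R w a b (graphPt H u)).2 =
      fderiv ℝ (gradient H) u (horField R w a b (graphPt H u)).1 := by
  have hF : ContDiff ℝ ∞ fun q => b * potRe R w q - a * potIm R w q :=
    (contDiff_const.mul (contDiff_potRe hw)).sub (contDiff_const.mul (contDiff_potIm hw))
  have h1 := hamField_graphPt hF hH (u := u) (h.mono fun v hv => by linarith)
  rw [hamField_const_smul_sub (contDiff_potRe hw) (contDiff_potIm hw)] at h1
  rw [horField, Prod.smul_snd, Prod.smul_fst, h1, map_smul]

lemma potRe_le_potBase (hpos : ∀ α ∈ R, ∀ u, 0 ≤ w α u) (q : Cover n) :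
    potRe R w q ≤ potBase R w q.1 := by
  refine add_le_add_right (Finset.sum_le_sum fun α hα => ?_) _
  exact mul_le_of_le_one_right (hpos α hα _) (Real.cos_le_one _)

lemma norm_pot_cov_sq (q : Cover n) :
    ‖pot R w (cov q)‖ ^ 2 = potRe R w q ^ 2 + potIm R w q ^ 2 := by
  rw [pot_cov, Complex.sq_norm, Complex.normSq_add_mul_I]

lemma hasDerivAt_ray (ψ s : ℝ) : HasDerivAt (fun s : ℝ => -(s : ℂ) * Complex.exp (ψ * Complex.I))
    (-Complex.exp (ψ * Complex.I)) s := by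
  simpa using (Complex.ofRealCLM.hasDerivAt (x := s)).neg.mul_const (Complex.exp (ψ * Complex.I))

lemma contDiff_ray (ψ : ℝ) :
    ContDiff ℝ ∞ fun s : ℝ => -(s : ℂ) * Complex.exp (ψ * Complex.I) :=
  (Complex.ofRealCLM.contDiff (n := ∞)).neg.mul contDiff_const

lemma neg_exp_mul_I (ψ : ℝ) : -Complex.exp (ψ * Complex.I) =
    ((-Real.cos ψ : ℝ) : ℂ) + ((-Real.sin ψ : ℝ) : ℂ) * Complex.I := by
  rw [Complex.exp_mul_I]
  push_cast
  ring

lemma re_im_unique {a b c d : ℝ} (h : (a : ℂ) + b * Complex.I = c + d * Complex.I) :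
    a = c ∧ b = d := by
  have h1 := congrArg Complex.re h
  have h2 := congrArg Complex.im h
  simp at h1 h2
  exact ⟨h1, h2⟩

/-- Where the connection is nondegenerate, a horizontal lift of a ray is an integral curve of the
horizontal vector field. -/
lemma IsHorizontalLift.hasDerivWithinAt (hw : ∀ α ∈ R, ContDiff ℝ ∞ (w α)) {ψ s : ℝ}
    {c : ℝ → Cover n}
    (hc : IsHorizontalLift (pot R w) (fun s => -(s : ℂ) * Complex.exp (ψ * Complex.I)) s c)
    {r : ℝ} (hr : r ∈ Icc 0 s) (hb : bracket R w (c r) ≠ 0) :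
    HasDerivWithinAt c (horField R w (Real.cos ψ) (Real.sin ψ) (c r)) (Icc 0 s) r := by
  obtain ⟨v, hv, h1, h2⟩ := hc r hr
  rw [(hasDerivAt_ray ψ r).deriv, neg_exp_mul_I, fderiv_pot_cov hw] at h1
  obtain ⟨hA, hB⟩ := re_im_unique h1
  rw [← eq_horField hb hA hB fun y hyA hyB => h2 y ?_]
  · exact hv
  · rw [fderiv_pot_cov hw, hyA, hyB]
    simp

lemma isHorizontalLift_of_hasDerivWithinAt (hw : ∀ α ∈ R, ContDiff ℝ ∞ (w α)) {ψ s : ℝ}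
    {c : ℝ → Cover n} (hc : ∀ r ∈ Icc 0 s, bracket R w (c r) ≠ 0 ∧
      HasDerivWithinAt c (horField R w (Real.cos ψ) (Real.sin ψ) (c r)) (Icc 0 s) r) :
    IsHorizontalLift (pot R w) (fun s => -(s : ℂ) * Complex.exp (ψ * Complex.I)) s c := by
  intro r hr
  obtain ⟨hb, h⟩ := hc r hr
  refine ⟨_, h, ?_, fun y hy => ?_⟩
  · rw [(hasDerivAt_ray ψ r).deriv, neg_exp_mul_I, fderiv_pot_cov hw,
      fderiv_potRe_horField _ _ hb, fderiv_potIm_horField _ _ hb]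
  · rw [fderiv_pot_cov hw] at hy
    have := re_im_unique (c := 0) (d := 0) (by simpa using hy)
    exact omega_horField _ _ this.1 this.2

/-- A graph on which, near its boundary, the superpotential has constant phase agrees with the
parallel transport of its boundary along a ray. -/
theorem agreesWithTransport_graphOver (hw : ∀ α ∈ R, ContDiff ℝ ∞ (w α))
    (hpos : ∀ α ∈ R, ∀ u, 0 ≤ w α u) (hB : IsCompact {u | potBase R w u ≤ 0})
    (hnd : ∀ u, potBase R w u = 0 →
      0 < inner ℝ (gradient (potBase R w) u) (potDir R w u))
    {H : Base n → ℝ} (hH : ContDiff ℝ ∞ H) {ψ : ℝ} (hψ : 0 < Real.cos ψ) {N : Set (Base n)}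
    (hN : IsOpen N) (hZN : ∀ u, potBase R w u = 0 → u ∈ N)
    (hIm : ∀ u ∈ N, potIm R w (graphPt H u) * Real.cos ψ =
      potRe R w (graphPt H u) * Real.sin ψ)
    (hph : ∀ u, potBase R w u = 0 → PhasesTrivial R w (graphPt H u)) :
    AgreesWithTransport (pot R w) (graphOver {u | potBase R w u ≤ 0} H)
      (fun s => -(s : ℂ) * Complex.exp (ψ * Complex.I)) := by
  have hf := contDiff_potBase hw
  have hreg : ∀ u, potBase R w u = 0 → fderiv ℝ (potBase R w) u ≠ 0 := by
    intro u hu h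
    have := hnd u hu
    rw [inner_gradient, h] at this
    simp at this
  rw [AgreesWithTransport, bdry_graphOver hf hreg hH]
  refine ⟨contDiff_ray ψ, by simp, by rw [(hasDerivAt_ray ψ 0).deriv]; simp, ?_⟩
  set f := potBase R w with hfdef
  -- The horizontal field is tangent to the graph over `N`, so its flow there is the lift of the
  -- flow of this field on the base, on every sheet alike.
  set X : Base n → Base n :=
    fun u => (horField R w (Real.cos ψ) (Real.sin ψ) (graphPt H u)).1 with hX
  set N₁ := N ∩ {u | 0 < bracket R w (graphPt H u)} with hN₁
  have hN₁o : IsOpen N₁ := hN.inter (isOpen_lt continuous_const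
    ((contDiff_bracket hw).continuous.comp (contDiff_graphPt hH).continuous))
  have hXs : ContDiffOn ℝ ∞ X N₁ := fun u hu => by
    have h1 : ContDiffAt ℝ ∞ (horField R w (Real.cos ψ) (Real.sin ψ)) (graphPt H u) :=
      contDiffAt_horField hw _ _ (ne_of_gt hu.2)
    exact (h1.comp u (contDiff_graphPt hH).contDiffAt).fst.contDiffWithinAt
  -- On this set `f` decreases strictly along the field: the transport enters the ball.
  set N₂ := N₁ ∩ (fun u => inner ℝ (gradient f u) (X u)) ⁻¹' Iio 0 with hN₂
  have hN₂o : IsOpen N₂ := ContinuousOn.isOpen_inter_preimage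
    ((contDiff_gradient hf).continuous.continuousOn.inner hXs.continuousOn) hN₁o isOpen_Iio
  have hbr : ∀ u, f u = 0 → bracket R w (graphPt H u) = inner ℝ (gradient f u) (potDir R w u) := by
    intro u hu
    have h := hph u hu
    rw [bracket, h.gradP_potIm hw, h.gradQ_potRe hw hpos, h.gradP_potRe hw]
    simp [graphPt, hfdef]
  have hZN₂ : ∀ u, f u = 0 → u ∈ N₂ := by
    intro u hu
    have h := hph u hu
    have hb := hnd u hu
    refine ⟨⟨hZN u hu, ?_⟩, ?_⟩
    · change 0 < bracket R w (graphPt H u)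
      rw [hbr u hu]; exact hb
    · change inner ℝ (gradient f u) (X u) < 0
      have : X u = -((Real.cos ψ / bracket R w (graphPt H u)) • potDir R w u) := by
        simp only [hX, horField, Prod.smul_fst, Prod.fst_sub, hamField, h.gradP_potIm hw,
          h.gradP_potRe hw]
        simp only [graphPt]
        rw [smul_zero, zero_sub, smul_neg, smul_smul, div_eq_inv_mul]
      rw [this, inner_neg_right, inner_smul_right, hbr u hu, div_mul_cancel₀ _ hb.ne']
      linarith
  have hZ : IsCompact {u | f u = 0} :=
    hB.of_isClosed_subset (isClosed_eq hf.continuous continuous_const) fun u hu => le_of_eq hu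
  obtain ⟨U', hU'o, hZU', s₀, hs₀, hflow⟩ := exists_flow_of_isCompact hN₂o
    ((hXs.mono inter_subset_left).of_le (by simp)) hZ hZN₂
  have hlift : ∀ {α : ℝ → Base n} {r s : ℝ} (k : Fin n → ℤ), α r ∈ N₂ →
      HasDerivWithinAt α (X (α r)) (Icc 0 s) r →
      0 < bracket R w (sheet H k (α r)) ∧ HasDerivWithinAt (fun r => sheet H k (α r))
        (horField R w (Real.cos ψ) (Real.sin ψ) (sheet H k (α r))) (Icc 0 s) r := by
    intro α r s k hr hd
    rw [sheet_eq_graphPt, bracket_shift, horField_shift]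
    refine ⟨hr.1.2, ?_⟩
    have h1 := (hasFDerivAt_sheet hH k (α r)).comp_hasDerivWithinAt r hd
    have h2 := horField_graphPt hw hH (u := α r) (a := Real.cos ψ) (b := Real.sin ψ)
      (eventually_of_mem (hN.mem_nhds hr.1.1) fun v hv => hIm v hv)
    have h3 : horField R w (Real.cos ψ) (Real.sin ψ) (graphPt H (α r)) =
        ((ContinuousLinearMap.id ℝ (Base n)).prod (fderiv ℝ (gradient H) (α r))) (X (α r)) :=
      Prod.ext rfl h2
    rw [h3]
    exact h1
  have hanti : ∀ {α : ℝ → Base n} {s : ℝ}, (∀ r ∈ Icc 0 s, α r ∈ N₂ ∧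
      HasDerivWithinAt α (X (α r)) (Icc 0 s) r) → AntitoneOn (fun r => f (α r)) (Icc 0 s) := by
    intro α s hα
    have hd : ∀ r ∈ Icc 0 s, HasDerivWithinAt (fun r => f (α r))
        (fderiv ℝ f (α r) (X (α r))) (Icc 0 s) r := fun r hr =>
      (hf.differentiable (by simp) (α r)).hasFDerivAt.comp_hasDerivWithinAt r (hα r hr).2
    refine antitoneOn_of_deriv_nonpos (convex_Icc 0 s) (fun r hr => (hd r hr).continuousWithinAt)
      (fun r hr => ?_) fun r hr => ?_
    · exact ((hd r (interior_subset hr)).differentiableWithinAt).mono interior_subset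
    · rw [((hd r (interior_subset hr)).hasDerivAt (mem_interior_iff_mem_nhds.1 hr)).deriv,
        ← inner_gradient]
      exact le_of_lt (hα r (interior_subset hr)).1.2
  obtain ⟨d, hd, hdU⟩ : ∃ d > 0, ∀ u, f u ≤ 0 → -d < f u → u ∈ U' := by
    have hC : IsCompact ({u | f u ≤ 0} \ U') := hB.diff hU'o
    rcases ({u | f u ≤ 0} \ U').eq_empty_or_nonempty with he | hne
    · exact ⟨1, one_pos, fun u hu _ => by_contra fun h => he.subset ⟨hu, h⟩⟩
    · obtain ⟨v, hv, hmax⟩ := hC.exists_isMaxOn hne hf.continuous.continuousOn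
      have hv0 : f v < 0 := lt_of_le_of_ne hv.1 fun h => hv.2 (hZU' h)
      exact ⟨-f v, by linarith, fun u hu hlt => by_contra fun h =>
        absurd (hmax (show u ∈ _ from ⟨hu, h⟩)) (by simp only [mem_ofPred_eq]; linarith)⟩
  refine ⟨s₀, hs₀, min d s₀, lt_min hd hs₀, fun q hq => ⟨fun hqS => ?_, ?_⟩⟩
  · obtain ⟨hq0, k, hk⟩ := mem_lift_graphOver.1 hqS
    have hqs : q = sheet H k q.1 := Prod.ext rfl hk
    set u := q.1 with hu
    have hq0 : f u ≤ 0 := hq0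
    have hnorm := norm_pot_cov_sq (R := R) (w := w) q
    rw [hqs, sheet_eq_graphPt, potRe_shift, potIm_shift, ← sheet_eq_graphPt, ← hqs] at hnorm
    have hRle : potRe R w (graphPt H u) ≤ f u := potRe_le_potBase hpos (graphPt H u)
    -- Here `-d < -|W| ≤ Re W ≤ f ≤ 0`, so a point of the graph with small `|W|` lies near the
    -- boundary.
    have huU : u ∈ U' := by
      refine hdU u hq0 ?_
      have h1 := lt_of_lt_of_le hq (min_le_left _ _)
      nlinarith [sq_nonneg (potIm R w (graphPt H u)), norm_nonneg (pot R w (cov q))]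
    set A := potRe R w (graphPt H u) with hA
    set C := potIm R w (graphPt H u) with hC
    have hsc := Real.sin_sq_add_cos_sq ψ
    -- By constancy of the phase, `W = -s e^{iψ}` at the point considered, so `s` is the time at
    -- which the ray reaches this value; `Re W ≤ 0` makes it nonnegative.
    set s := -(A * Real.cos ψ + C * Real.sin ψ) with hs
    have hfl0 := hflow u huU
    have hIu : C * Real.cos ψ = A * Real.sin ψ := by
      obtain ⟨c, hc, h⟩ := hfl0 0 ⟨le_rfl, hs₀.le⟩
      have := (h 0 ⟨le_rfl, hs₀.le⟩).1.1.1
      rw [hc] at this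
      exact hIm u this
    have hAs : A = -s * Real.cos ψ := by
      rw [hs]; linear_combination (-A) * hsc - Real.sin ψ * hIu
    have hCs : C = -s * Real.sin ψ := by
      rw [hs]; linear_combination (-C) * hsc + Real.cos ψ * hIu
    have hs1 : 0 ≤ s := by
      by_contra hcon
      have : 0 < A := by rw [hAs]; exact mul_pos (by linarith) hψ
      linarith
    have hss : s ^ 2 = ‖pot R w (cov q)‖ ^ 2 := by
      rw [hnorm, hAs, hCs]; linear_combination (-s ^ 2) * hsc
    have hs2 : s ≤ s₀ := by
      have h1 := lt_of_lt_of_le hq (min_le_right _ _)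
      nlinarith [norm_nonneg (pot R w (cov q))]
    -- The curve through `u` at time `s` is followed back to time `0`, where `W` vanishes.
    obtain ⟨α, hαs, hα⟩ := hfl0 s ⟨hs1, hs2⟩
    have hsub : Icc 0 s ⊆ Icc 0 s₀ := Icc_subset_Icc_right hs2
    have hα' : ∀ r ∈ Icc 0 s, α r ∈ N₂ ∧ HasDerivWithinAt α (X (α r)) (Icc 0 s) r :=
      fun r hr => ⟨(hα r (hsub hr)).1, (hα r (hsub hr)).2.mono hsub⟩
    have hcurve := fun r (hr : r ∈ Icc 0 s) => hlift k (hα' r hr).1 (hα' r hr).2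
    have hconst : ∀ {G : Cover n → ℝ} {c : ℝ}, ContDiff ℝ ∞ G →
        (∀ q, bracket R w q ≠ 0 →
          fderiv ℝ G q (horField R w (Real.cos ψ) (Real.sin ψ) q) = -c) →
        ∀ r ∈ Icc 0 s, G (sheet H k (α r)) + c * r = G (sheet H k (α s)) + c * s := by
      intro G c hG hGd r hr
      have hd : ∀ r ∈ Icc 0 s, HasDerivWithinAt (fun r => G (sheet H k (α r)) + c * r) 0
          (Icc 0 s) r := fun r hr => by
        have h1 := (hG.differentiable (by simp) (sheet H k (α r))).hasFDerivAt.comp_hasDerivWithinAt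
          r (hcurve r hr).2
        rw [hGd _ (hcurve r hr).1.ne'] at h1
        have h2 := h1.add ((hasDerivAt_id r).const_mul c).hasDerivWithinAt
        rw [mul_one, neg_add_cancel] at h2
        exact h2
      have hc := constant_of_has_deriv_right_zero (fun r hr => (hd r hr).continuousWithinAt)
        (fun r hr => (hd r ⟨hr.1, hr.2.le⟩).mono_of_mem_nhdsWithin
          (mem_of_superset (Icc_mem_nhdsGE hr.2) (Icc_subset_Icc_left hr.1)))
      rw [hc r hr, hc s ⟨hs1, le_rfl⟩]
    have hReα : ∀ r ∈ Icc 0 s, potRe R w (graphPt H (α r)) = -r * Real.cos ψ := by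
      intro r hr
      have := hconst (contDiff_potRe hw) (fun q hq => fderiv_potRe_horField _ _ hq) r hr
      rw [sheet_eq_graphPt, sheet_eq_graphPt, potRe_shift, potRe_shift, hαs] at this
      linarith
    -- From `Re W = 0` at time `0` one only gets `f ≥ 0`. If `f > 0`, then `f` vanishes at some `σ >
    -- 0`; phases are trivial there, so `Re W = f = 0`, whereas `Re W = -σ cos ψ < 0`.
    have hf0 : f (α 0) = 0 := by
      have h0I : (0 : ℝ) ∈ Icc 0 s := ⟨le_rfl, hs1⟩
      have hge : 0 ≤ f (α 0) := by
        have h1 := hReα 0 h0I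
        have h2 : potRe R w (graphPt H (α 0)) ≤ f (α 0) := potRe_le_potBase hpos _
        linarith
      by_contra hne
      have hgt : 0 < f (α 0) := lt_of_le_of_ne hge (Ne.symm hne)
      have hcont : ContinuousOn (fun r => f (α r)) (Icc 0 s) := fun r hr =>
        (hf.continuous.continuousAt.comp_continuousWithinAt (hα' r hr).2.continuousWithinAt)
      obtain ⟨σ, hσ, hσ0⟩ := intermediate_value_Icc' hs1 hcont
        (show (0 : ℝ) ∈ Icc (f (α s)) (f (α 0)) from ⟨by rw [hαs]; exact hq0, hge⟩)
      have hσ0 : f (α σ) = 0 := hσ0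
      have hσpos : 0 < σ := lt_of_le_of_ne hσ.1 fun h => by
        rw [← h] at hσ0; exact hne hσ0
      have h1 := (hph _ hσ0).potRe
      rw [hReα σ hσ] at h1
      have h2 : -σ * Real.cos ψ = f (α σ) := h1
      nlinarith
    refine ⟨s, ⟨hs1, hs2⟩, fun r => sheet H k (α r), ?_, ?_, ?_⟩
    · exact ⟨mem_lift_graphOver.2 ⟨le_of_eq hf0, k, rfl⟩, hf0⟩
    · exact isHorizontalLift_of_hasDerivWithinAt hw fun r hr =>
        ⟨(hcurve r hr).1.ne', (hcurve r hr).2⟩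
    · change sheet H k (α s) = q
      rw [hαs, ← hqs]
  · rintro ⟨s, ⟨hs1, hs2⟩, c, ⟨hc0, hc0f⟩, hc, rfl⟩
    obtain ⟨-, k, hk⟩ := mem_lift_graphOver.1 (show c 0 ∈ lift _ from hc0)
    have hc0f : f (c 0).1 = 0 := hc0f
    obtain ⟨α, hα0, hα⟩ := hflow (c 0).1 (hZU' hc0f) 0 ⟨le_rfl, hs₀.le⟩
    have hsub : Icc 0 s ⊆ Icc 0 s₀ := Icc_subset_Icc_right hs2
    have hα' : ∀ r ∈ Icc 0 s, α r ∈ N₂ ∧ HasDerivWithinAt α (X (α r)) (Icc 0 s) r :=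
      fun r hr => ⟨(hα r (hsub hr)).1, (hα r (hsub hr)).2.mono hsub⟩
    have hU : IsOpen {q : Cover n | bracket R w q ≠ 0} :=
      isOpen_ne_fun (contDiff_bracket hw).continuous continuous_const
    -- A horizontal lift is an integral curve only where the bracket is nonzero, so it is compared
    -- with the lifted flow, which is known to stay there.
    have heq := eqOn_of_integralCurve hU
      (fun q hq => ((contDiffAt_horField hw (Real.cos ψ) (Real.sin ψ) hq).of_le
        (by simp)).contDiffWithinAt)
      (c := c) (g := fun r => sheet H k (α r)) (s := s)
      (fun r hr => ⟨(hlift k (hα' r hr).1 (hα' r hr).2).1.ne',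
        (hlift k (hα' r hr).1 (hα' r hr).2).2⟩)
      (fun r hr => (hc r hr).choose_spec.1.continuousWithinAt)
      (fun r hr hb => hc.hasDerivWithinAt hw hr hb)
      (by rw [hα0]; exact Prod.ext rfl hk)
    rw [heq ⟨hs1, le_rfl⟩]
    refine mem_lift_graphOver.2 ⟨?_, k, rfl⟩
    have := hanti hα' ⟨le_rfl, hs1⟩ ⟨hs1, le_rfl⟩ hs1
    simp only [hα0] at this
    exact this.trans (le_of_eq hc0f)

end Transport

/-! ### The collar of the boundary -/

section Collar

/-- A smooth step function, vanishing below `a` and equal to `1` above `2 * a`. -/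
noncomputable def step (a x : ℝ) : ℝ := Real.smoothTransition ((x - a) / a)

lemma contDiff_step (a : ℝ) : ContDiff ℝ ∞ (step a) :=
  Real.smoothTransition.contDiff.comp ((contDiff_id.sub contDiff_const).div_const a)

lemma step_nonneg (a x : ℝ) : 0 ≤ step a x := Real.smoothTransition.nonneg _

lemma step_le_one (a x : ℝ) : step a x ≤ 1 := Real.smoothTransition.le_one _

lemma step_eq_zero {a x : ℝ} (ha : 0 < a) (hx : x ≤ a) : step a x = 0 :=
  Real.smoothTransition.zero_of_nonpos (div_nonpos_of_nonpos_of_nonneg (by linarith) ha.le)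

lemma step_eq_one {a x : ℝ} (ha : 0 < a) (hx : 2 * a ≤ x) : step a x = 1 :=
  Real.smoothTransition.one_of_one_le (by rw [le_div_iff₀ ha]; linarith)

lemma step_lt_one {a x : ℝ} (ha : 0 < a) (hx : x < 2 * a) : step a x < 1 :=
  Real.smoothTransition.lt_one_of_lt_one (by rw [div_lt_iff₀ ha]; linarith)

lemma monotone_step {a : ℝ} (ha : 0 < a) : Monotone (step a) := fun x y hxy =>
  Real.smoothTransition.monotone (div_le_div_of_nonneg_right (by linarith) ha.le)

/-- Applied to the collar coordinate `K`: slope `1` near `K = 0` preserves the solution of the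
Hamilton-Jacobi equation, and slope `0` beyond `2a` makes it flat inside. -/
lemma exists_hasDerivAt_one_sub_step (a : ℝ) :
    ∃ θ : ℝ → ℝ, ContDiff ℝ ∞ θ ∧ ∀ x, HasDerivAt θ (1 - step a x) x := by
  have hc : ContDiff ℝ ∞ fun x => 1 - step a x := contDiff_const.sub (contDiff_step a)
  have hd : ∀ x, HasDerivAt (fun x => ∫ y in (0 : ℝ)..x, (1 - step a y)) (1 - step a x) x :=
    fun x => (hc.continuous.integral_hasStrictDerivAt 0 x).hasDerivAt
  refine ⟨_, contDiff_infty_iff_deriv.2 ⟨fun x => (hd x).differentiableAt, ?_⟩, hd⟩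
  rwa [funext fun x => (hd x).deriv]

lemma gradient_comp_real {g : ℝ → ℝ} {g' : ℝ} {K : Base n → ℝ} (hK : ContDiff ℝ ∞ K) {u : Base n}
    (hg : HasDerivAt g g' (K u)) : gradient (fun u => g (K u)) u = g' • gradient K u := by
  refine ext_inner_right ℝ fun v => ?_
  rw [inner_gradient, inner_smul_left, inner_gradient]
  have h : HasFDerivAt (fun u => g (K u)) (g' • fderiv ℝ K u) u :=
    hg.comp_hasFDerivAt u (hK.differentiable (by simp) u).hasFDerivAt
  rw [h.fderiv]
  rfl

variable {R : Finset (Fin n → ℤ)} {w : (Fin n → ℤ) → Base n → ℝ}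

lemma exists_bound_of_isCompact {f : Base n → ℝ} (hf : Continuous f)
    (hB : IsCompact {u | f u ≤ 0}) {U : Set (Base n)} (hU : IsOpen U)
    (hZU : ∀ u, f u = 0 → u ∈ U) : ∃ d > 0, ∀ u, f u ≤ 0 → -d < f u → u ∈ U := by
  have hC : IsCompact ({u | f u ≤ 0} \ U) := hB.diff hU
  rcases ({u | f u ≤ 0} \ U).eq_empty_or_nonempty with he | hne
  · exact ⟨1, one_pos, fun u hu _ => by_contra fun h => he.subset ⟨hu, h⟩⟩
  · obtain ⟨v, hv, hmax⟩ := hC.exists_isMaxOn hne hf.continuousOn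
    have hv0 : f v < 0 := lt_of_le_of_ne hv.1 fun h => hv.2 (hZU v h)
    exact ⟨-f v, by linarith, fun u hu hlt => by_contra fun h =>
      absurd (hmax (show u ∈ _ from ⟨hu, h⟩)) (by simp only [mem_ofPred_eq]; linarith)⟩

/-- A smooth defining function of the boundary whose differential is a Lagrangian on which the
superpotential has constant phase. -/
lemma exists_collarFunction (hw : ∀ α ∈ R, ContDiff ℝ ∞ (w α)) (hB : IsCompact {u | potBase R w u ≤ 0})
    (hnd : ∀ u, potBase R w u = 0 →
      0 < inner ℝ (gradient (potBase R w) u) (potDir R w u))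
    {ψ : ℝ} (hc : 0 < Real.cos ψ) (hs : 0 < Real.sin ψ) {O : Set (Base n)} (hO : IsOpen O)
    (hZO : ∀ u, potBase R w u = 0 → u ∈ O) :
    ∃ (K : Base n → ℝ) (N : Set (Base n)), ContDiff ℝ ∞ K ∧ IsOpen N ∧ N ⊆ O ∧
      (∀ u, potBase R w u = 0 → u ∈ N ∧ K u = 0 ∧ gradient K u = 0) ∧
      (∀ u, potBase R w u ≠ 0 → 0 < K u) ∧
      ∀ u ∈ N, potIm R w (graphPt K u) * Real.cos ψ = potRe R w (graphPt K u) * Real.sin ψ ∧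
        ∀ α ∈ R, |inner ℝ (vec α) (gradient K u)| ≤ 1 := by
  have hf := contDiff_potBase hw
  set f := potBase R w with hfdef
  set Z := {u | f u = 0} with hZdef
  have hZ : IsCompact Z :=
    hB.of_isClosed_subset (isClosed_eq hf.continuous continuous_const) fun u hu => le_of_eq hu
  -- On the zero section this Hamiltonian is `-sin ψ · f`, so its zero set there is exactly the
  -- boundary of the ball.
  set G : Cover n → ℝ := fun q => Real.cos ψ * potIm R w q - Real.sin ψ * potRe R w q with hG
  have hGs : ContDiff ℝ ∞ G :=
    (contDiff_const.mul (contDiff_potIm hw)).sub (contDiff_const.mul (contDiff_potRe hw))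
  have hG0 : ∀ u, G (u, 0) = -Real.sin ψ * f u := by
    intro u
    have hph : PhasesTrivial R w (u, 0) := fun α _ _ => ⟨0, by simp⟩
    simp [hG, hph.potRe, hph.potIm, hfdef]
  have hPz : ∀ u, gradP G (u, 0) = Real.cos ψ • potDir R w u := by
    intro u
    have hph : PhasesTrivial R w (u, 0) := fun α _ _ => ⟨0, by simp⟩
    have h := congrArg Prod.fst (hamField_const_smul_sub (contDiff_potIm hw) (contDiff_potRe hw)
      (Real.cos ψ) (Real.sin ψ) (u, 0))
    simpa [hamField, hph.gradP_potIm hw, hph.gradP_potRe hw] using h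
  have hQz : ∀ u, gradQ G (u, 0) = -Real.sin ψ • gradient f u := by
    intro u
    refine gradQ_eq_of_fderiv fun v => ?_
    have h1 : HasFDerivAt (fun v : Base n => G (v, 0)) _ u :=
      HasFDerivAt.comp (g := G) u (hGs.differentiable (by simp) _).hasFDerivAt
        ((hasFDerivAt_id u).prodMk (hasFDerivAt_const (0 : Base n) u))
    have h2 : HasFDerivAt (fun v : Base n => -Real.sin ψ * f v) _ u :=
      (hf.differentiable (by simp) u).hasFDerivAt.const_mul (-Real.sin ψ)
    simp only [hG0] at h1
    have h3 := congrArg (fun L => L v) (h1.unique h2)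
    rw [inner_smul_left, inner_gradient]
    exact h3
  obtain ⟨N, K, hNo, hZN, hKs, hKN, hKZ⟩ := exists_hamiltonJacobi hGs hZ
    (fun u hu => by rw [hG0, show f u = 0 from hu, mul_zero]) (fun u hu => by
      rw [hPz, hQz, inner_smul_left, inner_smul_right]
      have := mul_pos hs (mul_pos hc (hnd u hu))
      simp only [map_neg, conj_trivial]
      linarith)
  obtain ⟨ζ, hζ0, hζ1, hζI⟩ := exists_contMDiffMap_zero_one_nhds_of_isClosed
    (modelWithCornersSelf ℝ (Base n)) (n := (⊤ : ℕ∞)) hNo.isClosed_compl hZ.isClosed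
    (disjoint_compl_left_iff_subset.2 hZN)
  have hζs : ContDiff ℝ ∞ ζ := ζ.contMDiff.contDiff
  rw [eventually_nhdsSet_iff_forall] at hζ0 hζ1
  -- Interpolation with the constant `1` extends `K` smoothly beyond `N` and keeps it positive off
  -- the boundary.
  set K' : Base n → ℝ := fun u => ζ u * K u + (1 - ζ u) with hK'
  have hK's : ContDiff ℝ ∞ K' := by
    refine contDiff_iff_contDiffAt.2 fun u => ?_
    by_cases hu : u ∈ N
    · exact (hζs.contDiffAt.mul (hKs.contDiffAt (hNo.mem_nhds hu))).add
        (contDiffAt_const.sub hζs.contDiffAt)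
    · refine (contDiffAt_const (c := (1 : ℝ))).congr_of_eventuallyEq ?_
      filter_upwards [hζ0 u hu] with v hv
      simp [hK', hv]
  -- Phases are kept below `1` in absolute value, where the sine has the sign of its argument.
  set N₁ := interior {u | ζ u = 1} ∩ (O ∩ {u | ∀ α ∈ R, |inner ℝ (vec α) (gradient K' u)| < 1})
    with hN₁
  have hloc : ∀ u ∈ interior {u | ζ u = 1}, u ∈ N ∧ K' u = K u ∧ gradient K' u = gradient K u := by
    intro u hu
    have h1 : K' =ᶠ[𝓝 u] K := by
      filter_upwards [isOpen_interior.mem_nhds hu] with v hv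
      have : v ∈ {u | ζ u = 1} := interior_subset hv
      have : ζ v = 1 := this
      simp [hK', this]
    refine ⟨by_contra fun h => ?_, h1.eq_of_nhds, ?_⟩
    · have h2 : u ∈ {u | ζ u = 1} := interior_subset hu
      have h2 : ζ u = 1 := h2
      have h3 := (hζ0 u h).self_of_nhds
      rw [h3] at h2
      exact zero_ne_one h2
    · rw [gradient, gradient, h1.fderiv_eq]
  refine ⟨K', N₁, hK's, isOpen_interior.inter (hO.inter ?_), fun u hu => hu.2.1, ?_, ?_, ?_⟩
  · have : {u | ∀ α ∈ R, |inner ℝ (vec α) (gradient K' u)| < 1} =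
        ⋂ α ∈ R, {u | |inner ℝ (vec α) (gradient K' u)| < 1} := by ext; simp
    rw [this]
    exact isOpen_biInter_finset fun α _ => isOpen_lt
      (continuous_const.inner (contDiff_gradient hK's).continuous).abs continuous_const
  · intro u hu
    have hi : u ∈ interior {u | ζ u = 1} := mem_interior_iff_mem_nhds.2 (hζ1 u hu)
    obtain ⟨-, h2, h3⟩ := hloc u hi
    obtain ⟨h4, h5⟩ := hKZ u hu
    refine ⟨⟨hi, hZO u hu, fun α _ => ?_⟩, h2.trans h4, h3.trans h5⟩
    rw [h3, h5]
    simp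
  · intro u hu
    have h01 := hζI u
    by_cases huN : u ∈ N
    · obtain ⟨-, h2, h3⟩ := hKN u huN
      have h4 : 0 < K u := lt_of_le_of_ne h2 fun h => hu (by
        have := h3 h.symm
        rw [hG0] at this
        rcases mul_eq_zero.1 this with h | h
        · linarith
        · exact h)
      rcases eq_or_lt_of_le h01.1 with h | h
      · simp [hK', ← h]
      · have := mul_pos h h4
        simp only [hK']
        linarith [h01.2]
    · have : ζ u = 0 := (hζ0 u huN).self_of_nhds
      simp [hK', this]
  · intro u hu
    obtain ⟨h1, h2, h3⟩ := hloc u hu.1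
    refine ⟨?_, fun α hα => (hu.2.2 α hα).le⟩
    have h4 := (hKN u h1).1
    rw [← h3] at h4
    simp only [hG] at h4
    simp only [graphPt]
    linarith

/-- The functions which interpolate, near the boundary, between the Lagrangian determined by the
parallel transport of the boundary and the interior. -/
theorem exists_collar (hw : ∀ α ∈ R, ContDiff ℝ ∞ (w α))
    (hpos : ∀ α ∈ R, ∀ u, 0 ≤ w α u) (hB : IsCompact {u | potBase R w u ≤ 0})
    (hnd : ∀ u, potBase R w u = 0 →
      0 < inner ℝ (gradient (potBase R w) u) (potDir R w u))
    {ψ : ℝ} (hc : 0 < Real.cos ψ) (hs : 0 < Real.sin ψ) {O : Set (Base n)} (hO : IsOpen O)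
    (hZO : ∀ u, potBase R w u = 0 → u ∈ O) :
    ∃ (Θ S : Base n → ℝ) (N V : Set (Base n)), ContDiff ℝ ∞ Θ ∧ ContDiff ℝ ∞ S ∧ IsOpen N ∧
      (∀ u, potBase R w u = 0 → u ∈ N ∧ gradient Θ u = 0) ∧
      (∀ u ∈ N, S u = 0 ∧
        potIm R w (graphPt Θ u) * Real.cos ψ = potRe R w (graphPt Θ u) * Real.sin ψ) ∧
      (∀ u, 0 ≤ S u ∧ S u ≤ 1) ∧ IsOpen V ∧ (∀ u ∈ closure V, potBase R w u < 0) ∧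
      (∀ u, potBase R w u ≤ 0 → u ∉ V → u ∈ O) ∧ (∀ u ∈ V, gradient Θ u = 0) ∧
      ∀ u, potBase R w u < 0 →
        (u ∈ O ∧ ∃ α ∈ R, 0 < w α u ∧ -1 ≤ (inner ℝ (vec α) (gradient Θ u) : ℝ) ∧
          (inner ℝ (vec α) (gradient Θ u) : ℝ) < 0 ∧
          (inner ℝ (vec α) (gradient S u) : ℝ) ≤ 0) ∨
        (S u = 1 ∧ gradient Θ u = 0 ∧ gradient S u = 0 ∧ u ∈ closure V) := by
  obtain ⟨K, N, hK, hN, hNO, hKZ, hKpos, hKN⟩ := exists_collarFunction hw hB hnd hc hs hO hZO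
  have hf := contDiff_potBase hw
  set f := potBase R w with hfdef
  obtain ⟨d, hd, hdN⟩ := exists_bound_of_isCompact hf.continuous hB hN fun u hu => (hKZ u hu).1
  obtain ⟨a, ha, haK⟩ : ∃ a > 0, ∀ u, f u ≤ -d → 2 * a < K u := by
    have hC : IsCompact {u | f u ≤ -d} := hB.of_isClosed_subset
      (isClosed_le hf.continuous continuous_const) fun u hu => by
        have : f u ≤ -d := hu
        change f u ≤ 0
        linarith
    rcases {u | f u ≤ -d}.eq_empty_or_nonempty with he | hne
    · exact ⟨1, one_pos, fun u hu => (he.subset hu).elim⟩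
    · obtain ⟨v, hv, hmin⟩ := hC.exists_isMinOn hne hK.continuous.continuousOn
      have hv : f v ≤ -d := hv
      have hKv : 0 < K v := hKpos v (by linarith)
      refine ⟨K v / 4, by positivity, fun u hu => ?_⟩
      have : K v ≤ K u := hmin hu
      linarith
  obtain ⟨θ, hθ, hθd⟩ := exists_hasDerivAt_one_sub_step a
  have hΘg : ∀ u, gradient (fun u => θ (K u)) u = (1 - step a (K u)) • gradient K u := fun u =>
    gradient_comp_real hK (hθd (K u))
  have hSg : ∀ u, gradient (fun u => step a (K u)) u = deriv (step a) (K u) • gradient K u :=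
    fun u => gradient_comp_real hK ((contDiff_step a).differentiable (by simp) _).hasDerivAt
  -- Inside the ball `Re W ≤ f < 0`, so phase `ψ` forces `Im W < 0`. Some monomial then has a
  -- negative sine, hence a negative phase, bounded below by `-1`.
  have hcollar : ∀ u, f u < 0 → u ∈ N → ∃ α ∈ R, 0 < w α u ∧
      -1 ≤ (inner ℝ (vec α) (gradient K u) : ℝ) ∧ (inner ℝ (vec α) (gradient K u) : ℝ) < 0 := by
    intro u hu huN
    obtain ⟨h1, h2⟩ := hKN u huN
    have h3 : potRe R w (graphPt K u) ≤ f u := potRe_le_potBase hpos _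
    have h4 : potIm R w (graphPt K u) < 0 := by
      by_contra hcon
      have := mul_nonneg (not_lt.1 hcon) hc.le
      have := mul_pos_of_neg_of_neg (h3.trans_lt hu) (neg_lt_zero.2 hs)
      linarith
    obtain ⟨α, hα, h5⟩ := Finset.exists_lt_of_sum_lt (s := R) (g := fun _ => (0 : ℝ))
      (by simpa [potIm] using h4)
    simp only [graphPt] at h5
    have h6 : 0 < w α u := lt_of_le_of_ne (hpos α hα u) fun h => by
      rw [← h, zero_mul] at h5; exact lt_irrefl _ h5
    have h7 : Real.sin (inner ℝ (vec α) (gradient K u)) < 0 := by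
      by_contra hcon
      exact absurd h5 (not_lt.2 (mul_nonneg h6.le (not_lt.1 hcon)))
    obtain ⟨h8, h9⟩ := abs_le.1 (h2 α hα)
    refine ⟨α, hα, h6, h8, by_contra fun hcon => absurd h7 (not_lt.2 ?_)⟩
    exact Real.sin_nonneg_of_nonneg_of_le_pi (not_lt.1 hcon) (by linarith [Real.pi_gt_three])
  refine ⟨fun u => θ (K u), fun u => step a (K u), N ∩ {u | K u < a}, {u | f u < 0 ∧ 2 * a < K u},
    hθ.comp hK, (contDiff_step a).comp hK, hN.inter (isOpen_lt hK.continuous continuous_const),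
    fun u hu => ?_, fun u hu => ?_, fun u => ⟨step_nonneg _ _, step_le_one _ _⟩,
    (isOpen_lt hf.continuous continuous_const).inter (isOpen_lt continuous_const hK.continuous),
    fun u hu => ?_, fun u hu huV => ?_, fun u hu => ?_, fun u hu => ?_⟩
  · obtain ⟨h1, h2, h3⟩ := hKZ u hu
    refine ⟨⟨h1, ?_⟩, by rw [hΘg, h3, smul_zero]⟩
    change K u < a
    rwa [h2]
  · have h1 : step a (K u) = 0 := step_eq_zero ha (le_of_lt hu.2)
    refine ⟨h1, ?_⟩
    have h2 : graphPt (fun u => θ (K u)) u = graphPt K u := by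
      rw [graphPt, hΘg, h1, sub_zero, one_smul, graphPt]
    rw [h2]
    exact (hKN u hu.1).1
  · have h1 : f u ≤ 0 ∧ 2 * a ≤ K u := by
      have hcl : IsClosed {u | f u ≤ 0 ∧ 2 * a ≤ K u} :=
        (isClosed_le hf.continuous continuous_const).inter
          (isClosed_le continuous_const hK.continuous)
      have hsub : {u | f u < 0 ∧ 2 * a < K u} ⊆ {u | f u ≤ 0 ∧ 2 * a ≤ K u} :=
        fun v hv => And.intro hv.1.le hv.2.le
      exact closure_minimal hsub hcl hu
    refine lt_of_le_of_ne h1.1 fun h => ?_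
    have := (hKZ u h).2.1
    linarith [h1.2]
  · by_cases hlt : -d < f u
    · exact hNO (hdN u hu hlt)
    · exact (huV ⟨by linarith, haK u (not_lt.1 hlt)⟩).elim
  · rw [hΘg, step_eq_one ha hu.2.le, sub_self, zero_smul]
  · rcases lt_or_ge (K u) (2 * a) with hlt | hge
    · have hNu : u ∈ N := hdN u hu.le (by
        by_contra hcon
        linarith [haK u (not_lt.1 hcon)])
      obtain ⟨α, hα, h1, h2, h3⟩ := hcollar u hu hNu
      refine Or.inl ⟨hNO hNu, α, hα, h1, ?_⟩
      rw [hΘg, hSg, inner_smul_right, inner_smul_right]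
      have h4 := step_nonneg a (K u)
      have h5 := step_lt_one ha hlt
      have h6 : 0 ≤ deriv (step a) (K u) := (monotone_step ha).deriv_nonneg
      refine ⟨?_, mul_neg_of_pos_of_neg (by linarith) h3,
        mul_nonpos_of_nonneg_of_nonpos h6 h3.le⟩
      nlinarith
    · have h1 : step a (K u) = 1 := step_eq_one ha hge
      refine Or.inr ⟨h1, by rw [hΘg, h1, sub_self, zero_smul], ?_, ?_⟩
      · have : IsLocalMax (fun u => step a (K u)) u := Eventually.of_forall fun v =>
          (step_le_one a (K v)).trans h1.ge
        refine ext_inner_right ℝ fun v => ?_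
        rw [inner_gradient, this.fderiv_eq_zero]
        simp
      -- On the level `K = 2a` the gradient of `K` is nonzero and a small step along it enters `V`;
      -- such points lie in the closure only.
      · rcases eq_or_lt_of_le hge with heq | hlt
        · have hNu : u ∈ N := hdN u hu.le (by
            by_contra hcon
            linarith [haK u (not_lt.1 hcon)])
          obtain ⟨α, hα, -, -, h3⟩ := hcollar u hu hNu
          have hv : HasDerivAt (fun s : ℝ => K (u + s • gradient K u))
              (fderiv ℝ K u (gradient K u)) 0 := by
            have h4 : HasDerivAt (fun s : ℝ => u + s • gradient K u) (gradient K u) 0 := by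
              simpa using ((hasDerivAt_id (0 : ℝ)).smul_const (gradient K u)).const_add u
            have h5 : HasFDerivAt K (fderiv ℝ K u) (u + (0 : ℝ) • gradient K u) := by
              simpa using (hK.differentiable (by simp) u).hasFDerivAt
            exact h5.comp_hasDerivAt (0 : ℝ) h4
          have hg : gradient K u ≠ 0 := fun h => by simp [h] at h3
          have hpos' : 0 < fderiv ℝ K u (gradient K u) := by
            rw [← inner_gradient]
            exact real_inner_self_pos.2 hg
          have hcont : Tendsto (fun s : ℝ => u + s • gradient K u) (𝓝[>] 0) (𝓝 u) := by
            have : Continuous fun s : ℝ => u + s • gradient K u := by fun_prop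
            simpa using (this.tendsto 0).mono_left nhdsWithin_le_nhds
          refine mem_closure_of_tendsto hcont ?_
          have h6 := (hasDerivWithinAt_iff_tendsto_slope' (s := Ioi (0 : ℝ)) (by simp)).1
            hv.hasDerivWithinAt
          filter_upwards [h6.eventually (lt_mem_nhds hpos'), self_mem_nhdsWithin,
            hcont.eventually (isOpen_lt hf.continuous continuous_const |>.mem_nhds hu)]
            with s hs1 hs2 hs3
          refine ⟨hs3, ?_⟩
          rw [slope_def_field, sub_zero] at hs1
          have := (div_pos_iff_of_pos_right hs2).1 hs1
          simp only [zero_smul, add_zero] at this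
          linarith
        · exact subset_closure ⟨hu, hlt⟩

end Collar

/-! ### The polytope, its vertices and its facets -/

section Polytope

lemma vec_mem_cone {τ : Finset (Fin n → ℤ)} {α : Fin n → ℤ} (h : α ∈ τ) : vec α ∈ cone τ := by
  classical
  refine ⟨fun v => if v = α then 1 else 0, fun v => by dsimp only; split_ifs <;> norm_num, ?_⟩
  rw [Finset.sum_eq_single_of_mem α h fun v _ hv => by simp [hv]]
  simp

/-- The affine function which vanishes on the facet of the polytope normal to `α`. -/
noncomputable def facet (ν : Base n → ℝ) (α : Fin n → ℤ) (u : Base n) : ℝ :=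
  inner ℝ (vec α) u - ν (vec α)

lemma continuous_facet (ν : Base n → ℝ) (α : Fin n → ℤ) : Continuous (facet ν α) :=
  (continuous_const.inner continuous_id).sub continuous_const

lemma contDiff_facet (ν : Base n → ℝ) (α : Fin n → ℤ) : ContDiff ℝ ∞ (facet ν α) :=
  (contDiff_const.inner ℝ contDiff_id).sub contDiff_const

lemma facet_add (ν : Base n → ℝ) (α : Fin n → ℤ) (u v : Base n) :
    facet ν α (u + v) = facet ν α u + inner ℝ (vec α) v := by
  rw [facet, facet, inner_add_right]; ring

lemma facet_smul (ν : Base n → ℝ) (α : Fin n → ℤ) (c : ℝ) (u : Base n) :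
    facet ν α (c • u) = c * facet ν α u + (c - 1) * ν (vec α) := by
  rw [facet, facet, inner_smul_right]; ring

variable {F : SmoothCompleteFan n} {ν : Base n → ℝ}

lemma mem_polytope {y : Base n} : y ∈ polytope F ν ↔ ∀ α ∈ F.rays, facet ν α y ≤ 0 := by
  simp only [facet, sub_nonpos]
  rfl

lemma isClosed_polytope : IsClosed (polytope F ν) := by
  have : polytope F ν = ⋂ α ∈ F.rays, {y | facet ν α y ≤ 0} := by
    ext y
    rw [mem_polytope]
    simp
  rw [this]
  exact isClosed_biInter fun α _ => isClosed_le (continuous_facet ν α) continuous_const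

/-- The vectors dual to the generators of a smooth maximal cone. -/
lemma exists_dual_vector {τ : Finset (Fin n → ℤ)} (hτ : τ ∈ F.maxCones) {α : Fin n → ℤ}
    (hα : α ∈ τ) : ∃ ξ : Base n, inner ℝ (vec α) ξ = 1 ∧
      ∀ β ∈ τ, β ≠ α → inner ℝ (vec β) ξ = 0 := by
  classical
  obtain ⟨b, hb⟩ := F.smooth τ hτ
  obtain ⟨i, rfl⟩ : α ∈ Set.range b := by rw [hb]; exact hα
  have key : ∀ v : Fin n → ℤ, inner ℝ (vec v)
      (vec fun j => b.coord i (Pi.single j 1)) = (b.coord i v : ℝ) := by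
    intro v
    rw [inner_vec_vec]
    congr 1
    conv_rhs => rw [pi_eq_sum_univ' v, map_sum]
    refine Finset.sum_congr rfl fun j _ => ?_
    rw [map_smul, smul_eq_mul]
  refine ⟨_, (key _).trans (by simp), fun β hβ hne => ?_⟩
  obtain ⟨k, rfl⟩ : β ∈ Set.range b := by rw [hb]; exact hβ
  rw [key, Module.Basis.coord_apply, Module.Basis.repr_self, Finsupp.single_apply, if_neg]
  · simp
  · rintro rfl; exact hne rfl

lemma exists_dual_bound (F : SmoothCompleteFan n) : ∃ C : ℝ, 0 ≤ C ∧ ∀ τ ∈ F.maxCones, ∀ α ∈ τ,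
    ∃ ξ : Base n, ‖ξ‖ ≤ C ∧ inner ℝ (vec α) ξ = 1 ∧
      ∀ β ∈ τ, β ≠ α → inner ℝ (vec β) ξ = 0 := by
  classical
  choose! ξ h1 h2 using fun (τ : Finset (Fin n → ℤ)) (hτ : τ ∈ F.maxCones) (α : Fin n → ℤ)
    (hα : α ∈ τ) => exists_dual_vector hτ hα
  refine ⟨∑ τ ∈ F.maxCones, ∑ α ∈ τ, ‖ξ τ α‖,
    Finset.sum_nonneg fun _ _ => Finset.sum_nonneg fun _ _ => norm_nonneg _,
    fun τ hτ α hα => ⟨ξ τ α, ?_, h1 τ hτ α hα, h2 τ hτ α hα⟩⟩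
  calc ‖ξ τ α‖ ≤ ∑ α ∈ τ, ‖ξ τ α‖ :=
        Finset.single_le_sum (f := fun α => ‖ξ τ α‖) (fun _ _ => norm_nonneg _) hα
    _ ≤ _ := Finset.single_le_sum (f := fun τ => ∑ α ∈ τ, ‖ξ τ α‖)
        (fun _ _ => Finset.sum_nonneg fun _ _ => norm_nonneg _) hτ

lemma exists_ray_bound (F : SmoothCompleteFan n) :
    ∃ A : ℝ, 1 ≤ A ∧ ∀ α ∈ F.rays, ‖vec α‖ ≤ A :=
  ⟨1 + ∑ α ∈ F.rays, ‖vec α‖,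
    le_add_of_nonneg_right (Finset.sum_nonneg fun _ _ => norm_nonneg _), fun _ hα =>
    (Finset.single_le_sum (f := fun α => ‖vec α‖) (fun _ _ => norm_nonneg _) hα).trans
      (le_add_of_nonneg_left zero_le_one)⟩

/-- A generator of a `1`-cone which lies in a maximal cone generates an edge of it. -/
lemma mem_of_vec_mem_cone {τ : Finset (Fin n → ℤ)} (hτ : τ ∈ F.maxCones) {α : Fin n → ℤ}
    (hα : α ∈ F.rays) (h : vec α ∈ cone τ) : α ∈ τ := by
  obtain ⟨τ', hτ', hα'⟩ := F.ray_mem α hα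
  have h1 : vec α ∈ cone (τ ∩ τ') := by
    rw [← F.inter τ hτ τ' hτ']
    exact ⟨h, vec_mem_cone hα'⟩
  obtain ⟨c, -, hc⟩ := h1
  obtain ⟨ξ, hξ1, hξ0⟩ := exists_dual_vector hτ' hα'
  by_contra hcon
  rw [hc, sum_inner, Finset.sum_eq_zero] at hξ1
  · exact zero_ne_one hξ1
  · intro v hv
    rw [inner_smul_left, hξ0 v (Finset.mem_inter.1 hv).2, mul_zero]
    rintro rfl
    exact hcon (Finset.mem_inter.1 hv).1

lemma ray_ne_zero {α : Fin n → ℤ} (hα : α ∈ F.rays) : vec α ≠ 0 := by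
  obtain ⟨τ, hτ, hατ⟩ := F.ray_mem α hα
  obtain ⟨ξ, hξ, -⟩ := exists_dual_vector hτ hατ
  intro h
  rw [h, inner_zero_left] at hξ
  exact zero_ne_one hξ

/-- Strict convexity: the linear form that gives `ν` on the cone is strictly below `ν` elsewhere, so
it lies on the facets of its own cone and on no others. -/
lemma exists_vertex (hν : IsAmple F ν) {τ : Finset (Fin n → ℤ)} (hτ : τ ∈ F.maxCones) :
    ∃ m : Fin n → ℤ,
    vec m ∈ polytope F ν ∧ (∀ x ∈ cone τ, ν x = inner ℝ (vec m) x) ∧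
      ∀ α ∈ F.rays, (facet ν α (vec m) = 0 ↔ α ∈ τ) := by
  obtain ⟨m, h1, h2⟩ := hν τ hτ
  have h3 : ∀ α ∈ F.rays, α ∉ τ → facet ν α (vec m) < 0 := fun α hα h => by
    rw [facet, real_inner_comm, sub_neg]
    exact h2 _ fun hc => h (mem_of_vec_mem_cone hτ hα hc)
  have h4 : ∀ α ∈ τ, facet ν α (vec m) = 0 := fun α hα => by
    rw [facet, h1 _ (vec_mem_cone hα), real_inner_comm, sub_self]
  refine ⟨m, mem_polytope.2 fun α hα => ?_, h1, fun α hα => ⟨fun h => ?_, h4 α⟩⟩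
  · by_cases h : α ∈ τ
    · exact (h4 α h).le
    · exact (h3 α hα h).le
  · by_contra hcon
    exact (h3 α hα hcon).ne h

lemma ample_zero (hν : IsAmple F ν) : ν 0 = 0 := by
  obtain ⟨τ, hτ, hx⟩ := F.complete 0
  obtain ⟨m, -, h, -⟩ := exists_vertex hν hτ
  rw [h 0 hx, inner_zero_right]

lemma exists_int_ample (hν : IsAmple F ν) {α : Fin n → ℤ} (hα : α ∈ F.rays) :
    ∃ k : ℤ, ν (vec α) = k := by
  obtain ⟨τ, hτ, hατ⟩ := F.ray_mem α hα
  obtain ⟨m, -, h, -⟩ := exists_vertex hν hτ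
  exact ⟨_, (h _ (vec_mem_cone hατ)).trans (inner_vec_vec _ _)⟩

/-- A small positive multiple of `α` lies in `Q`, so `ν(α)` is positive; being an integer, it is at
least `1`. This gap separates the facets from the origin in all later estimates. -/
lemma one_le_ample (hν : IsAmple F ν) (h0 : (0 : Base n) ∈ interior (polytope F ν)) {α : Fin n → ℤ}
    (hα : α ∈ F.rays) : 1 ≤ ν (vec α) := by
  have hc : Tendsto (fun s : ℝ => s • vec α) (𝓝[>] 0) (𝓝 0) := by
    have : Continuous fun s : ℝ => s • vec α := by fun_prop
    simpa using (this.tendsto 0).mono_left nhdsWithin_le_nhds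
  obtain ⟨s, hs1, hs2⟩ := ((hc.eventually (mem_interior_iff_mem_nhds.1 h0)).and
    self_mem_nhdsWithin).exists
  have hs2 : 0 < s := hs2
  have h1 := mem_polytope.1 hs1 α hα
  rw [facet, inner_smul_right, sub_nonpos] at h1
  have h2 : 0 < ν (vec α) := lt_of_lt_of_le
    (mul_pos hs2 (real_inner_self_pos.2 (ray_ne_zero hα))) h1
  obtain ⟨k, hk⟩ := exists_int_ample hν hα
  rw [hk] at h2 ⊢
  exact_mod_cast h2

/-- `ν` bounds linear forms on `Q`: on a maximal cone it is linear, and the inequality need only be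
checked on generators. -/
lemma inner_le_ample (hν : IsAmple F ν) {y : Base n} (hy : y ∈ polytope F ν) (x : Base n) :
    inner ℝ x y ≤ ν x := by
  obtain ⟨τ, hτ, hx⟩ := F.complete x
  obtain ⟨m, -, h, h'⟩ := exists_vertex hν hτ
  rw [h x hx]
  obtain ⟨c, hc, rfl⟩ := hx
  rw [sum_inner, inner_sum]
  refine Finset.sum_le_sum fun v hv => ?_
  rw [inner_smul_left, inner_smul_right]
  refine mul_le_mul_of_nonneg_left ?_ (hc v)
  have h1 := mem_polytope.1 hy v (F.subset_rays τ hτ hv)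
  have h2 := (h' v (F.subset_rays τ hτ hv)).2 hv
  rw [facet] at h1 h2
  rw [real_inner_comm (vec v)]
  linarith

lemma isCompact_polytope (hν : IsAmple F ν) : IsCompact (polytope F ν) := by
  classical
  refine Metric.isCompact_of_isClosed_isBounded isClosed_polytope ?_
  refine (Metric.isBounded_iff_subset_closedBall 0).2 ⟨∑ i : Fin n,
    (|ν (EuclideanSpace.single i 1)| + |ν (-EuclideanSpace.single i 1)|), fun y hy => ?_⟩
  rw [mem_closedBall_zero_iff]
  have hn : ‖y‖ ≤ ∑ i, |y i| := by
    have h1 : y = ∑ i, y i • EuclideanSpace.single i (1 : ℝ) := by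
      ext k
      simp [Finset.sum_apply, Pi.single_apply]
    calc ‖y‖ = ‖∑ i, y i • EuclideanSpace.single i (1 : ℝ)‖ := by rw [← h1]
      _ ≤ ∑ i, ‖y i • EuclideanSpace.single i (1 : ℝ)‖ := norm_sum_le _ _
      _ = ∑ i, |y i| := by simp [norm_smul]
  refine hn.trans (Finset.sum_le_sum fun i _ => abs_le.2 ⟨?_, ?_⟩)
  · have := inner_le_ample hν hy (-EuclideanSpace.single i 1)
    rw [inner_neg_left, EuclideanSpace.inner_single_left] at this
    simp only [map_one, one_mul] at this
    linarith [abs_nonneg (ν (EuclideanSpace.single i 1)),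
      le_abs_self (ν (-EuclideanSpace.single i 1))]
  · have := inner_le_ample hν hy (EuclideanSpace.single i 1)
    rw [EuclideanSpace.inner_single_left] at this
    simp only [map_one, one_mul] at this
    linarith [abs_nonneg (ν (-EuclideanSpace.single i 1)),
      le_abs_self (ν (EuclideanSpace.single i 1))]

lemma exists_polytope_bound (hν : IsAmple F ν) : ∃ D : ℝ, 1 ≤ D ∧ ∀ y ∈ polytope F ν, ‖y‖ ≤ D := by
  obtain ⟨D, hD⟩ := (isCompact_polytope hν).isBounded.exists_norm_le
  exact ⟨max 1 D, le_max_left _ _, fun y hy => (hD y hy).trans (le_max_right _ _)⟩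

/-- The facets through a point of the polytope are normal to the generators of a maximal cone. -/
lemma exists_maxCone_of_facets (hν : IsAmple F ν) {y : Base n} (hy : y ∈ polytope F ν) :
    ∃ τ ∈ F.maxCones, ∀ α ∈ F.rays, facet ν α y = 0 → α ∈ τ := by
  classical
  set A := {α ∈ F.rays | facet ν α y = 0} with hA
  -- No active normal is larger at the vertex of this cone than at `y`, yet their sum is at least as
  -- large there. So all of them agree, and the vertex lies on the same facets.
  obtain ⟨τ, hτ, hx⟩ := F.complete (∑ α ∈ A, vec α)
  obtain ⟨m, hm, h, h'⟩ := exists_vertex hν hτ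
  have h1 := inner_le_ample hν hy (∑ α ∈ A, vec α)
  rw [h _ hx, sum_inner, inner_sum] at h1
  have h2 : ∀ α ∈ A, inner ℝ (vec m) (vec α) ≤ (inner ℝ (vec α) y : ℝ) := fun α hα => by
    obtain ⟨hα1, hα2⟩ := Finset.mem_filter.1 hα
    have := mem_polytope.1 hm α hα1
    rw [facet] at this hα2
    rw [real_inner_comm]
    linarith
  refine ⟨τ, hτ, fun α hα h0 => (h' α hα).1 ?_⟩
  have hαA : α ∈ A := Finset.mem_filter.2 ⟨hα, h0⟩
  have h3 := (Finset.sum_eq_sum_iff_of_le h2).1 (le_antisymm (Finset.sum_le_sum h2) h1) α hαA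
  rw [facet] at h0 ⊢
  rw [real_inner_comm, h3, h0]

/-- Uniform version of `exists_maxCone_of_facets`. -/
lemma exists_uniform_maxCone (hν : IsAmple F ν) : ∃ r > 0, ∀ y ∈ polytope F ν,
    ∃ τ ∈ F.maxCones, ∀ α ∈ F.rays, -r ≤ facet ν α y → α ∈ τ := by
  refine (isCompact_polytope hν).induction_on (p := fun S => ∃ r > 0, ∀ y ∈ S,
    ∃ τ ∈ F.maxCones, ∀ α ∈ F.rays, -r ≤ facet ν α y → α ∈ τ) ?_ ?_ ?_ ?_
  · exact ⟨1, one_pos, fun y hy => hy.elim⟩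
  · rintro s t hst ⟨r, hr, h⟩
    exact ⟨r, hr, fun y hy => h y (hst hy)⟩
  · rintro s t ⟨r, hr, h⟩ ⟨r', hr', h'⟩
    refine ⟨min r r', lt_min hr hr', ?_⟩
    rintro y (hy | hy)
    · obtain ⟨τ, hτ, hy⟩ := h y hy
      exact ⟨τ, hτ, fun α hα hle => hy α hα (by linarith [min_le_left r r'])⟩
    · obtain ⟨τ, hτ, hy⟩ := h' y hy
      exact ⟨τ, hτ, fun α hα hle => hy α hα (by linarith [min_le_right r r'])⟩
  · intro y hy
    obtain ⟨τ, hτ, h⟩ := exists_maxCone_of_facets hν hy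
    have h1 : ∀ α ∈ F.rays, ∃ r > 0, α ∉ τ → facet ν α y < -r := fun α hα => by
      by_cases hατ : α ∈ τ
      · exact ⟨1, one_pos, fun h => (h hατ).elim⟩
      · have : facet ν α y < 0 := lt_of_le_of_ne (mem_polytope.1 hy α hα)
          fun h0 => hατ (h α hα h0)
        exact ⟨-facet ν α y / 2, by linarith, fun _ => by linarith⟩
    choose! ρ hρ hρ' using h1
    obtain ⟨r, hr, hrρ⟩ : ∃ r > 0, ∀ α ∈ F.rays, r ≤ ρ α := by
      rcases F.rays.eq_empty_or_nonempty with he | hne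
      · exact ⟨1, one_pos, fun α hα => by simp [he] at hα⟩
      · exact ⟨F.rays.inf' hne ρ, (Finset.lt_inf'_iff hne).2 hρ, fun α hα =>
          Finset.inf'_le _ hα⟩
    refine ⟨_, mem_nhdsWithin_of_mem_nhds ((Filter.eventually_all_finset F.rays
      (p := fun α z => α ∉ τ → facet ν α z < -r)).2 fun α hα => ?_), r, hr,
      fun z hz => ⟨τ, hτ, fun α hα hle => by_contra fun hcon => ?_⟩⟩
    · by_cases hατ : α ∈ τ
      · exact Eventually.of_forall fun z h => (h hατ).elim
      · filter_upwards [(continuous_facet ν α).continuousAt.eventually_lt continuousAt_const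
          ((hρ' α hα hατ).trans_le (neg_le_neg (hrρ α hα)))] with z hz _ using hz
    · exact absurd hle (not_le.2 (hz α hα hcon))

end Polytope

/-! ### Mollification of Lipschitz functions -/

section Mollification

open MeasureTheory in
/-- Mollification of a Lipschitz function, keeping the directions in which it is affine. -/
lemma exists_mollification {g : Base n → ℝ} {L : ℝ} (h0 : 0 ≤ L)
    (hL : ∀ z z', |g z - g z'| ≤ L * ‖z - z'‖)
    {ρ : ℝ} (hρ : 0 < ρ) : ∃ G : Base n → ℝ, ContDiff ℝ ∞ G ∧ (∀ z, |G z - g z| ≤ L * ρ) ∧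
      ∀ (z v : Base n) (c s₀ : ℝ), 0 < s₀ → (∀ s, |s| < s₀ → ∀ x : Base n, ‖x‖ < ρ →
        g (z - x + s • v) = g (z - x) + s * c) → inner ℝ v (gradient G z) = c := by
  have hgc : Continuous g := by
    exact (LipschitzWith.of_dist_le_mul (K := ⟨L, h0⟩) fun z z' => by
      rw [Real.dist_eq, dist_eq_norm]; exact hL z z').continuous
  let φ : ContDiffBump (0 : Base n) := ⟨ρ / 2, ρ, by positivity, by linarith⟩
  set G : Base n → ℝ := MeasureTheory.convolution (φ.normed volume) g
    (ContinuousLinearMap.lsmul ℝ ℝ) volume with hG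
  have hGs : ContDiff ℝ ∞ G := φ.hasCompactSupport_normed.contDiff_convolution_left _
    φ.contDiff_normed hgc.locallyIntegrable
  have hGz : ∀ z, G z = ∫ x, φ.normed volume x * g (z - x) := fun z => rfl
  refine ⟨G, hGs, fun z => ?_, fun z v c s₀ hs₀ h => ?_⟩
  · rw [← Real.dist_eq]
    refine φ.dist_normed_convolution_le hgc.aestronglyMeasurable fun x hx => ?_
    rw [Real.dist_eq]
    have hx : dist x z < ρ := hx
    rw [dist_eq_norm] at hx
    exact (hL x z).trans (mul_le_mul_of_nonneg_left hx.le h0)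
  · have hint : ∀ z, Integrable (fun x => φ.normed volume x * g (z - x)) volume := fun z =>
      (φ.continuous_normed.mul (hgc.comp (continuous_const.sub continuous_id))
        ).integrable_of_hasCompactSupport φ.hasCompactSupport_normed.mul_right
    have hline : ∀ s, |s| < s₀ → G (z + s • v) = G z + s * c := by
      intro s hs
      have h1 : ∀ x, φ.normed volume x * g (z + s • v - x) =
          φ.normed volume x * g (z - x) + φ.normed volume x * (s * c) := by
        intro x
        by_cases hx : ‖x‖ < ρ
        · rw [show z + s • v - x = z - x + s • v by abel, h s hs x hx, mul_add]
        · have : φ.normed volume x = 0 := by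
            rw [← Function.notMem_support, φ.support_normed_eq, mem_ball_zero_iff]
            exact hx
          simp [this]
      rw [hGz, hGz, integral_congr_ae (Eventually.of_forall h1), integral_add (hint z)
        (φ.integrable_normed.mul_const _), integral_mul_const, φ.integral_normed, one_mul]
    have hd1 : HasDerivAt (fun s : ℝ => G (z + s • v)) (fderiv ℝ G z v) 0 := by
      have h4 : HasDerivAt (fun s : ℝ => z + s • v) v 0 := by
        simpa using ((hasDerivAt_id (0 : ℝ)).smul_const v).const_add z
      have h5 : HasFDerivAt G (fderiv ℝ G z) (z + (0 : ℝ) • v) := by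
        simpa using (hGs.differentiable (by simp) z).hasFDerivAt
      exact h5.comp_hasDerivAt (0 : ℝ) h4
    have hd2 : HasDerivAt (fun s : ℝ => G (z + s • v)) c 0 := by
      have h6 : HasDerivAt (fun s : ℝ => G z + s * c) c 0 := by
        simpa using ((hasDerivAt_id (0 : ℝ)).mul_const c).const_add (G z)
      refine h6.congr_of_eventuallyEq ?_
      filter_upwards [Metric.ball_mem_nhds (0 : ℝ) hs₀] with s hs
      exact hline s (by simpa using hs)
    rw [real_inner_comm, inner_gradient]
    exact hd1.unique hd2

end Mollification

/-! ### Approximation of `|z|²/2` by functions affine across facets -/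

section FacetSup

/-- The heights by which the faces of the polytope are lifted, according to their codimension. -/
noncomputable def boost (A C a D : ℝ) : ℕ → ℝ
  | 0 => 0
  | k + 1 => boost A C a D k + (√(2 * boost A C a D k + D ^ 2) +
      C * (a + A * √(2 * boost A C a D k + D ^ 2))) ^ 2 / 2

variable {A C a D : ℝ}

lemma monotone_boost (A C a D : ℝ) : Monotone (boost A C a D) :=
  monotone_nat_of_le_succ fun k => by rw [boost]; exact le_add_of_nonneg_right (by positivity)

lemma boost_nonneg (k : ℕ) : 0 ≤ boost A C a D k := monotone_boost A C a D (Nat.zero_le k)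

variable {F : SmoothCompleteFan n} {ν : Base n → ℝ}

open Classical in
/-- The facets through a point. -/
noncomputable def activeRays (F : SmoothCompleteFan n) (ν : Base n → ℝ) (y : Base n) :
    Finset (Fin n → ℤ) := {α ∈ F.rays | facet ν α y = 0}

lemma mem_activeRays {y : Base n} {α : Fin n → ℤ} :
    α ∈ activeRays F ν y ↔ α ∈ F.rays ∧ facet ν α y = 0 := by
  classical
  exact Finset.mem_filter

/-- The function of `y` whose maximum over the polytope is an approximation of `|z|²/2`. -/
noncomputable def faceVal (F : SmoothCompleteFan n) (ν : Base n → ℝ) (b : ℕ → ℝ) (e : ℝ)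
    (z y : Base n) : ℝ :=
  inner ℝ z y - ‖y‖ ^ 2 / 2 + e ^ 2 * b (activeRays F ν y).card

lemma faceVal_eq (b : ℕ → ℝ) (e : ℝ) (z y : Base n) : faceVal F ν b e z y =
    ‖z‖ ^ 2 / 2 - ‖z - y‖ ^ 2 / 2 + e ^ 2 * b (activeRays F ν y).card := by
  rw [faceVal, norm_sub_sq_real]; ring

lemma faceVal_add (b : ℕ → ℝ) (e : ℝ) (z v y : Base n) :
    faceVal F ν b e (z + v) y = faceVal F ν b e z y + inner ℝ v y := by
  rw [faceVal, faceVal, inner_add_left]; ring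

/-- Points of the polytope near `z` can be improved by points of every facet near `z`. -/
lemma exists_faceVal_le_of_near (hA : 0 ≤ A) (hAR : ∀ α ∈ F.rays, ‖vec α‖ ≤ A) (hC : 0 ≤ C)
    (hdual : ∀ τ ∈ F.maxCones, ∀ α ∈ τ, ∃ ξ : Base n, ‖ξ‖ ≤ C ∧ inner ℝ (vec α) ξ = 1 ∧
      ∀ β ∈ τ, β ≠ α → inner ℝ (vec β) ξ = 0) {r : ℝ}
    (hr : ∀ y ∈ polytope F ν, ∃ τ ∈ F.maxCones, ∀ α ∈ F.rays, -r ≤ facet ν α y → α ∈ τ)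
    (ha : 0 ≤ a) {e : ℝ} (he : 0 < e)
    (her : e * (a + A * √(2 * boost A C a D F.rays.card + D ^ 2)) * (1 + C * A) < r)
    {z y : Base n} {α : Fin n → ℤ} (hα : α ∈ F.rays) (hz : -(a * e) ≤ facet ν α z)
    (hy : y ∈ polytope F ν)
    (hzy : ‖z - y‖ ≤ √(2 * boost A C a D (activeRays F ν y).card + D ^ 2) * e) :
    ∃ y' ∈ polytope F ν, facet ν α y' = 0 ∧
      faceVal F ν (boost A C a D) e z y ≤ faceVal F ν (boost A C a D) e z y' := by
  classical
  by_cases hact : facet ν α y = 0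
  · exact ⟨y, hy, hact, le_rfl⟩
  set k := (activeRays F ν y).card with hk
  -- In units of `e`, this is the distance beyond which a point on `k` facets loses more by `|z -
  -- y|²/2` than its bonus can repay.
  set X := √(2 * boost A C a D k + D ^ 2) with hX
  have hX0 : 0 ≤ X := Real.sqrt_nonneg _
  have hXM : X ≤ √(2 * boost A C a D F.rays.card + D ^ 2) := by
    refine Real.sqrt_le_sqrt ?_
    have : boost A C a D k ≤ boost A C a D F.rays.card :=
      monotone_boost A C a D (Finset.card_le_card fun β hβ => (mem_activeRays.1 hβ).1)
    linarith
  set δ := -facet ν α y with hδ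
  have hδ0 : 0 < δ := by
    have := lt_of_le_of_ne (mem_polytope.1 hy α hα) hact
    linarith
  have hδle : δ ≤ (a + A * X) * e := by
    have h1 : facet ν α z = facet ν α y + inner ℝ (vec α) (z - y) := by
      rw [← facet_add, add_sub_cancel]
    have h2 : (inner ℝ (vec α) (z - y) : ℝ) ≤ A * (X * e) :=
      (real_inner_le_norm _ _).trans (mul_le_mul (hAR α hα) hzy (norm_nonneg _) hA)
    linarith
  have hδM : δ ≤ e * (a + A * √(2 * boost A C a D F.rays.card + D ^ 2)) := by
    refine hδle.trans ?_
    rw [mul_comm]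
    gcongr
  have hδr : δ * (1 + C * A) < r := lt_of_le_of_lt
    (mul_le_mul_of_nonneg_right hδM (by positivity)) her
  have hCA : 0 ≤ C * A := by positivity
  obtain ⟨τ, hτ, hτr⟩ := hr y hy
  have hr0 : δ < r := lt_of_le_of_lt (le_mul_of_one_le_right hδ0.le (by linarith)) hδr
  have hατ : α ∈ τ := hτr α hα (by linarith)
  obtain ⟨ξ, hξC, hξ1, hξ0⟩ := hdual τ hτ α hατ
  have hface : ∀ β, facet ν β (y + δ • ξ) = facet ν β y + δ * inner ℝ (vec β) ξ := fun β => by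
    rw [facet_add, inner_smul_right]
  have hα0 : facet ν α (y + δ • ξ) = 0 := by rw [hface, hξ1, hδ]; ring
  -- The dual vector `ξ` leads to the facet `α` without moving the other facet functions of the
  -- cone; facets outside the cone are too far away to be crossed.
  refine ⟨y + δ • ξ, mem_polytope.2 fun β hβ => ?_, hα0, ?_⟩
  · by_cases hβα : β = α
    · rw [hβα, hα0]
    by_cases hβτ : β ∈ τ
    · rw [hface, hξ0 β hβτ hβα, mul_zero, add_zero]
      exact mem_polytope.1 hy β hβ
    · have h1 : facet ν β y < -r := not_le.1 fun h => hβτ (hτr β hβ h)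
      have h2 : (inner ℝ (vec β) ξ : ℝ) ≤ A * C :=
        (real_inner_le_norm _ _).trans (mul_le_mul (hAR β hβ) hξC (norm_nonneg _) hA)
      rw [hface]
      nlinarith
  · have hcard : k + 1 ≤ (activeRays F ν (y + δ • ξ)).card := by
      have h1 : α ∉ activeRays F ν y := fun h => hact (mem_activeRays.1 h).2
      rw [hk, ← Finset.card_insert_of_notMem h1]
      refine Finset.card_le_card fun β hβ => mem_activeRays.2 ?_
      rcases Finset.mem_insert.1 hβ with rfl | hβ
      · exact ⟨hα, hα0⟩
      · obtain ⟨h2, h3⟩ := mem_activeRays.1 hβ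
        have hβα : β ≠ α := fun h => hact (h ▸ h3)
        exact ⟨h2, by rw [hface, h3, hξ0 β (hτr β h2 (by rw [h3]; linarith)) hβα]; ring⟩
    -- The new point lies on one more facet, and the increment of `boost` is half the square of the
    -- bound `X + C(a + AX)` for its distance to `z`, in units of `e`.
    have hb := monotone_boost A C a D hcard
    rw [boost, ← hX] at hb
    rw [faceVal_eq, faceVal_eq, ← hk]
    have h4 : ‖z - (y + δ • ξ)‖ ≤ (X + C * (a + A * X)) * e := by
      rw [show z - (y + δ • ξ) = z - y - δ • ξ by abel]
      refine (norm_sub_le _ _).trans ?_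
      rw [norm_smul, Real.norm_of_nonneg hδ0.le]
      have := mul_le_mul hδle hξC (norm_nonneg _) (by positivity)
      linarith
    have h5 : ‖z - (y + δ • ξ)‖ ^ 2 ≤ ((X + C * (a + A * X)) * e) ^ 2 :=
      pow_le_pow_left₀ (norm_nonneg _) h4 2
    have h6 := mul_le_mul_of_nonneg_left hb (sq_nonneg e)
    nlinarith [sq_nonneg ‖z - y‖]

/-- A point far from `z` is already beaten by the nearby point `y₀`, which reduces everything to
points near `z`. -/
lemma exists_faceVal_le (hA : 0 ≤ A) (hAR : ∀ α ∈ F.rays, ‖vec α‖ ≤ A) (hC : 0 ≤ C)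
    (hdual : ∀ τ ∈ F.maxCones, ∀ α ∈ τ, ∃ ξ : Base n, ‖ξ‖ ≤ C ∧ inner ℝ (vec α) ξ = 1 ∧
      ∀ β ∈ τ, β ≠ α → inner ℝ (vec β) ξ = 0) {r : ℝ}
    (hr : ∀ y ∈ polytope F ν, ∃ τ ∈ F.maxCones, ∀ α ∈ F.rays, -r ≤ facet ν α y → α ∈ τ)
    (ha : 0 ≤ a) {e : ℝ} (he : 0 < e)
    (her : e * (a + A * √(2 * boost A C a D F.rays.card + D ^ 2)) * (1 + C * A) < r)
    {z y₀ y : Base n} {α : Fin n → ℤ} (hα : α ∈ F.rays) (hz : -(a * e) ≤ facet ν α z)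
    (hy₀ : y₀ ∈ polytope F ν) (hzy₀ : ‖z - y₀‖ ≤ D * e) (hy : y ∈ polytope F ν) :
    ∃ y' ∈ polytope F ν, facet ν α y' = 0 ∧
      faceVal F ν (boost A C a D) e z y ≤ faceVal F ν (boost A C a D) e z y' := by
  have hnear := fun (y : Base n) (hy : y ∈ polytope F ν) => exists_faceVal_le_of_near
    (D := D) hA hAR hC hdual hr ha he her hα hz hy
  rcases le_or_gt ‖z - y‖ (√(2 * boost A C a D (activeRays F ν y).card + D ^ 2) * e) with h | h
  · exact hnear y hy h
  · have hb0 := boost_nonneg (A := A) (C := C) (a := a) (D := D) (activeRays F ν y₀).card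
    have hb := boost_nonneg (A := A) (C := C) (a := a) (D := D) (activeRays F ν y).card
    obtain ⟨y', h1, h2, h3⟩ := hnear y₀ hy₀ (hzy₀.trans (mul_le_mul_of_nonneg_right
      (Real.le_sqrt_of_sq_le (by linarith)) he.le))
    refine ⟨y', h1, h2, le_trans ?_ h3⟩
    rw [faceVal_eq, faceVal_eq]
    have h4 := pow_le_pow_left₀ (by positivity) h.le 2
    rw [mul_pow, Real.sq_sqrt (by positivity)] at h4
    have h5 := pow_le_pow_left₀ (norm_nonneg _) hzy₀ 2
    have h6 := mul_nonneg (sq_nonneg e) hb0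
    nlinarith

/-- The lifted version of `|z|²/2 - d(z, Q)²/2`. -/
noncomputable def faceSup (F : SmoothCompleteFan n) (ν : Base n → ℝ) (b : ℕ → ℝ) (e : ℝ)
    (z : Base n) : ℝ := sSup (faceVal F ν b e z '' polytope F ν)

lemma faceVal_le {b : ℕ → ℝ} (hb : Monotone b) (e : ℝ) (z y : Base n) :
    faceVal F ν b e z y ≤ ‖z‖ ^ 2 / 2 + e ^ 2 * b F.rays.card := by
  rw [faceVal_eq]
  have h1 : b (activeRays F ν y).card ≤ b F.rays.card :=
    hb (Finset.card_le_card fun β hβ => (mem_activeRays.1 hβ).1)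
  nlinarith [sq_nonneg ‖z - y‖, mul_le_mul_of_nonneg_left h1 (sq_nonneg e)]

lemma le_faceSup {b : ℕ → ℝ} (hb : Monotone b) (e : ℝ) (z : Base n) {y : Base n}
    (hy : y ∈ polytope F ν) : faceVal F ν b e z y ≤ faceSup F ν b e z :=
  le_csSup ⟨_, by rintro _ ⟨y, -, rfl⟩; exact faceVal_le hb e z y⟩ (mem_image_of_mem _ hy)

lemma faceSup_le (hne : (polytope F ν).Nonempty) {b : ℕ → ℝ} {e c : ℝ} {z : Base n}
    (h : ∀ y ∈ polytope F ν, faceVal F ν b e z y ≤ c) : faceSup F ν b e z ≤ c :=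
  csSup_le (hne.image _) (by rintro _ ⟨y, hy, rfl⟩; exact h y hy)

lemma abs_faceSup_sub_le (hne : (polytope F ν).Nonempty) {b : ℕ → ℝ} (hb : Monotone b) (e : ℝ)
    {L : ℝ} (hL : ∀ y ∈ polytope F ν, ‖y‖ ≤ L) (z z' : Base n) :
    |faceSup F ν b e z - faceSup F ν b e z'| ≤ L * ‖z - z'‖ := by
  have key : ∀ z z', faceSup F ν b e z ≤ faceSup F ν b e z' + L * ‖z - z'‖ := by
    intro z z'
    refine faceSup_le hne fun y hy => ?_
    have h1 := le_faceSup hb e z' hy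
    have h2 := faceVal_add (F := F) (ν := ν) b e z' (z - z') y
    rw [add_sub_cancel] at h2
    have h3 : (inner ℝ (z - z') y : ℝ) ≤ ‖z - z'‖ * L :=
      (real_inner_le_norm _ _).trans (mul_le_mul_of_nonneg_left (hL y hy) (norm_nonneg _))
    linarith
  have h1 := key z z'
  have h2 := key z' z
  rw [norm_sub_rev] at h2
  exact abs_sub_le_iff.2 ⟨by linarith, by linarith⟩

/-- A smooth approximation of `|z|²/2` near the polytope, which near each facet is affine in the
direction of its normal. -/
theorem exists_facetAffine (hν : IsAmple F ν) (h0 : (0 : Base n) ∈ interior (polytope F ν))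
    {a D : ℝ} (ha : 0 ≤ a) (hD : 0 ≤ D) : ∃ c > 0, ∃ e₀ > 0, ∀ e, 0 < e → e < e₀ →
      ∃ G : Base n → ℝ, ContDiff ℝ ∞ G ∧ ∀ z : Base n, (∃ y ∈ polytope F ν, ‖z - y‖ ≤ D * e) →
        |G z - ‖z‖ ^ 2 / 2| ≤ c * e ^ 2 ∧
        ∀ α ∈ F.rays, -(a * e) ≤ facet ν α z → inner ℝ (vec α) (gradient G z) = ν (vec α) := by
  obtain ⟨A, hA1, hAR⟩ := exists_ray_bound F
  obtain ⟨C, hC, hdual⟩ := exists_dual_bound F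
  obtain ⟨r, hr0, hr⟩ := exists_uniform_maxCone hν
  obtain ⟨L, hL1, hL⟩ := exists_polytope_bound hν
  have hne : (polytope F ν).Nonempty := ⟨0, interior_subset h0⟩
  have hA : 0 ≤ A := by linarith
  -- The enlarged constants leave room for displacements by the mollification radius and along `α`.
  set a' := a + A + 1 with ha'
  set D' := D + 2 with hD'
  set b := boost A C a' D' with hb
  have hbm : Monotone b := monotone_boost _ _ _ _
  have hb0 : 0 ≤ b F.rays.card := boost_nonneg _
  set M := (a' + A * √(2 * b F.rays.card + D' ^ 2)) * (1 + C * A) with hM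
  have hM0 : 0 < M := by positivity
  refine ⟨L + D' ^ 2 / 2 + b F.rays.card, by positivity, min 1 (r / M), by positivity,
    fun e he0 he => ?_⟩
  have he1 : e < 1 := he.trans_le (min_le_left _ _)
  have her : e * (a' + A * √(2 * b F.rays.card + D' ^ 2)) * (1 + C * A) < r := by
    have := (lt_div_iff₀ hM0).1 (he.trans_le (min_le_right _ _))
    rwa [mul_assoc]
  have hee : e ^ 2 ≤ e := by nlinarith
  obtain ⟨G, hG, hGg, hGd⟩ := exists_mollification (by linarith)
    (abs_faceSup_sub_le hne hbm e hL)
    (ρ := e ^ 2) (by positivity)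
  -- Near the facet the supremum may be taken over points with `⟨α, y⟩ = ν(α)`, whose values change
  -- by exactly `sν(α)`. Shifting forth and back turns the inequality into an equality.
  have hshift : ∀ (z : Base n) (α) (s : ℝ), α ∈ F.rays → -(a' * e) ≤ facet ν α z →
      (∃ y ∈ polytope F ν, ‖z - y‖ ≤ D' * e) →
      faceSup F ν b e z + s * ν (vec α) ≤ faceSup F ν b e (z + s • vec α) := by
    rintro z α s hα hz ⟨y₀, hy₀, hzy₀⟩
    rw [← le_sub_iff_add_le]
    refine faceSup_le hne fun y hy => ?_
    obtain ⟨y', h1, h2, h3⟩ := exists_faceVal_le hA hAR hC hdual hr (by positivity)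
      he0 her hα hz hy₀ hzy₀ hy
    have h4 := le_faceSup hbm e (z + s • vec α) h1
    rw [faceVal_add, inner_smul_left] at h4
    rw [facet, sub_eq_zero] at h2
    rw [h2] at h4
    simp only [conj_trivial] at h4
    exact h3.trans (by linarith)
  refine ⟨G, hG, fun z => ?_⟩
  rintro ⟨y₀, hy₀, hzy₀⟩
  refine ⟨?_, fun α hα hz => ?_⟩
  · have h1 := abs_le.1 (hGg z)
    have h2 : faceSup F ν b e z ≤ ‖z‖ ^ 2 / 2 + e ^ 2 * b F.rays.card :=
      faceSup_le hne fun y hy => faceVal_le hbm e z y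
    have h3 := le_faceSup (F := F) (ν := ν) hbm e z hy₀
    rw [faceVal_eq] at h3
    have h4 : 0 ≤ b (activeRays F ν y₀).card := boost_nonneg _
    have h5 : ‖z - y₀‖ ^ 2 ≤ (D' * e) ^ 2 :=
      pow_le_pow_left₀ (norm_nonneg _) (hzy₀.trans (by rw [hD']; nlinarith)) 2
    have h6 := mul_nonneg (sq_nonneg e) h4
    have h7 := mul_nonneg (sq_nonneg e) hb0
    rw [abs_le]
    constructor <;> nlinarith [sq_nonneg (D' * e)]
  · refine hGd z (vec α) (ν (vec α)) (e / A ^ 2) (by positivity) fun s hs x hx => ?_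
    have hα1 : ‖vec α‖ ≤ A := hAR α hα
    have hs1 : |s| * A ^ 2 < e := (lt_div_iff₀ (by positivity)).1 hs
    have hs2 : ‖s • vec α‖ ≤ |s| * A := by
      rw [norm_smul, Real.norm_eq_abs]
      exact mul_le_mul_of_nonneg_left hα1 (abs_nonneg s)
    have hs3 : |s| * A ≤ |s| * A ^ 2 := by nlinarith [abs_nonneg s, mul_nonneg (abs_nonneg s) hA]
    have hx1 : |(inner ℝ (vec α) x : ℝ)| ≤ A * e := (abs_real_inner_le_norm _ _).trans
      (mul_le_mul hα1 (hx.le.trans hee) (norm_nonneg _) hA)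
    have hs4 : |(inner ℝ (vec α) (s • vec α) : ℝ)| ≤ e := by
      refine (abs_real_inner_le_norm _ _).trans ?_
      have := mul_le_mul hα1 hs2 (norm_nonneg _) hA
      nlinarith
    have hf1 : facet ν α (z - x) = facet ν α z - inner ℝ (vec α) x := by
      rw [sub_eq_add_neg, facet_add, inner_neg_right]; ring
    have hf2 : facet ν α (z - x + s • vec α) = facet ν α z - inner ℝ (vec α) x +
        inner ℝ (vec α) (s • vec α) := by rw [facet_add, hf1]
    have hd1 : ‖z - x - y₀‖ ≤ (D + 1) * e := by
      rw [show z - x - y₀ = z - y₀ - x by abel]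
      refine (norm_sub_le _ _).trans ?_
      linarith
    have hd2 : ‖z - x + s • vec α - y₀‖ ≤ D' * e := by
      rw [show z - x + s • vec α - y₀ = z - x - y₀ + s • vec α by abel]
      refine (norm_add_le _ _).trans ?_
      rw [hD']
      linarith
    have hx2 := abs_le.1 hx1
    have hs5 := abs_le.1 hs4
    have e1 := hshift (z - x) α s hα (by rw [hf1, ha']; linarith) ⟨y₀, hy₀, hd1.trans
      (by rw [hD']; linarith)⟩
    have e2 := hshift (z - x + s • vec α) α (-s) hα (by rw [hf2, ha']; linarith) ⟨y₀, hy₀, hd2⟩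
    rw [add_assoc, ← add_smul, add_neg_cancel, zero_smul, add_zero] at e2
    linarith

end FacetSup

/-! ### The tropically localized superpotential -/

section Superpotential

variable {F : SmoothCompleteFan n} {ν : Base n → ℝ} {ε B t : ℝ}
  {χ : (Fin n → ℤ) → Base n → ℝ}

/-- The weights of the monomials of the tropically localized superpotential. -/
noncomputable def weight (ν : Base n → ℝ) (t : ℝ) (χ : (Fin n → ℤ) → Base n → ℝ)
    (α : Fin n → ℤ) (u : Base n) : ℝ := (1 - χ α u) * t ^ facet ν α u

lemma superpotential_eq_pot :
    superpotential F ν t χ = pot F.rays (weight ν t χ) := rfl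

lemma zero_le_facet_of_mem_dominance (hν : IsAmple F ν) {α : Fin n → ℤ} {u : Base n}
    (h : u ∈ dominance F ν α) : 0 ≤ facet ν α u := by
  have h1 := h 0 (Finset.mem_insert_self _ _)
  have h2 : vec (0 : Fin n → ℤ) = (0 : Base n) := by ext i; simp [vec]
  rw [h2, ample_zero hν, inner_zero_left, sub_zero] at h1
  exact h1

lemma dominance_nonempty (hν : IsAmple F ν) {α : Fin n → ℤ} (hα : α ∈ F.rays) :
    (dominance F ν α).Nonempty := by
  obtain ⟨τ, hτ, hατ⟩ := F.ray_mem α hα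
  obtain ⟨m, hm, -, h⟩ := exists_vertex hν hτ
  have h0 := (h α hα).2 hατ
  refine ⟨vec m, fun β hβ => ?_⟩
  change _ ≤ facet ν α (vec m)
  rw [h0]
  rcases Finset.mem_insert.1 hβ with rfl | hβ
  · have h2 : vec (0 : Fin n → ℤ) = (0 : Base n) := by ext i; simp [vec]
    rw [h2, ample_zero hν, inner_zero_left, sub_zero]
  · exact mem_polytope.1 hm β hβ

namespace IsCutoffFamily

lemma exists_near (hχ : IsCutoffFamily F ν ε B χ) (hν : IsAmple F ν) {α : Fin n → ℤ}
    (hα : α ∈ F.rays) {u : Base n} (h : χ α u ≠ 1) : ∃ c ∈ dominance F ν α, dist u c < ε := by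
  refine (Metric.infDist_lt_iff (dominance_nonempty hν hα)).1 (not_le.1 fun hle => h ?_)
  exact (hχ.eq_one α hα u).2 hle

/-- If the cutoff exceeded `1`, then on the segment to a point of `C_α` at distance less than `ε` it
would take the value `1`, which is reserved for distances at least `ε`. -/
lemma le_one (hχ : IsCutoffFamily F ν ε B χ) (hν : IsAmple F ν) (hε : 0 < ε) {α : Fin n → ℤ}
    (hα : α ∈ F.rays) (u : Base n) : χ α u ≤ 1 := by
  by_contra hcon
  obtain ⟨c, hc, hd⟩ := hχ.exists_near hν hα (ne_of_gt (not_le.1 hcon))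
  have hc0 : χ α c = 0 := (hχ.eq_zero α hα c).2 (by
    rw [Metric.infDist_zero_of_mem hc]; positivity)
  have hcont : ContinuousOn (fun s : ℝ => χ α (c + s • (u - c))) (Icc 0 1) :=
    ((hχ.smooth α hα).continuous.comp (by fun_prop)).continuousOn
  obtain ⟨s, hs, hs1⟩ := intermediate_value_Icc zero_le_one hcont
    (show (1 : ℝ) ∈ Icc _ _ by
      simp only [zero_smul, add_zero, one_smul, add_sub_cancel, hc0]
      exact ⟨zero_le_one, (not_le.1 hcon).le⟩)
  have h1 := (hχ.eq_one α hα _).1 hs1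
  have h2 := Metric.infDist_le_dist_of_mem (x := c + s • (u - c)) hc
  rw [dist_eq_norm, add_sub_cancel_left, norm_smul, Real.norm_of_nonneg hs.1] at h2
  rw [dist_eq_norm] at hd
  have := mul_le_of_le_one_left (norm_nonneg (u - c)) hs.2
  linarith

/-- The facet function is nonnegative on `C_α`, and the monomial survives only within distance `ε`
of it. -/
lemma facet_gt (hχ : IsCutoffFamily F ν ε B χ) (hν : IsAmple F ν) {A : ℝ}
    (hA : ∀ α ∈ F.rays, ‖vec α‖ ≤ A) {α : Fin n → ℤ} (hα : α ∈ F.rays) {u : Base n}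
    (h : χ α u ≠ 1) : -(A * ε) ≤ facet ν α u := by
  obtain ⟨c, hc, hd⟩ := hχ.exists_near hν hα h
  have h1 := zero_le_facet_of_mem_dominance hν hc
  have h2 : facet ν α u = facet ν α c + inner ℝ (vec α) (u - c) := by
    rw [← facet_add, add_sub_cancel]
  have h3 := (abs_le.1 (abs_real_inner_le_norm (vec α) (u - c))).1
  rw [dist_eq_norm] at hd
  have h4 := mul_le_mul (hA α hα) hd.le (norm_nonneg _) ((norm_nonneg _).trans (hA α hα))
  linarith

end IsCutoffFamily

lemma weight_nonneg (hχ : IsCutoffFamily F ν ε B χ) (hν : IsAmple F ν) (hε : 0 < ε) (ht : 0 < t) :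
    ∀ α ∈ F.rays, ∀ u, 0 ≤ weight ν t χ α u := fun _ hα u =>
  mul_nonneg (sub_nonneg.2 (hχ.le_one hν hε hα u)) (Real.rpow_nonneg ht.le _)

lemma weight_ne_zero_iff (ht : 0 < t) {α : Fin n → ℤ} {u : Base n} :
    weight ν t χ α u ≠ 0 ↔ χ α u ≠ 1 := by
  rw [weight, Ne, mul_eq_zero, not_or, sub_eq_zero, eq_comm]
  exact and_iff_left (Real.rpow_pos_of_pos ht _).ne'

lemma hasFDerivAt_rpow_facet (ht : 0 < t) (α : Fin n → ℤ) (u : Base n) :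
    HasFDerivAt (fun u => t ^ facet ν α u)
      ((t ^ facet ν α u * Real.log t) • innerSL ℝ (vec α)) u := by
  have h1 : HasFDerivAt (facet ν α) (innerSL ℝ (vec α)) u :=
    (innerSL ℝ (vec α)).hasFDerivAt.sub_const _
  have h2 := (h1.const_mul (Real.log t)).exp
  have h3 : (fun u => t ^ facet ν α u) = fun u => Real.exp (Real.log t * facet ν α u) :=
    funext fun u => Real.rpow_def_of_pos ht _
  rw [h3, Real.rpow_def_of_pos ht, mul_smul]
  exact h2

lemma contDiff_weight (hχ : IsCutoffFamily F ν ε B χ) (ht : 0 < t) :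
    ∀ α ∈ F.rays, ContDiff ℝ ∞ (weight ν t χ α) := fun α hα => by
  refine (contDiff_const.sub (hχ.smooth α hα)).mul ?_
  simp only [Real.rpow_def_of_pos ht]
  exact (contDiff_const.mul (contDiff_facet ν α)).exp

lemma fderiv_weight (hχ : IsCutoffFamily F ν ε B χ) (ht : 0 < t) {α : Fin n → ℤ}
    (hα : α ∈ F.rays) (u v : Base n) : fderiv ℝ (weight ν t χ α) u v =
      Real.log t * (weight ν t χ α u * inner ℝ (vec α) v) -
        t ^ facet ν α u * fderiv ℝ (χ α) u v := by
  have h : HasFDerivAt (weight ν t χ α) _ u :=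
    (((hχ.smooth α hα).differentiable (by simp) u).hasFDerivAt.const_sub 1).mul
      (hasFDerivAt_rpow_facet ht α u)
  rw [h.fderiv]
  change (1 - χ α u) * (t ^ facet ν α u * Real.log t * inner ℝ (vec α) v) +
    t ^ facet ν α u * -(fderiv ℝ (χ α) u v) = _
  rw [weight]
  ring

/-- Outside `Q` the dominant monomial exceeds `1`, and its own cutoff vanishes there. So `{f ≤ 0}`
is automatically contained in `Q`. -/
lemma potBase_pos (hχ : IsCutoffFamily F ν ε B χ) (hν : IsAmple F ν) (hε : 0 < ε) (ht : 1 < t)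
    {u : Base n} (hu : u ∉ polytope F ν) : 0 < potBase F.rays (weight ν t χ) u := by
  obtain ⟨γ, hγ, hγu⟩ : ∃ γ ∈ F.rays, 0 < facet ν γ u := by
    by_contra! hcon
    exact hu (mem_polytope.2 hcon)
  obtain ⟨β, hβ, hmax⟩ := Finset.exists_max_image F.rays (fun α => facet ν α u) ⟨γ, hγ⟩
  have hβ0 : 0 < facet ν β u := hγu.trans_le (hmax γ hγ)
  have hdom : u ∈ dominance F ν β := fun α hα => by
    rcases Finset.mem_insert.1 hα with rfl | hα
    · have h2 : vec (0 : Fin n → ℤ) = (0 : Base n) := by ext i; simp [vec]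
      rw [h2, ample_zero hν, inner_zero_left, sub_zero]
      exact hβ0.le
    · exact hmax α hα
  have hχ0 : χ β u = 0 := (hχ.eq_zero β hβ u).2 (by
    rw [Metric.infDist_zero_of_mem hdom]; positivity)
  have h1 : 1 < weight ν t χ β u := by
    rw [weight, hχ0, sub_zero, one_mul]
    exact Real.one_lt_rpow ht hβ0
  have h2 := Finset.single_le_sum (f := fun α => weight ν t χ α u)
    (fun α hα => weight_nonneg hχ hν hε (by linarith) α hα u) hβ
  rw [potBase]
  linarith

lemma ballBase_eq (hχ : IsCutoffFamily F ν ε B χ) (hν : IsAmple F ν) (hε : 0 < ε) (ht : 1 < t) :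
    ballBase F ν t χ = {u | potBase F.rays (weight ν t χ) u ≤ 0} := by
  have h1 : ∀ u, (superpotential F ν t χ (u, 0)).re = potBase F.rays (weight ν t χ) u := by
    intro u
    have h2 : ((u, 0) : Torus n) = cov (u, 0) := by
      refine Prod.ext rfl (funext fun i => ?_)
      simp [cov]
    have hph : PhasesTrivial F.rays (weight ν t χ) (u, 0) := fun α _ _ => ⟨0, by simp⟩
    rw [superpotential_eq_pot, h2, pot_cov, hph.potIm, hph.potRe]
    simp
  ext u
  change u ∈ polytope F ν ∧ _ ↔ _
  rw [h1]
  refine and_iff_right_of_imp fun hle => by_contra fun hu => ?_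
  exact absurd hle (not_le.2 (potBase_pos hχ hν hε ht hu))

lemma potBase_eq_neg_one (hχ : IsCutoffFamily F ν ε B χ) (hν : IsAmple F ν) (ht : 0 < t) {A : ℝ}
    (hA : ∀ α ∈ F.rays, ‖vec α‖ ≤ A) {u : Base n} (hu : ∀ α ∈ F.rays, facet ν α u < -(A * ε)) :
    potBase F.rays (weight ν t χ) u = -1 := by
  rw [potBase, Finset.sum_eq_zero, add_zero]
  intro α hα
  by_contra hne
  exact absurd (hχ.facet_gt hν hA hα ((weight_ne_zero_iff ht).1 hne)) (not_le.2 (hu α hα))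

/-- The connection is nondegenerate along the boundary of the ball, for large parameters. -/
lemma exists_nondegenerate (hν : IsAmple F ν) (h0 : (0 : Base n) ∈ interior (polytope F ν)) {A : ℝ}
    (hA : ∀ α ∈ F.rays, ‖vec α‖ ≤ A) (hε : 0 < ε) (hAε : A * ε ≤ 1 / 2) (B : ℝ) :
    ∃ T, 1 ≤ T ∧ ∀ t, T < t → ∀ χ, IsCutoffFamily F ν ε B χ → ∀ u,
      potBase F.rays (weight ν t χ) u = 0 →
      0 < inner ℝ (gradient (potBase F.rays (weight ν t χ)) u)
        (potDir F.rays (weight ν t χ) u) := by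
  obtain ⟨L, hL1, hL⟩ := exists_polytope_bound hν
  refine ⟨Real.exp (2 * L * (F.rays.card * |B|)), Real.one_le_exp (by positivity),
    fun t ht χ hχ u hu => ?_⟩
  have ht1 : 1 < t := lt_of_le_of_lt (Real.one_le_exp (by positivity)) ht
  have ht0 : 0 < t := by linarith
  have hlog : 2 * L * (F.rays.card * |B|) < Real.log t := (Real.lt_log_iff_exp_lt ht0).2 ht
  have huQ : u ∈ polytope F ν := by
    by_contra hcon
    exact absurd hu (potBase_pos hχ hν hε ht1 hcon).ne'
  set w := weight ν t χ with hw
  set d := potDir F.rays w u with hd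
  have hsum : ∑ α ∈ F.rays, w α u = 1 := by
    rw [potBase] at hu; linarith
  -- The weights add up to `1`, and each one present has `⟨α, u⟩ ≥ ν(α) - Aε ≥ 1/2`. This bounds
  -- `‖d‖` from below independently of `t`.
  have hdu : 1 / 2 ≤ (inner ℝ d u : ℝ) := by
    rw [hd, potDir, sum_inner]
    calc (1 / 2 : ℝ) = ∑ α ∈ F.rays, w α u * (1 / 2) := by rw [← Finset.sum_mul, hsum, one_mul]
      _ ≤ _ := Finset.sum_le_sum fun α hα => ?_
    rw [inner_smul_left]
    by_cases hwα : w α u = 0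
    · simp [hwα]
    · refine mul_le_mul_of_nonneg_left ?_ (weight_nonneg hχ hν hε ht0 α hα u)
      have h1 := hχ.facet_gt hν hA hα ((weight_ne_zero_iff ht0).1 hwα)
      have h2 := one_le_ample hν h0 hα
      rw [facet] at h1
      linarith
  have hdn : 1 / 2 ≤ ‖d‖ * L :=
    hdu.trans ((real_inner_le_norm _ _).trans
      (mul_le_mul_of_nonneg_left (hL u huQ) (norm_nonneg _)))
  have hd0 : 0 < ‖d‖ := by
    by_contra hcon
    have := le_antisymm (not_lt.1 hcon) (norm_nonneg d)
    rw [this] at hdn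
    linarith
  -- The main term grows with `log t`. The derivatives of the cutoffs stay bounded, as `t ^ facet ≤
  -- 1` on `Q`.
  have hder : inner ℝ (gradient (potBase F.rays w) u) d =
      Real.log t * ‖d‖ ^ 2 - ∑ α ∈ F.rays, t ^ facet ν α u * fderiv ℝ (χ α) u d := by
    rw [inner_gradient, fderiv_potBase (contDiff_weight hχ ht0),
      Finset.sum_congr rfl fun α hα => fderiv_weight hχ ht0 hα u d, Finset.sum_sub_distrib,
      ← Finset.mul_sum, ← real_inner_self_eq_norm_sq]
    nth_rewrite 3 [hd]
    rw [potDir, sum_inner]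
    simp only [inner_smul_left, conj_trivial, hw]
  have hbound : ∑ α ∈ F.rays, t ^ facet ν α u * fderiv ℝ (χ α) u d ≤
      F.rays.card * |B| * ‖d‖ := by
    calc ∑ α ∈ F.rays, t ^ facet ν α u * fderiv ℝ (χ α) u d ≤
        ∑ α ∈ F.rays, |B| * ‖d‖ := Finset.sum_le_sum fun α hα => ?_
      _ = F.rays.card * |B| * ‖d‖ := by rw [Finset.sum_const, nsmul_eq_mul, mul_assoc]
    have h1 : t ^ facet ν α u ≤ 1 :=
      Real.rpow_le_one_of_one_le_of_nonpos ht1.le (mem_polytope.1 huQ α hα)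
    have h2 : |fderiv ℝ (χ α) u d| ≤ |B| * ‖d‖ := by
      rw [← Real.norm_eq_abs]
      refine ((fderiv ℝ (χ α) u).le_opNorm d).trans ?_
      exact mul_le_mul_of_nonneg_right ((hχ.bound α hα u).trans (le_abs_self B)) (norm_nonneg _)
    calc t ^ facet ν α u * fderiv ℝ (χ α) u d ≤ t ^ facet ν α u * |fderiv ℝ (χ α) u d| :=
          mul_le_mul_of_nonneg_left (le_abs_self _) (Real.rpow_nonneg ht0.le _)
      _ ≤ 1 * |fderiv ℝ (χ α) u d| := mul_le_mul_of_nonneg_right h1 (abs_nonneg _)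
      _ ≤ |B| * ‖d‖ := by rwa [one_mul]
  rw [hder]
  have hk : F.rays.card * |B| < Real.log t * ‖d‖ := by
    have h1 : (F.rays.card * |B|) * 1 ≤ (F.rays.card * |B|) * (2 * L * ‖d‖) :=
      mul_le_mul_of_nonneg_left (by linarith) (by positivity)
    have h2 := mul_lt_mul_of_pos_right hlog hd0
    linarith
  have := mul_lt_mul_of_pos_right hk hd0
  linarith

/-- Points near a facet are near the boundary of every compact subset of the polytope. -/
lemma infDist_frontier_lt (hν : IsAmple F ν) (h0 : (0 : Base n) ∈ interior (polytope F ν))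
    {L c η : ℝ} (hL : ∀ y ∈ polytope F ν, ‖y‖ ≤ L) (hc0 : 0 < c) (hc : c < 1 / 2)
    (hcη : 2 * c * L < η) {D : Set (Base n)} (hD : D ⊆ polytope F ν) {u : Base n} (hu : u ∈ D)
    {α : Fin n → ℤ} (hα : α ∈ F.rays) (hαu : -c < facet ν α u) :
    Metric.infDist u (frontier D) < η := by
  -- At this point the facet function exceeds `c(1 - 2c) > 0` because `ν(α) ≥ 1`. So the radial
  -- segment, of length at most `2cL`, leaves `D`.
  set v := (1 + 2 * c) • u with hv
  have hvD : v ∉ D := fun h => by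
    have h1 := mem_polytope.1 (hD h) α hα
    rw [hv, facet_smul] at h1
    have h2 := one_le_ample hν h0 hα
    nlinarith
  have hpre : IsPreconnected (segment ℝ u v) := (convex_segment u v).isPreconnected
  obtain ⟨x, hx, hxD⟩ : (segment ℝ u v ∩ frontier D).Nonempty := by
    by_contra hcon
    have hno : ∀ x ∈ segment ℝ u v, x ∈ interior D ∨ x ∉ closure D := fun x hx => by
      by_contra! h
      exact hcon ⟨x, hx, h.2, h.1⟩
    obtain ⟨x, -, hx1, hx2⟩ := hpre _ _ isOpen_interior isClosed_closure.isOpen_compl hno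
      ⟨u, left_mem_segment ℝ u v, (hno u (left_mem_segment ℝ u v)).resolve_right
        fun h => h (subset_closure hu)⟩
      ⟨v, right_mem_segment ℝ u v, (hno v (right_mem_segment ℝ u v)).resolve_left
        fun h => hvD (interior_subset h)⟩
    exact hx2 (subset_closure (interior_subset hx1))
  refine (Metric.infDist_le_dist_of_mem hxD).trans_lt ?_
  rw [dist_comm]
  refine lt_of_le_of_lt (b := dist v u) ?_ ?_
  · obtain ⟨a, b, ha, hb, hab, rfl⟩ := hx
    rw [dist_eq_norm, dist_eq_norm, show a • u + b • v - u = b • (v - u) by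
      rw [← eq_sub_iff_add_eq] at hab
      rw [hab]
      module, norm_smul, Real.norm_of_nonneg hb]
    exact mul_le_of_le_one_left (norm_nonneg _) (by linarith)
  · rw [dist_eq_norm, hv, show (1 + 2 * c) • u - u = (2 * c) • u by module, norm_smul,
      Real.norm_of_nonneg (by positivity)]
    exact (mul_le_mul_of_nonneg_left (hL u (hD hu)) (by positivity)).trans_lt hcη

end Superpotential

/-! ### The generating function away from the collar -/

section Profile

/-- A smooth cutoff function, `1` below `-1/4` and `0` above `-1/8`. -/
noncomputable def dropOff (x : ℝ) : ℝ := 1 - Real.smoothTransition (8 * x + 2)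

lemma contDiff_dropOff : ContDiff ℝ ∞ dropOff :=
  contDiff_const.sub (Real.smoothTransition.contDiff.comp
    ((contDiff_const.mul contDiff_id).add contDiff_const))

lemma dropOff_nonneg (x : ℝ) : 0 ≤ dropOff x := sub_nonneg.2 (Real.smoothTransition.le_one _)

lemma dropOff_le_one (x : ℝ) : dropOff x ≤ 1 :=
  sub_le_self _ (Real.smoothTransition.nonneg _)

lemma dropOff_eq_one {x : ℝ} (hx : x ≤ -1 / 4) : dropOff x = 1 := by
  rw [dropOff, Real.smoothTransition.zero_of_nonpos (by linarith), sub_zero]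

lemma dropOff_eq_zero {x : ℝ} (hx : -1 / 8 ≤ x) : dropOff x = 0 := by
  rw [dropOff, Real.smoothTransition.one_of_one_le (by linarith), sub_self]

lemma deriv_dropOff_nonpos (x : ℝ) : deriv dropOff x ≤ 0 := by
  have : Antitone dropOff := fun x y hxy =>
    sub_le_sub_left (Real.smoothTransition.monotone (by linarith)) _
  exact this.deriv_nonpos

lemma deriv_dropOff_of_le {x : ℝ} (hx : x ≤ -1 / 4) : deriv dropOff x = 0 := by
  have : IsLocalMax dropOff x := Eventually.of_forall fun y => by
    rw [dropOff_eq_one hx]; exact dropOff_le_one y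
  exact this.deriv_eq_zero

lemma deriv_dropOff_of_ge {x : ℝ} (hx : -1 / 8 ≤ x) : deriv dropOff x = 0 := by
  have : IsLocalMin dropOff x := Eventually.of_forall fun y => by
    rw [dropOff_eq_zero hx]; exact dropOff_nonneg y
  exact this.deriv_eq_zero

lemma exists_deriv_dropOff_bound : ∃ K, 0 ≤ K ∧ ∀ x, |deriv dropOff x| ≤ K := by
  obtain ⟨K, hK⟩ := (isCompact_Icc (a := (-1 / 4 : ℝ)) (b := -1 / 8)).exists_bound_of_continuousOn
    (contDiff_dropOff.continuous_deriv (by simp)).continuousOn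
  have hK0 : 0 ≤ K := (norm_nonneg _).trans (hK (-1 / 4) ⟨le_rfl, by norm_num⟩)
  refine ⟨K, hK0, fun x => ?_⟩
  rcases le_or_gt x (-1 / 4) with h | h
  · rw [deriv_dropOff_of_le h, abs_zero]; exact hK0
  rcases le_or_gt (-1 / 8) x with h' | h'
  · rw [deriv_dropOff_of_ge h', abs_zero]; exact hK0
  · exact hK x ⟨h.le, h'.le⟩

variable {F : SmoothCompleteFan n} {ν : Base n → ℝ}

lemma gradient_eq_of_hasFDerivAt {f : Base n → ℝ} {u a : Base n} {l : Base n →L[ℝ] ℝ}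
    (h : HasFDerivAt f l u) (hl : ∀ v, l v = inner ℝ a v) : gradient f u = a := by
  refine ext_inner_right ℝ fun v => ?_
  rw [inner_gradient, h.fderiv, hl]

lemma hasFDerivAt_gradient {f : Base n → ℝ} (hf : ContDiff ℝ ∞ f) (u : Base n) :
    HasFDerivAt f (innerSL ℝ (gradient f u)) u := by
  have h : innerSL ℝ (gradient f u) = fderiv ℝ f u :=
    ContinuousLinearMap.ext fun v => inner_gradient f u v
  rw [h]
  exact (hf.differentiable (by simp) u).hasFDerivAt

/-- Cutoff functions of the polytope. -/
lemma exists_facetCutoff {A : ℝ} (hA : ∀ α ∈ F.rays, ‖vec α‖ ≤ A) :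
    ∃ K, 0 ≤ K ∧ ∀ e, 0 < e → ∃ ρ : Base n → ℝ, ContDiff ℝ ∞ ρ ∧ (∀ u, 0 ≤ ρ u ∧ ρ u ≤ 1) ∧
      (∀ u, (∀ α ∈ F.rays, facet ν α u ≤ -(e / 4)) → ρ u = 1) ∧
      (∀ u, ∀ α ∈ F.rays, -(e / 8) ≤ facet ν α u → ρ u = 0) ∧
      (∀ u, ∀ α ∈ F.rays, |(inner ℝ (vec α) (gradient ρ u) : ℝ)| ≤ K / e) ∧
      ∀ u, (∃ α ∈ F.rays, -(e / 4) ≤ facet ν α u) →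
        ∃ α ∈ F.rays, -(e / 4) ≤ facet ν α u ∧ (inner ℝ (vec α) (gradient ρ u) : ℝ) ≤ 0 := by
  classical
  obtain ⟨K, hK0, hK⟩ := exists_deriv_dropOff_bound
  refine ⟨F.rays.card * K * A ^ 2, by positivity, fun e he => ?_⟩
  set k : (Fin n → ℤ) → Base n → ℝ := fun γ u =>
    (∏ β ∈ F.rays.erase γ, dropOff (facet ν β u / e)) * (-deriv dropOff (facet ν γ u / e) / e)
    with hk
  have hprod : ∀ γ u, 0 ≤ ∏ β ∈ F.rays.erase γ, dropOff (facet ν β u / e) := fun γ u =>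
    Finset.prod_nonneg fun _ _ => dropOff_nonneg _
  have hk0 : ∀ γ u, 0 ≤ k γ u := fun γ u => mul_nonneg (hprod γ u)
    (div_nonneg (neg_nonneg.2 (deriv_dropOff_nonpos _)) he.le)
  have hkK : ∀ γ u, k γ u ≤ K / e := fun γ u => by
    have h1 : ∏ β ∈ F.rays.erase γ, dropOff (facet ν β u / e) ≤ 1 :=
      Finset.prod_le_one (fun _ _ => dropOff_nonneg _) fun _ _ => dropOff_le_one _
    have h2 : -deriv dropOff (facet ν γ u / e) / e ≤ K / e :=
      div_le_div_of_nonneg_right ((neg_le_abs _).trans (hK _)) he.le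
    have h3 : 0 ≤ -deriv dropOff (facet ν γ u / e) / e :=
      div_nonneg (neg_nonneg.2 (deriv_dropOff_nonpos _)) he.le
    exact (mul_le_of_le_one_left h3 h1).trans h2
  have hgrad : ∀ u, gradient (fun u => ∏ α ∈ F.rays, dropOff (facet ν α u / e)) u =
      -∑ γ ∈ F.rays, k γ u • vec γ := by
    intro u
    have h1 : ∀ γ ∈ F.rays, HasFDerivAt (fun u => dropOff (facet ν γ u / e))
        ((deriv dropOff (facet ν γ u / e) / e) • innerSL ℝ (vec γ)) u := fun γ _ => by
      have h2 : HasFDerivAt (facet ν γ) (innerSL ℝ (vec γ)) u :=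
        (innerSL ℝ (vec γ)).hasFDerivAt.sub_const _
      have h3 := ((contDiff_dropOff.differentiable (by simp)
        (facet ν γ u / e)).hasDerivAt).comp_hasFDerivAt u (h2.mul_const e⁻¹)
      rw [smul_smul, ← div_eq_mul_inv] at h3
      exact h3
    refine gradient_eq_of_hasFDerivAt (HasFDerivAt.finsetProd h1) fun v => ?_
    simp only [coe_innerSL_apply, inner_neg_left, sum_inner, inner_smul_left, conj_trivial,
      sum_apply, smul_apply, smul_eq_mul, hk]
    rw [← Finset.sum_neg_distrib]
    refine Finset.sum_congr rfl fun γ _ => ?_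
    ring
  refine ⟨fun u => ∏ α ∈ F.rays, dropOff (facet ν α u / e), contDiff_prod fun α _ =>
    contDiff_dropOff.comp ((contDiff_facet ν α).div_const e), fun u =>
    ⟨Finset.prod_nonneg fun _ _ => dropOff_nonneg _,
      Finset.prod_le_one (fun _ _ => dropOff_nonneg _) fun _ _ => dropOff_le_one _⟩,
    fun u hu => Finset.prod_eq_one fun α hα => dropOff_eq_one ?_,
    fun u α hα hu => Finset.prod_eq_zero hα (dropOff_eq_zero ?_), fun u α hα => ?_, ?_⟩
  · rw [div_le_iff₀ he]; linarith [hu α hα]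
  · rw [le_div_iff₀ he]; linarith
  · rw [hgrad, inner_neg_right, abs_neg, inner_sum]
    calc |∑ γ ∈ F.rays, (inner ℝ (vec α) (k γ u • vec γ) : ℝ)|
        ≤ ∑ γ ∈ F.rays, |(inner ℝ (vec α) (k γ u • vec γ) : ℝ)| := Finset.abs_sum_le_sum_abs _ _
      _ ≤ ∑ γ ∈ F.rays, K / e * A ^ 2 := Finset.sum_le_sum fun γ hγ => ?_
      _ = F.rays.card * K * A ^ 2 / e := by rw [Finset.sum_const, nsmul_eq_mul]; ring
    rw [inner_smul_right, abs_mul, abs_of_nonneg (hk0 γ u), sq]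
    refine mul_le_mul (hkK γ u) ((abs_real_inner_le_norm _ _).trans ?_) (abs_nonneg _)
      (by positivity)
    exact mul_le_mul (hA α hα) (hA γ hγ) (norm_nonneg _) ((norm_nonneg _).trans (hA α hα))
  · rintro u ⟨α, hα, hαu⟩
    -- `∇ρ = -∑ k_γ γ` with `k_γ ≥ 0`, and only nearby facets occur. If all of these paired
    -- positively with `∇ρ`, then `‖∇ρ‖² ≤ 0`.
    by_contra! hcon
    set G := gradient (fun u => ∏ α ∈ F.rays, dropOff (facet ν α u / e)) u with hG
    have h1 : ‖G‖ ^ 2 = -∑ γ ∈ F.rays, k γ u * inner ℝ (vec γ) G := by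
      rw [← real_inner_self_eq_norm_sq]
      nth_rewrite 1 [hG]
      rw [hgrad, inner_neg_left, sum_inner]
      simp [inner_smul_left]
    have h2 : 0 ≤ ∑ γ ∈ F.rays, k γ u * inner ℝ (vec γ) G := Finset.sum_nonneg fun γ hγ => by
      rcases le_or_gt (-(e / 4)) (facet ν γ u) with h | h
      · exact mul_nonneg (hk0 γ u) (hcon γ hγ h).le
      · have : k γ u = 0 := by
          simp only [hk]
          rw [deriv_dropOff_of_le (by rw [div_le_iff₀ he]; linarith)]
          simp
        rw [this, zero_mul]
    have h3 : G = 0 := norm_eq_zero.1 (by nlinarith [sq_nonneg ‖G‖, norm_nonneg G])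
    have := hcon α hα hαu
    rw [h3, inner_zero_right] at this
    exact lt_irrefl _ this

lemma exists_ample_bound (F : SmoothCompleteFan n) (ν : Base n → ℝ) :
    ∃ N, 0 ≤ N ∧ ∀ α ∈ F.rays, ν (vec α) ≤ N :=
  ⟨∑ α ∈ F.rays, |ν (vec α)|, Finset.sum_nonneg fun _ _ => abs_nonneg _, fun _ hα =>
    (le_abs_self _).trans
      (Finset.single_le_sum (f := fun α => |ν (vec α)|) (fun _ _ => abs_nonneg _) hα)⟩

/-- The ingredients of the generating function of the twisted Lagrangian away from its boundary:
`g` generates the part near the boundary of the polytope, `g + D` the part in the interior, and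
`ρ` interpolates. -/
theorem exists_profile (hν : IsAmple F ν) (h0 : (0 : Base n) ∈ interior (polytope F ν))
    {j s : ℝ} (hs : s = 1 ∧ 0 < j ∨ s = -1 ∧ j < 0) : ∃ e₀ > 0, ∀ e, 0 < e → e < e₀ →
    ∃ g D ρ : Base n → ℝ, ContDiff ℝ ∞ g ∧ ContDiff ℝ ∞ D ∧ ContDiff ℝ ∞ ρ ∧
      (∀ u ∈ Metric.thickening e (polytope F ν), ∀ α ∈ F.rays, -(e / 4) ≤ facet ν α u →
        inner ℝ (vec α) (gradient g u) = ν (vec α)) ∧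
      (∀ u, gradient g u + gradient D u = (1 + s * e) • u) ∧
      (∀ u ∈ polytope F ν, j * D u ≤ 0) ∧
      (∀ u ∈ polytope F ν, ∀ α ∈ F.rays, -(e / 4) ≤ facet ν α u →
        0 < j * inner ℝ (vec α) (gradient D u) ∧
        |j| * (|(inner ℝ (vec α) (gradient ρ u) : ℝ)| * |D u| +
          |(inner ℝ (vec α) (gradient D u) : ℝ)|) < 1) ∧
      (∀ u, 0 ≤ ρ u ∧ ρ u ≤ 1) ∧
      (∀ u, (∀ α ∈ F.rays, facet ν α u ≤ -(e / 4)) → ρ u = 1) ∧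
      (∀ u, ∀ α ∈ F.rays, -(e / 8) ≤ facet ν α u → ρ u = 0) ∧
      ∀ u, (∃ α ∈ F.rays, -(e / 4) ≤ facet ν α u) →
        ∃ α ∈ F.rays, -(e / 4) ≤ facet ν α u ∧ (inner ℝ (vec α) (gradient ρ u) : ℝ) ≤ 0 := by
  obtain ⟨A, hA1, hA⟩ := exists_ray_bound F
  obtain ⟨L, hL1, hL⟩ := exists_polytope_bound hν
  obtain ⟨N, hN0, hN⟩ := exists_ample_bound F ν
  obtain ⟨K, hK0, hK⟩ := exists_facetCutoff (F := F) (ν := ν) hA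
  obtain ⟨c, hc0, e₁, he₁, hG⟩ := exists_facetAffine hν h0 (a := 1 + N) (D := L + 2)
    (by positivity) (by positivity)
  have hs2 : s * s = 1 := by rcases hs with ⟨rfl, -⟩ | ⟨rfl, -⟩ <;> norm_num
  have hsabs : |s| = 1 := by rcases hs with ⟨rfl, -⟩ | ⟨rfl, -⟩ <;> norm_num
  have hjs : j = |j| * s := by
    rcases hs with ⟨rfl, h⟩ | ⟨rfl, h⟩
    · rw [abs_of_pos h, mul_one]
    · rw [abs_of_neg h]; ring
  have hj0 : 0 < |j| := abs_pos.2 (by rcases hs with ⟨-, h⟩ | ⟨-, h⟩ <;> [exact h.ne'; exact h.ne])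
  set Y := |j| * (4 * K * c + 1 + N) with hY
  have hY0 : 0 < Y := by positivity
  refine ⟨min (min e₁ (1 / 2)) (1 / Y), by positivity, fun e he hlt => ?_⟩
  have hee₁ : e < e₁ := hlt.trans_le ((min_le_left _ _).trans (min_le_left _ _))
  have he2 : e < 1 / 2 := hlt.trans_le ((min_le_left _ _).trans (min_le_right _ _))
  have heY : e * Y < 1 := (lt_div_iff₀ hY0).1 (hlt.trans_le (min_le_right _ _))
  obtain ⟨G, hGs, hGz⟩ := hG e he hee₁
  obtain ⟨ρ, hρs, hρI, hρ1, hρ0, hρK, hρd⟩ := hK e he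
  have hse := abs_le.1 (show |s * e| ≤ e by rw [abs_mul, hsabs, one_mul, abs_of_pos he])
  set l := 1 + s * e with hl
  have hl1 : 1 / 2 < l := by linarith
  have hl2 : l < 3 / 2 := by linarith
  have hl0 : 0 < l := by linarith
  -- This rescaling approximates `l|u|²/2` while its gradient is that of `G` at `l u`, so the slopes
  -- across the facets remain `ν(α)`.
  set g : Base n → ℝ := fun u => l⁻¹ * G (l • u) with hg
  have hgs : ContDiff ℝ ∞ g := contDiff_const.mul (hGs.comp (contDiff_const_smul l))
  have hggrad : ∀ u, gradient g u = gradient G (l • u) := fun u => by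
    have h1 : HasFDerivAt (fun u : Base n => l • u) (l • ContinuousLinearMap.id ℝ (Base n)) u :=
      (hasFDerivAt_id u).const_smul l
    have h2 := ((hasFDerivAt_gradient hGs (l • u)).comp u h1).const_mul l⁻¹
    refine gradient_eq_of_hasFDerivAt h2 fun v => ?_
    simp [hl0.ne']
  -- The constant equals the bound for the approximation error; it makes `jD ≤ 0` on `Q` without
  -- affecting the gradient.
  set D : Base n → ℝ := fun u => l / 2 * inner ℝ u u - s * (2 * c * e ^ 2) - g u with hD
  have hDs : ContDiff ℝ ∞ D :=
    ((contDiff_const.mul (contDiff_id.inner ℝ contDiff_id)).sub contDiff_const).sub hgs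
  have hDgrad : ∀ u, gradient D u = l • u - gradient g u := fun u => by
    have h1 : HasFDerivAt (fun u : Base n => (inner ℝ u u : ℝ)) _ u :=
      (hasFDerivAt_id u).inner ℝ (hasFDerivAt_id u)
    have h2 := ((h1.const_mul (l / 2)).sub_const (s * (2 * c * e ^ 2))).sub
      (hasFDerivAt_gradient hgs u)
    refine gradient_eq_of_hasFDerivAt h2 fun v => ?_
    simp [inner_sub_left, inner_smul_left, real_inner_comm u v]
    ring
  have hnear : ∀ u ∈ Metric.thickening e (polytope F ν),
      ∃ y ∈ polytope F ν, ‖l • u - y‖ ≤ (L + 2) * e := by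
    intro u hu
    obtain ⟨y, hy, huy⟩ := Metric.mem_thickening_iff.1 hu
    rw [dist_eq_norm] at huy
    refine ⟨y, hy, ?_⟩
    have h1 : l • u - y = l • (u - y) + (s * e) • y := by rw [hl]; module
    rw [h1]
    refine (norm_add_le _ _).trans ?_
    rw [norm_smul, norm_smul, Real.norm_of_nonneg hl0.le, Real.norm_eq_abs, abs_mul, hsabs,
      one_mul, abs_of_pos he]
    have h2 := hL y hy
    nlinarith [norm_nonneg (u - y)]
  have hfacet : ∀ u α, α ∈ F.rays → -(e / 4) ≤ facet ν α u →
      -((1 + N) * e) ≤ facet ν α (l • u) := fun u α hα hu => by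
    rw [facet_smul, hl, add_sub_cancel_left, ← hl]
    have h1 := one_le_ample hν h0 hα
    have h2 := hN α hα
    nlinarith
  have hbd : ∀ u ∈ polytope F ν, |l / 2 * inner ℝ u u - g u| ≤ 2 * c * e ^ 2 := fun u hu => by
    have h1 := (hGz (l • u) (hnear u (Metric.self_subset_thickening he _ hu))).1
    have h2 : l / 2 * inner ℝ u u - g u = -(l⁻¹ * (G (l • u) - ‖l • u‖ ^ 2 / 2)) := by
      rw [real_inner_self_eq_norm_sq, norm_smul, Real.norm_of_nonneg hl0.le, hg]
      field_simp
      ring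
    rw [h2, abs_neg, abs_mul, abs_of_pos (inv_pos.2 hl0)]
    have h3 : l⁻¹ ≤ 2 := by
      rw [inv_le_comm₀ hl0 two_pos]; linarith
    calc l⁻¹ * |G (l • u) - ‖l • u‖ ^ 2 / 2| ≤ 2 * (c * e ^ 2) :=
          mul_le_mul h3 h1 (abs_nonneg _) zero_le_two
      _ = _ := by ring
  have hLe : 0 ≤ 2 * c * e ^ 2 := by positivity
  refine ⟨g, D, ρ, hgs, hDs, hρs, fun u hu α hα hαu => ?_, fun u => ?_, fun u hu => ?_,
    fun u hu α hα hαu => ?_, hρI, hρ1, hρ0, hρd⟩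
  · rw [hggrad]
    exact (hGz _ (hnear u hu)).2 α hα (hfacet u α hα hαu)
  · rw [hDgrad, add_sub_cancel]
  · have h1 : s * (l / 2 * inner ℝ u u - g u) ≤ 2 * c * e ^ 2 :=
      (le_abs_self _).trans (by rw [abs_mul, hsabs, one_mul]; exact hbd u hu)
    have h2 : s * D u ≤ 0 := by
      have : s * D u = s * (l / 2 * inner ℝ u u - g u) - s * s * (2 * c * e ^ 2) := by
        rw [hD]; ring
      rw [this, hs2]; linarith
    rw [hjs, mul_assoc]
    exact mul_nonpos_of_nonneg_of_nonpos hj0.le h2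
  · have h1 : inner ℝ (vec α) (gradient D u) = l * facet ν α u + s * e * ν (vec α) := by
      rw [hDgrad, inner_sub_right, hggrad, (hGz _ (hnear u
        (Metric.self_subset_thickening he _ hu))).2 α hα (hfacet u α hα hαu), inner_smul_right,
        facet, hl]
      ring
    have h2 := one_le_ample hν h0 hα
    have h3 := hN α hα
    have h4 := mem_polytope.1 hu α hα
    have h5 : -(3 / 8 * e) ≤ l * facet ν α u := by nlinarith
    have h6 : l * facet ν α u ≤ 0 := mul_nonpos_of_nonneg_of_nonpos hl0.le h4
    have h7 : e ≤ e * ν (vec α) := le_mul_of_one_le_right he.le h2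
    have h8 : e * ν (vec α) ≤ e * N := mul_le_mul_of_nonneg_left h3 he.le
    constructor
    · rw [h1]
      rcases hs with ⟨rfl, h⟩ | ⟨rfl, h⟩
      · exact mul_pos h (by linarith)
      · exact mul_pos_of_neg_of_neg h (by linarith)
    · have h9 : |(inner ℝ (vec α) (gradient D u) : ℝ)| ≤ (1 + N) * e := by
        rw [h1, abs_le]
        rcases hs with ⟨rfl, h⟩ | ⟨rfl, h⟩ <;> constructor <;> linarith
      have h10 : |D u| ≤ 4 * c * e ^ 2 := by
        have : D u = (l / 2 * inner ℝ u u - g u) - s * (2 * c * e ^ 2) := by rw [hD]; ring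
        rw [this]
        refine (abs_sub _ _).trans ?_
        rw [abs_mul, hsabs, one_mul, abs_of_nonneg hLe]
        linarith [hbd u hu]
      have h11 := mul_le_mul (hρK u α hα) h10 (abs_nonneg _) (by positivity)
      have h12 : K / e * (4 * c * e ^ 2) = 4 * K * c * e := by field_simp
      rw [h12] at h11
      -- The cutoff has slope `O(1/e)` but `D = O(e²)`: quadratic accuracy of `G` makes the product
      -- `O(e)`.
      calc |j| * (|(inner ℝ (vec α) (gradient ρ u) : ℝ)| * |D u| +
            |(inner ℝ (vec α) (gradient D u) : ℝ)|) ≤ |j| * (4 * K * c * e + (1 + N) * e) :=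
            mul_le_mul_of_nonneg_left (add_le_add h11 h9) hj0.le
        _ = e * Y := by rw [hY]; ring
        _ < 1 := heY

end Profile

/-! ### Interpolation between the collar and the interior -/

section Twist

/-- The properties of the generating function `H` of the Lagrangian `ℒ(j)`: near the boundary `N`
of the ball the superpotential has phase `ψ` along the graph, and over `V` the graph is linear. -/
structure IsTwistFunction (F : SmoothCompleteFan n) (ν : Base n → ℝ)
    (w : (Fin n → ℤ) → Base n → ℝ) (ψ : ℝ) (j : ℤ) (e l : ℝ) (H : Base n → ℝ)
    (N V : Set (Base n)) : Prop where
  smooth : ContDiff ℝ ∞ H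
  isOpen_N : IsOpen N
  mem_N : ∀ u, potBase F.rays w u = 0 → u ∈ N
  inner_gradient_bdry : ∀ u, potBase F.rays w u = 0 → ∀ α ∈ F.rays, w α u ≠ 0 →
    inner ℝ (vec α) (gradient H u) = -(2 * Real.pi * j * ν (vec α))
  phase : ∀ u ∈ N, potIm F.rays w (graphPt H u) * Real.cos ψ =
    potRe F.rays w (graphPt H u) * Real.sin ψ
  isOpen_V : IsOpen V
  closure_V : ∀ u ∈ closure V, potBase F.rays w u < 0
  near_bdry : ∀ u, potBase F.rays w u ≤ 0 → u ∉ V → ∃ α ∈ F.rays, -(e / 2) < facet ν α u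
  gradient_V : ∀ u ∈ V, gradient H u = -(2 * Real.pi * j * l) • u
  mem_of_lattice : ∀ u, potBase F.rays w u < 0 → (∃ k, gradient H u = (2 * Real.pi) • vec k) →
    u ∈ closure V ∧ (j ≠ 0 → u ∈ V)
  eq_V : j ≠ 0 → V = {u | ∀ α ∈ F.rays, facet ν α u < -(e / 4)}

variable {F : SmoothCompleteFan n} {ν : Base n → ℝ} {w : (Fin n → ℤ) → Base n → ℝ}

lemma exists_weight_ne_zero {u : Base n} (hu : potBase F.rays w u = 0) :
    ∃ α ∈ F.rays, w α u ≠ 0 := by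
  by_contra! h
  rw [potBase, Finset.sum_eq_zero h] at hu
  norm_num at hu

lemma not_int_of_mem_Ioo {x : ℝ} (h1 : -(2 * Real.pi) < x) (h2 : x < 0) (k : ℤ) :
    x ≠ 2 * Real.pi * k := by
  rintro rfl
  have hpi : 0 < 2 * Real.pi := by positivity
  have h3 : (-1 : ℝ) < k := lt_of_mul_lt_mul_left (by linarith) hpi.le
  have h4 : (k : ℝ) < 0 := neg_of_mul_neg_right h2 hpi.le
  have h5 : -1 < k := by exact_mod_cast h3
  have h6 : k < 0 := by exact_mod_cast h4
  omega

/-- Without twist the collar function alone works: in the collar some phase lies in `[-1, 0)` and is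
therefore not a multiple of `2π`. -/
theorem exists_twistFunction_zero (hw : ∀ α ∈ F.rays, ContDiff ℝ ∞ (w α))
    (hpos : ∀ α ∈ F.rays, ∀ u, 0 ≤ w α u) (hB : IsCompact {u | potBase F.rays w u ≤ 0})
    (hnd : ∀ u, potBase F.rays w u = 0 →
      0 < inner ℝ (gradient (potBase F.rays w) u) (potDir F.rays w u))
    {ψ : ℝ} (hc : 0 < Real.cos ψ) (hs : 0 < Real.sin ψ) {e l : ℝ}
    (hwf : ∀ α ∈ F.rays, ∀ u, w α u ≠ 0 → -(e / 2) < facet ν α u) :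
    ∃ H N V, IsTwistFunction F ν w ψ 0 e l H N V := by
  have hO : IsOpen {u | ∃ α ∈ F.rays, -(e / 2) < facet ν α u} := by
    have : {u | ∃ α ∈ F.rays, -(e / 2) < facet ν α u} =
        ⋃ α ∈ F.rays, {u | -(e / 2) < facet ν α u} := by ext; simp
    rw [this]
    exact isOpen_biUnion fun α _ => isOpen_lt continuous_const (continuous_facet ν α)
  obtain ⟨Θ, S, N, V, hΘ, -, hN, hZ, hNΘ, -, hV, hVc, hVO, hΘV, hcol⟩ :=
    exists_collar hw hpos hB hnd hc hs hO fun u hu => by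
      obtain ⟨α, hα, h⟩ := exists_weight_ne_zero hu
      exact ⟨α, hα, hwf α hα u h⟩
  refine ⟨Θ, N, V, ⟨hΘ, hN, fun u hu => (hZ u hu).1, fun u hu α _ _ => ?_,
    fun u hu => (hNΘ u hu).2, hV, hVc, hVO, fun u hu => ?_, fun u hu hk => ?_,
    fun h => (h rfl).elim⟩⟩
  · rw [(hZ u hu).2]; simp
  · rw [hΘV u hu]; simp
  · refine ⟨?_, fun h => (h rfl).elim⟩
    rcases hcol u hu with ⟨-, α, -, -, h1, h2, -⟩ | ⟨-, -, -, h⟩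
    · obtain ⟨k, hk⟩ := hk
      rw [hk, inner_smul_right, inner_vec_vec] at h1 h2
      exact (not_int_of_mem_Ioo (by linarith [Real.pi_gt_three]) h2 _ rfl).elim
    · exact h

lemma gradient_twist {g S D ρ Θ : Base n → ℝ} (hg : ContDiff ℝ ∞ g) (hS : ContDiff ℝ ∞ S)
    (hD : ContDiff ℝ ∞ D) (hρ : ContDiff ℝ ∞ ρ) (hΘ : ContDiff ℝ ∞ Θ) (c d : ℝ) (u : Base n) :
    gradient (fun u => c * (g u + S u * ((1 - d) * ρ u + d) * D u) + Θ u) u =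
      c • (gradient g u + (((1 - d) * ρ u + d) * D u) • gradient S u +
        (S u * D u * (1 - d)) • gradient ρ u + (S u * ((1 - d) * ρ u + d)) • gradient D u) +
        gradient Θ u := by
  have h := ((((hasFDerivAt_gradient hg u).add (((hasFDerivAt_gradient hS u).mul
    (((hasFDerivAt_gradient hρ u).const_mul (1 - d)).add_const d)).mul
      (hasFDerivAt_gradient hD u))).const_mul c).add (hasFDerivAt_gradient hΘ u))
  refine gradient_eq_of_hasFDerivAt h fun v => ?_
  simp only [add_apply, smul_apply, coe_innerSL_apply, inner_add_left, inner_smul_left,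
    conj_trivial, smul_eq_mul, Pi.mul_apply]
  ring

lemma gradient_eq_zero_of_isLocalMin {f : Base n → ℝ} {u : Base n} (h : IsLocalMin f u) :
    gradient f u = 0 := by
  refine ext_inner_right ℝ fun v => ?_
  rw [inner_gradient, h.fderiv_eq_zero]
  simp

lemma gradient_eq_zero_of_isLocalMax {f : Base n → ℝ} {u : Base n} (h : IsLocalMax f u) :
    gradient f u = 0 := by
  refine ext_inner_right ℝ fun v => ?_
  rw [inner_gradient, h.fderiv_eq_zero]
  simp

/-- The function is `-2πj(g + S((1 - d)ρ + d)D) + Θ`. At the boundary `S = 0`, which leaves `-2πj g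
+ Θ`; over `V` one has `S = ρ = 1` and `∇Θ = 0`, which leaves the quadratic form up to a locally
constant term. The transitions of `S` and of `ρ` occur in disjoint regions. -/
theorem exists_twistFunction (hν : IsAmple F ν) (h0 : (0 : Base n) ∈ interior (polytope F ν))
    {j : ℤ} {s : ℝ} (hs : s = 1 ∧ 0 < (j : ℝ) ∨ s = -1 ∧ (j : ℝ) < 0) :
    ∃ e₀ > 0, ∀ e, 0 < e → e < e₀ → ∀ w : (Fin n → ℤ) → Base n → ℝ,
      (∀ α ∈ F.rays, ContDiff ℝ ∞ (w α)) → (∀ α ∈ F.rays, ∀ u, 0 ≤ w α u) →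
      {u | potBase F.rays w u ≤ 0} ⊆ polytope F ν →
      (∀ u, potBase F.rays w u = 0 →
        0 < inner ℝ (gradient (potBase F.rays w) u) (potDir F.rays w u)) →
      (∀ α ∈ F.rays, ∀ u, w α u ≠ 0 → -(e / 8) < facet ν α u) →
      ∀ ψ : ℝ, 0 < Real.cos ψ → 0 < Real.sin ψ →
      ∃ H N V, IsTwistFunction F ν w ψ j e (1 + s * e) H N V := by
  obtain ⟨e₀, he₀, hprof⟩ := exists_profile hν h0 hs
  refine ⟨e₀, he₀, fun e he hee w hw hpos hBQ hnd hwf ψ hcos hsin => ?_⟩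
  obtain ⟨g, D, ρ, hg, hD, hρ, hgα, hgD, hDneg, hDα, hρI, hρ1, hρ0, hρd⟩ := hprof e he hee
  have hj0 : (j : ℝ) ≠ 0 := by rcases hs with ⟨-, h⟩ | ⟨-, h⟩ <;> [exact h.ne'; exact h.ne]
  have hB : IsCompact {u | potBase F.rays w u ≤ 0} :=
    (isCompact_polytope hν).of_isClosed_subset
      (isClosed_le (contDiff_potBase hw).continuous continuous_const) hBQ
  set O := {u | ∃ α ∈ F.rays, -(e / 8) < facet ν α u} with hOdef
  have hO : IsOpen O := by
    have : O = ⋃ α ∈ F.rays, {u | -(e / 8) < facet ν α u} := by ext; simp [hOdef]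
    rw [this]
    exact isOpen_biUnion fun α _ => isOpen_lt continuous_const (continuous_facet ν α)
  obtain ⟨Θ, S, N, V₀, hΘ, hS, hN, hZ, hNΘ, hSI, -, -, -, -, hcol⟩ :=
    exists_collar hw hpos hB hnd hcos hsin hO fun u hu => by
      obtain ⟨α, hα, h⟩ := exists_weight_ne_zero hu
      exact ⟨α, hα, hwf α hα u h⟩
  obtain ⟨M, hM0, hM⟩ : ∃ M, 0 ≤ M ∧ ∀ u, potBase F.rays w u ≤ 0 → ∀ α ∈ F.rays,
      |(j : ℝ)| * (|(inner ℝ (vec α) (gradient S u) : ℝ)| * |D u|) ≤ M := by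
    have hcont : Continuous fun u => ∑ α ∈ F.rays,
        |(j : ℝ)| * (|(inner ℝ (vec α) (gradient S u) : ℝ)| * |D u|) :=
      continuous_finsetSum _ fun α _ => continuous_const.mul
        ((continuous_const.inner (contDiff_gradient hS).continuous).abs.mul hD.continuous.abs)
    obtain ⟨M, hM⟩ := hB.exists_bound_of_continuousOn hcont.continuousOn
    refine ⟨|M|, abs_nonneg _, fun u hu α hα => ?_⟩
    exact (Finset.single_le_sum (f := fun α =>
      |(j : ℝ)| * (|(inner ℝ (vec α) (gradient S u) : ℝ)| * |D u|))
      (fun _ _ => by positivity) hα).trans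
      ((le_abs_self _).trans ((hM u hu).trans (le_abs_self M)))
  -- The collar may be arbitrarily thin, so `∇S` has no bound in terms of `e`. It multiplies `D`
  -- where `ρ = 0`, and there the small factor `d` brings the contribution below `1/2`.
  set d := 1 / (2 * (M + 1)) with hd
  have hd0 : 0 < d := by positivity
  have hdM : d * (M + 1) = 1 / 2 := by rw [hd]; field_simp
  have hd1 : d ≤ 1 / 2 := by nlinarith
  set H : Base n → ℝ := fun u =>
    (-(2 * Real.pi * j)) * (g u + S u * ((1 - d) * ρ u + d) * D u) + Θ u with hH
  have hHgrad := fun u => gradient_twist hg hS hD hρ hΘ (-(2 * Real.pi * j)) d u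
  have hHs : ContDiff ℝ ∞ H := (contDiff_const.mul (hg.add ((hS.mul
    ((contDiff_const.mul hρ).add contDiff_const)).mul hD))).add hΘ
  have hHN : ∀ u ∈ N, gradient H u = -(2 * Real.pi * j) • gradient g u + gradient Θ u := by
    intro u hu
    have hS0 := (hNΘ u hu).1
    have hSg : gradient S u = 0 := gradient_eq_zero_of_isLocalMin
      (Eventually.of_forall fun v => by rw [hS0]; exact (hSI v).1)
    rw [hHgrad, hS0, hSg]
    simp
  have hphase : ∀ u ∈ N ∩ Metric.thickening e (polytope F ν), ∀ α ∈ F.rays, w α u ≠ 0 →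
      inner ℝ (vec α) (gradient H u) =
        inner ℝ (vec α) (gradient Θ u) - 2 * Real.pi * j * ν (vec α) := by
    intro u hu α hα hwα
    have h1 := hwf α hα u hwα
    rw [hHN u hu.1, inner_add_right, inner_smul_right, hgα u hu.2 α hα (by linarith)]
    ring
  set V := {u | ∀ α ∈ F.rays, facet ν α u < -(e / 4)} with hV
  have hneg : ∀ u, (∀ α ∈ F.rays, facet ν α u ≤ -(e / 4)) → potBase F.rays w u < 0 := by
    intro u hu
    rw [potBase, Finset.sum_eq_zero fun α hα => ?_]
    · norm_num
    · by_contra hne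
      linarith [hwf α hα u hne, hu α hα]
  have hVQ : ∀ u ∈ V, u ∈ polytope F ν := fun u hu =>
    mem_polytope.2 fun α hα => by linarith [hu α hα]
  refine ⟨H, N ∩ Metric.thickening e (polytope F ν), V, ⟨hHs,
    hN.inter Metric.isOpen_thickening, fun u hu => ⟨(hZ u hu).1,
      Metric.self_subset_thickening he _ (hBQ hu.le)⟩, fun u hu α hα hwα => ?_, fun u hu => ?_,
    ?_, fun u hu => hneg u ?_, fun u hu huV => ?_, fun u hu => ?_, fun u hu hk => ?_,
    fun _ => rfl⟩⟩
  · rw [hphase u ⟨(hZ u hu).1, Metric.self_subset_thickening he _ (hBQ hu.le)⟩ α hα hwα,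
      (hZ u hu).2, inner_zero_right, zero_sub]
  -- Near the boundary the phases of the monomials present differ from those of `Θ` by multiples of
  -- `2π`, so `W` has the same values along both graphs.
  · have hkey : ∀ α ∈ F.rays, w α u ≠ 0 → ∃ k : ℤ, (inner ℝ (vec α) (gradient H u) : ℝ) =
        inner ℝ (vec α) (gradient Θ u) - k * (2 * Real.pi) := fun α hα hwα => by
      obtain ⟨k, hk⟩ := exists_int_ample hν hα
      exact ⟨j * k, by rw [hphase u hu α hα hwα, hk]; push_cast; ring⟩
    have h1 : potIm F.rays w (graphPt H u) = potIm F.rays w (graphPt Θ u) :=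
      Finset.sum_congr rfl fun α hα => by
        simp only [graphPt]
        by_cases hwα : w α u = 0
        · simp [hwα]
        · obtain ⟨k, hk⟩ := hkey α hα hwα
          rw [hk, Real.sin_sub_int_mul_two_pi]
    have h2 : potRe F.rays w (graphPt H u) = potRe F.rays w (graphPt Θ u) := by
      refine congrArg (-1 + ·) (Finset.sum_congr rfl fun α hα => ?_)
      simp only [graphPt]
      by_cases hwα : w α u = 0
      · simp [hwα]
      · obtain ⟨k, hk⟩ := hkey α hα hwα
        rw [hk, Real.cos_sub_int_mul_two_pi]
    rw [h1, h2]
    exact (hNΘ u hu.1).2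
  · have : V = ⋂ α ∈ F.rays, {u | facet ν α u < -(e / 4)} := by ext; simp [hV]
    rw [this]
    exact isOpen_biInter_finset fun α _ => isOpen_lt (continuous_facet ν α) continuous_const
  · have hcl : IsClosed {u | ∀ α ∈ F.rays, facet ν α u ≤ -(e / 4)} := by
      have : {u | ∀ α ∈ F.rays, facet ν α u ≤ -(e / 4)} =
          ⋂ α ∈ F.rays, {u | facet ν α u ≤ -(e / 4)} := by ext; simp
      rw [this]
      exact isClosed_biInter fun α _ => isClosed_le (continuous_facet ν α) continuous_const
    exact closure_minimal (fun v (hv : v ∈ V) α hα => (hv α hα).le) hcl hu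
  · simp only [hV, mem_ofPred_eq, not_forall, not_lt] at huV
    obtain ⟨α, hα, h⟩ := huV
    exact ⟨α, hα, by linarith⟩
  · have hρu : ρ u = 1 := hρ1 u fun α hα => (hu α hα).le
    have hρg : gradient ρ u = 0 := gradient_eq_zero_of_isLocalMax
      (Eventually.of_forall fun v => by rw [hρu]; exact (hρI v).2)
    rcases hcol u (hneg u fun α hα => (hu α hα).le) with ⟨⟨α, hα, h⟩, -⟩ | ⟨h1, h2, h3, -⟩
    · linarith [hu α hα]
    · rw [hHgrad, h1, h2, h3, hρu, hρg]
      simp only [smul_zero, add_zero, mul_one, one_mul, sub_add_cancel, one_smul]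
      rw [hgD, smul_smul]
      congr 1
      ring
  · suffices hmem : u ∈ V from ⟨subset_closure hmem, fun _ => hmem⟩
    by_contra huV
    simp only [hV, mem_ofPred_eq, not_forall, not_lt, exists_prop] at huV
    have huQ : u ∈ polytope F ν := hBQ (le_of_lt hu)
    have huE : u ∈ Metric.thickening e (polytope F ν) := Metric.self_subset_thickening he _ huQ
    obtain ⟨k, hk⟩ := hk
    have hpi := Real.pi_gt_three
    -- At an intersection point this quantity would be an integral multiple of `2π`.
    have hno : ∀ α ∈ F.rays, -(2 * Real.pi) <
        inner ℝ (vec α) (gradient H u) + 2 * Real.pi * j * ν (vec α) →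
        inner ℝ (vec α) (gradient H u) + 2 * Real.pi * j * ν (vec α) < 0 → False := by
      intro α hα h1 h2
      obtain ⟨m, hm⟩ := exists_int_ample hν hα
      refine not_int_of_mem_Ioo h1 h2 (∑ i, α i * k i + j * m) ?_
      rw [hk, inner_smul_right, inner_vec_vec, hm]
      push_cast
      ring
    have hX : ∀ α ∈ F.rays, -(e / 4) ≤ facet ν α u →
        (inner ℝ (vec α) (gradient H u) : ℝ) + 2 * Real.pi * j * ν (vec α) =
        -(2 * Real.pi) * (((1 - d) * ρ u + d) *
            (j * D u * inner ℝ (vec α) (gradient S u)) +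
          S u * (1 - d) * (j * D u * inner ℝ (vec α) (gradient ρ u)) +
          S u * ((1 - d) * ρ u + d) * (j * inner ℝ (vec α) (gradient D u))) +
          inner ℝ (vec α) (gradient Θ u) := by
      intro α hα hαu
      rw [hHgrad]
      simp only [inner_add_right, inner_smul_right]
      rw [hgα u huE α hα hαu]
      ring
    have hjD := hDneg u huQ
    -- In the collar, `ρ = 0` and the `D` terms contribute a number in `[-π, 0]`, to which `Θ` adds
    -- one in `[-1, 0)`. Where `S = 1`, only the transition of `ρ` matters, and its total lies
    -- strictly between `-2π` and `0`.
    rcases hcol u hu with ⟨⟨α', hα', hO'⟩, α, hα, hwα, h1, h2, h3⟩ | ⟨h1, h2, h3, -⟩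
    · have hαu := hwf α hα u hwα.ne'
      have hρu : ρ u = 0 := hρ0 u α' hα' hO'.le
      have hρg : gradient ρ u = 0 := gradient_eq_zero_of_isLocalMin
        (Eventually.of_forall fun v => by rw [hρu]; exact (hρI v).1)
      have hXα := hX α hα (by linarith)
      rw [hρu, hρg, inner_zero_right, mul_zero, mul_zero, mul_zero, zero_add, add_zero] at hXα
      obtain ⟨hD1, hD2⟩ := hDα u huQ α hα (by linarith)
      have hS1 := hSI u
      have e1 : 0 ≤ j * D u * inner ℝ (vec α) (gradient S u) := mul_nonneg_of_nonpos_of_nonpos hjD h3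
      have e2 : j * D u * inner ℝ (vec α) (gradient S u) ≤ M := by
        refine (le_abs_self _).trans ((le_of_eq ?_).trans (hM u hu.le α hα))
        rw [abs_mul, abs_mul]; ring
      have e3 : j * inner ℝ (vec α) (gradient D u) < 1 := by
        refine (le_abs_self _).trans_lt (lt_of_le_of_lt ?_ hD2)
        rw [abs_mul]
        exact mul_le_mul_of_nonneg_left (le_add_of_nonneg_left (by positivity)) (abs_nonneg _)
      have e4 : 0 ≤ d * (j * D u * inner ℝ (vec α) (gradient S u)) := mul_nonneg hd0.le e1
      have e5 : 0 ≤ S u * d * (j * inner ℝ (vec α) (gradient D u)) :=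
        mul_nonneg (mul_nonneg hS1.1 hd0.le) hD1.le
      have e6 : S u * d * (j * inner ℝ (vec α) (gradient D u)) ≤ d * 1 :=
        mul_le_mul (mul_le_of_le_one_left hd0.le hS1.2) e3.le hD1.le hd0.le
      have e7 : d * (j * D u * inner ℝ (vec α) (gradient S u)) ≤ d * M :=
        mul_le_mul_of_nonneg_left e2 hd0.le
      have f1 := add_nonneg e4 e5
      have f2 := add_le_add e7 e6
      rw [← mul_add, hdM] at f2
      have f3 := mul_nonneg (show 0 ≤ 2 * Real.pi by linarith) f1
      have f4 := mul_le_mul_of_nonneg_left f2 (show 0 ≤ 2 * Real.pi by linarith)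
      refine hno α hα ?_ ?_ <;> rw [hXα] <;> linarith
    · obtain ⟨α, hα, hαu, hρα⟩ := hρd u huV
      have hXα := hX α hα hαu
      rw [h1, h2, h3, inner_zero_right, mul_zero, mul_zero, zero_add, add_zero,
        one_mul, one_mul] at hXα
      obtain ⟨hD1, hD2⟩ := hDα u huQ α hα hαu
      have hρu := hρI u
      have e1 : 0 ≤ j * D u * inner ℝ (vec α) (gradient ρ u) :=
        mul_nonneg_of_nonpos_of_nonpos hjD hρα
      have e2 : j * D u * inner ℝ (vec α) (gradient ρ u) +
          j * inner ℝ (vec α) (gradient D u) < 1 := by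
        refine (add_le_add (le_abs_self _) (le_abs_self _)).trans_lt (lt_of_le_of_lt ?_ hD2)
        rw [abs_mul, abs_mul, abs_mul]
        exact le_of_eq (by ring)
      have e3 : 0 < (1 - d) * ρ u + d := by nlinarith
      have e4 : (1 - d) * ρ u + d ≤ 1 := by nlinarith
      have e5 := mul_pos e3 hD1
      have e6 := mul_le_of_le_one_left hD1.le e4
      have e7 := mul_nonneg (show 0 ≤ 1 - d by linarith) e1
      have e8 := mul_le_of_le_one_left e1 (show 1 - d ≤ 1 by linarith)
      have f1 := add_pos_of_nonneg_of_pos e7 e5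
      have f2 := (add_le_add e8 e6).trans_lt e2
      have f3 := mul_pos (show 0 < 2 * Real.pi by linarith) f1
      have f4 := mul_lt_mul_of_pos_left f2 (show 0 < 2 * Real.pi by linarith)
      refine hno α hα ?_ ?_ <;> rw [hXα] <;> linarith

end Twist

/-! ### Intersection points and lattice points -/

section Assembly

variable {F : SmoothCompleteFan n} {ν : Base n → ℝ}

lemma vec_neg (k : Fin n → ℤ) : vec (-k) = -vec k := by
  ext i
  simp [vec]

lemma facet_neg_of_mem_interior {y : Base n} (hy : y ∈ interior (polytope F ν)) {α : Fin n → ℤ}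
    (hα : α ∈ F.rays) : facet ν α y < 0 := by
  refine lt_of_le_of_ne (mem_polytope.1 (interior_subset hy) α hα) fun h => ?_
  have hc : Tendsto (fun s : ℝ => y + s • vec α) (𝓝[>] 0) (𝓝 y) := by
    have : Continuous fun s : ℝ => y + s • vec α := by fun_prop
    simpa using (this.tendsto 0).mono_left nhdsWithin_le_nhds
  obtain ⟨s, hs1, hs2⟩ := ((hc.eventually (mem_interior_iff_mem_nhds.1 hy)).and
    self_mem_nhdsWithin).exists
  have hs2 : 0 < s := hs2
  have h1 := mem_polytope.1 hs1 α hα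
  rw [facet_add, h, zero_add, inner_smul_right] at h1
  exact absurd h1 (not_le.2 (mul_pos hs2 (real_inner_self_pos.2 (ray_ne_zero hα))))

lemma mem_interior_polytope {y : Base n} (hy : ∀ α ∈ F.rays, facet ν α y < 0) :
    y ∈ interior (polytope F ν) := by
  refine mem_interior.2 ⟨⋂ α ∈ F.rays, {y | facet ν α y < 0}, fun z hz => ?_,
    isOpen_biInter_finset fun α _ => isOpen_lt (continuous_facet ν α) continuous_const, ?_⟩
  · exact mem_polytope.2 fun α hα => le_of_lt (by simpa using mem_iInter₂.1 hz α hα)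
  · exact mem_iInter₂.2 fun α hα => hy α hα

lemma exists_int_facet (hν : IsAmple F ν) {j : ℤ} {y : Base n} (hy : y ∈ fracLattice n j)
    {α : Fin n → ℤ} (hα : α ∈ F.rays) : ∃ m : ℤ, j * facet ν α y = m := by
  obtain ⟨k, hk⟩ := hy
  obtain ⟨p, hp⟩ := exists_int_ample hν hα
  refine ⟨∑ i, α i * k i - j * p, ?_⟩
  rw [facet, mul_sub, ← inner_smul_right, hk, inner_vec_vec, hp]
  push_cast
  ring

/-- Points of `Q` move inward by at least `e/(1 + e)` under the contraction. Conversely, the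
condition on the right gives `j · facet < 1`, and integrality then gives `j · facet ≤ 0`. -/
lemma fracLattice_mem_polytope_iff (hν : IsAmple F ν) (h0 : (0 : Base n) ∈ interior (polytope F ν))
    {N e : ℝ} (hN : ∀ α ∈ F.rays, ν (vec α) ≤ N) {j : ℤ} (hj : 0 < j) (he : 0 < e) (he1 : e < 1)
    (hje : |(j : ℝ)| * (e * (N + 1)) < 1) {y : Base n} (hy : y ∈ fracLattice n j) :
    y ∈ polytope F ν ↔ ∀ α ∈ F.rays, facet ν α ((1 + e)⁻¹ • y) < -(e / 4) := by
  have hl : 0 < 1 + e := by linarith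
  have hj' : (0 : ℝ) < j := by exact_mod_cast hj
  rw [mem_polytope]
  refine forall₂_congr fun α hα => ?_
  have h1 := one_le_ample hν h0 hα
  have hf : (1 + e) * facet ν α ((1 + e)⁻¹ • y) = facet ν α y - e * ν (vec α) := by
    rw [facet_smul]
    field_simp
    ring
  rw [abs_of_pos hj'] at hje
  have h2 := mul_le_mul_of_nonneg_left (hN α hα) he.le
  constructor
  · intro h
    by_contra hcon
    nlinarith
  · intro h
    obtain ⟨m, hm⟩ := exists_int_facet hν hy hα
    have h3 : facet ν α y < e * (N + 1) := by nlinarith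
    have h4 : (m : ℝ) < 1 := by
      rw [← hm]
      exact (mul_lt_mul_of_pos_left h3 hj').trans hje
    have h5 : m ≤ 0 := by
      have : m < 1 := by exact_mod_cast h4
      omega
    have h6 : (m : ℝ) ≤ 0 := by exact_mod_cast h5
    rw [← hm] at h6
    by_contra hcon
    linarith [mul_pos hj' (not_le.1 hcon)]

/-- Dual to the positive case. At an interior lattice point `|j|` times each facet function is at
most `-1`, which leaves room for the expansion by `(1 - e)⁻¹`; points of `∂Q` are pushed out. -/
lemma fracLattice_mem_interior_iff (hν : IsAmple F ν) (h0 : (0 : Base n) ∈ interior (polytope F ν))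
    {N e : ℝ} (hN : ∀ α ∈ F.rays, ν (vec α) ≤ N) {j : ℤ} (hj : j < 0) (he : 0 < e) (he1 : e < 1)
    (hje : |(j : ℝ)| * (e * (N + 1)) < 1) {y : Base n} (hy : y ∈ fracLattice n j) :
    y ∈ polytope F ν \ frontier (polytope F ν) ↔
      ∀ α ∈ F.rays, facet ν α ((1 - e)⁻¹ • y) < -(e / 4) := by
  have hl : 0 < 1 - e := by linarith
  have hj' : (j : ℝ) < 0 := by exact_mod_cast hj
  have hf : ∀ α, (1 - e) * facet ν α ((1 - e)⁻¹ • y) = facet ν α y + e * ν (vec α) := fun α => by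
    rw [facet_smul]
    field_simp
    ring
  rw [self_sdiff_frontier]
  constructor
  · intro h α hα
    have h1 := one_le_ample hν h0 hα
    have h2 := mul_le_mul_of_nonneg_left (hN α hα) he.le
    have h3 := facet_neg_of_mem_interior h hα
    obtain ⟨m, hm⟩ := exists_int_facet hν hy hα
    have h4 : (0 : ℝ) < m := by rw [← hm]; exact mul_pos_of_neg_of_neg hj' h3
    have h5 : (1 : ℝ) ≤ m := by
      have : 0 < m := by exact_mod_cast h4
      exact_mod_cast this
    rw [← hm] at h5
    rw [abs_of_neg hj'] at hje
    have h6 : facet ν α y < -(e * (N + 1)) := by nlinarith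
    have hfα := hf α
    by_contra hcon
    nlinarith
  · intro h
    refine mem_interior_polytope fun α hα => ?_
    have h1 := one_le_ample hν h0 hα
    have h2 := mul_pos hl (show 0 < -facet ν α ((1 - e)⁻¹ • y) by linarith [h α hα])
    have h3 := mul_le_mul_of_nonneg_left h1 he.le
    have hfα := hf α
    linarith

lemma gradient_quadratic (c : ℝ) (u : Base n) :
    gradient (fun u : Base n => -(c * inner ℝ u u)) u = -(2 * c) • u := by
  have h : HasFDerivAt (fun u : Base n => -(c * inner ℝ u u)) _ u :=
    (((hasFDerivAt_id u).inner ℝ (hasFDerivAt_id u)).const_mul c).neg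
  refine gradient_eq_of_hasFDerivAt h fun v => ?_
  simp [inner_smul_left, real_inner_comm u v]
  ring

lemma gradient_zero (u : Base n) : gradient (0 : Base n → ℝ) u = 0 := by
  refine ext_inner_right ℝ fun v => ?_
  rw [inner_gradient]
  simp

variable {f : Base n → ℝ}

lemma mem_interiorIntersection (hf : ContDiff ℝ ∞ f) (hreg : ∀ u, f u = 0 → fderiv ℝ f u ≠ 0)
    {H : Base n → ℝ} (hH : ContDiff ℝ ∞ H) {x : Torus n} :
    x ∈ interiorIntersection (graphOver {u | f u ≤ 0} 0) (graphOver {u | f u ≤ 0} H) ↔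
      f x.1 < 0 ∧ x.2 = 0 ∧ ∃ k : Fin n → ℤ, gradient H x.1 = (2 * Real.pi) • vec k := by
  have hz : ContDiff ℝ ∞ (0 : Base n → ℝ) := contDiff_const
  rw [interiorIntersection, bdry_graphOver hf hreg hH, bdry_graphOver hf hreg hz]
  have h1 : x.2 = 0 → (x ∈ graphOver {u | f u ≤ 0} H ↔ f x.1 ≤ 0 ∧
      ∃ k : Fin n → ℤ, gradient H x.1 = (2 * Real.pi) • vec k) := by
    intro hx
    have h2 : x = cov (x.1, 0) := by
      refine Prod.ext rfl (funext fun i => ?_)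
      rw [hx]
      simp [cov]
    have h3 : x ∈ graphOver {u | f u ≤ 0} H ↔ (x.1, 0) ∈ lift (graphOver {u | f u ≤ 0} H) := by
      rw [lift, mem_preimage, ← h2]
    rw [h3, mem_lift_graphOver]
    refine and_congr Iff.rfl ⟨?_, ?_⟩
    · rintro ⟨k, hk⟩
      exact ⟨-k, by rw [vec_neg, smul_neg]; exact eq_neg_of_add_eq_zero_left hk.symm⟩
    · rintro ⟨k, hk⟩
      exact ⟨-k, by rw [hk, vec_neg, smul_neg, add_neg_cancel]⟩
  have h4 : x ∈ graphOver {u | f u ≤ 0} 0 ↔ f x.1 ≤ 0 ∧ x.2 = 0 := by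
    refine and_congr Iff.rfl ?_
    simp only [gradient_zero]
    exact ⟨fun h => funext fun i => by rw [h i]; simp, fun h i => by rw [h]; simp⟩
  constructor
  · rintro ⟨⟨hx1, hx2⟩, hx3, -⟩
    obtain ⟨h5, h6⟩ := h4.1 hx1
    exact ⟨lt_of_le_of_ne h5 fun h => hx2 ⟨hx1, h⟩, h6, ((h1 h6).1 hx3).2⟩
  · rintro ⟨h5, h6, h7⟩
    exact ⟨⟨h4.2 ⟨h5.le, h6⟩, fun h => h5.ne h.2⟩, (h1 h6).2 ⟨h5.le, h7⟩, fun h => h5.ne h.2⟩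

lemma zeroBall_eq {t : ℝ} {χ : (Fin n → ℤ) → Base n → ℝ} :
    zeroBall F ν t χ = graphOver (ballBase F ν t χ) 0 := by
  ext x
  refine and_congr Iff.rfl ?_
  simp only [gradient_zero]
  exact ⟨fun h i => by rw [h]; simp, fun h => funext fun i => by rw [h i]; simp⟩

/-- In positive dimension a nonempty compact sublevel set is not the whole space, so it has a
frontier point. This makes the boundaries of the Lagrangians nonempty. -/
lemma exists_eq_zero_of_isCompact (hn : 1 ≤ n) (hf : Continuous f) (hB : IsCompact {u | f u ≤ 0})
    {u : Base n} (hu : f u ≤ 0) : ∃ v, f v = 0 := by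
  have : Nonempty (Fin n) := ⟨⟨0, hn⟩⟩
  have : NoncompactSpace (Base n) := NormedSpace.noncompactSpace ℝ (Base n)
  have h1 : (frontier {u | f u ≤ 0}).Nonempty :=
    nonempty_frontier_iff.2 ⟨⟨u, hu⟩, hB.ne_univ⟩
  obtain ⟨v, hv⟩ := h1
  exact ⟨v, frontier_le_subset_eq hf continuous_const hv⟩

lemma bdry_graphOver_nonempty (hf : ContDiff ℝ ∞ f) (hreg : ∀ u, f u = 0 → fderiv ℝ f u ≠ 0)
    {H : Base n → ℝ} (hH : ContDiff ℝ ∞ H) {u : Base n} (hu : f u = 0) :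
    (bdry (graphOver {u | f u ≤ 0} H)).Nonempty := by
  rw [bdry_graphOver hf hreg hH]
  exact ⟨cov (u, gradient H u), ⟨le_of_eq hu, fun i => rfl⟩, hu⟩

lemma isAdmissible_graphOver {R : Finset (Fin n → ℤ)} {w : (Fin n → ℤ) → Base n → ℝ}
    (hw : ∀ α ∈ R, ContDiff ℝ ∞ (w α)) (hB : IsCompact {u | potBase R w u ≤ 0})
    (hreg : ∀ u, potBase R w u = 0 → fderiv ℝ (potBase R w) u ≠ 0)
    {H : Base n → ℝ} (hH : ContDiff ℝ ∞ H)
    (hph : ∀ u, potBase R w u = 0 → PhasesTrivial R w (graphPt H u)) {γ : ℝ → ℂ}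
    (hγ : AgreesWithTransport (pot R w) (graphOver {u | potBase R w u ≤ 0} H) γ) :
    IsAdmissible (pot R w) (graphOver {u | potBase R w u ≤ 0} H) where
  compact := isCompact_graphOver hB hH
  lagrangian := isLagrangian_graphOver (contDiff_potBase hw) hreg hH
  exact := isExact_graphOver hH
  orientable := isOrientable_graphOver (contDiff_potBase hw) hreg hH
  bdry_subset := by
    rw [bdry_graphOver (contDiff_potBase hw) hreg hH]
    rintro x ⟨hx, h0⟩
    have h1 : x = cov (graphPt H x.1) := Prod.ext rfl (funext hx.2)
    rw [h1, pot_cov, (hph x.1 h0).potRe, (hph x.1 h0).potIm]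
    simp [graphPt, h0]
  transport := Or.inr ⟨γ, hγ⟩

lemma deriv_ray (ψ : ℝ) : deriv (fun s : ℝ => -(s : ℂ) * Complex.exp (ψ * Complex.I)) 0 =
    -Complex.exp (ψ * Complex.I) := (hasDerivAt_ray ψ 0).deriv

/-- Twist functions for the superpotentials of the mirror. -/
lemma exists_twistFunction_superpotential (hν : IsAmple F ν)
    (h0 : (0 : Base n) ∈ interior (polytope F ν)) (j : ℤ) :
    ∃ s : ℝ, (j ≠ 0 → s = 1 ∧ 0 < (j : ℝ) ∨ s = -1 ∧ (j : ℝ) < 0) ∧ |s| = 1 ∧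
    ∃ e₀ > 0, ∀ e, 0 < e → e < e₀ → ∀ w : (Fin n → ℤ) → Base n → ℝ,
      (∀ α ∈ F.rays, ContDiff ℝ ∞ (w α)) → (∀ α ∈ F.rays, ∀ u, 0 ≤ w α u) →
      {u | potBase F.rays w u ≤ 0} ⊆ polytope F ν →
      (∀ u, potBase F.rays w u = 0 →
        0 < inner ℝ (gradient (potBase F.rays w) u) (potDir F.rays w u)) →
      (∀ α ∈ F.rays, ∀ u, w α u ≠ 0 → -(e / 8) < facet ν α u) →
      ∀ ψ : ℝ, 0 < Real.cos ψ → 0 < Real.sin ψ →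
      ∃ H N V, IsTwistFunction F ν w ψ j e (1 + s * e) H N V := by
  rcases lt_trichotomy j 0 with h | rfl | h
  · have hs : (-1 : ℝ) = 1 ∧ 0 < (j : ℝ) ∨ (-1 : ℝ) = -1 ∧ (j : ℝ) < 0 :=
      Or.inr ⟨rfl, by exact_mod_cast h⟩
    exact ⟨-1, fun _ => hs, by norm_num, exists_twistFunction hν h0 hs⟩
  · refine ⟨1, fun h => (h rfl).elim, by norm_num, 1, one_pos,
      fun e he _ w hw hpos hBQ hnd hwf ψ hc hs => ?_⟩
    have hB : IsCompact {u | potBase F.rays w u ≤ 0} :=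
      (isCompact_polytope hν).of_isClosed_subset
        (isClosed_le (contDiff_potBase hw).continuous continuous_const) hBQ
    exact exists_twistFunction_zero hw hpos hB hnd hc hs fun α hα u hu => by
      linarith [hwf α hα u hu]
  · have hs : (1 : ℝ) = 1 ∧ 0 < (j : ℝ) ∨ (1 : ℝ) = -1 ∧ (j : ℝ) < 0 :=
      Or.inl ⟨rfl, by exact_mod_cast h⟩
    exact ⟨1, fun _ => hs, by norm_num, exists_twistFunction hν h0 hs⟩

/-- All intersections lie over `V`, where `∇H = -2πjl u`, so they are the points with `jl u ∈ ℤⁿ`.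
The last hypothesis translates `V` into the polytope. -/
lemma bijOn_fracLattice (hf : ContDiff ℝ ∞ f) (hreg : ∀ u, f u = 0 → fderiv ℝ f u ≠ 0)
    {H : Base n → ℝ} (hH : ContDiff ℝ ∞ H) {j : ℤ} {l : ℝ} (hl : l ≠ 0) {V : Set (Base n)}
    (hV : ∀ u ∈ V, f u < 0) (hHV : ∀ u ∈ V, gradient H u = -(2 * Real.pi * j * l) • u)
    (hlat : ∀ u, f u < 0 → (∃ k, gradient H u = (2 * Real.pi) • vec k) → u ∈ V)
    {P : Set (Base n)} (hP : ∀ y ∈ fracLattice n j, y ∈ P ↔ l⁻¹ • y ∈ V) :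
    BijOn (fun x : Torus n => l • x.1)
      (interiorIntersection (graphOver {u | f u ≤ 0} 0) (graphOver {u | f u ≤ 0} H))
      (fracLattice n j ∩ P) := by
  have hpi : (2 * Real.pi) ≠ 0 := by positivity
  refine ⟨fun x hx => ?_, fun x hx y hy hxy => ?_, fun y hy => ?_⟩
  · obtain ⟨h1, -, k, hk⟩ := (mem_interiorIntersection hf hreg hH).1 hx
    have hxV := hlat x.1 h1 ⟨k, hk⟩
    have hfrac : l • x.1 ∈ fracLattice n j := by
      refine ⟨-k, ?_⟩
      rw [hHV _ hxV, show -(2 * Real.pi * j * l) • x.1 =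
        (2 * Real.pi) • -((j : ℝ) • l • x.1) by module] at hk
      rw [vec_neg, ← smul_right_injective _ hpi hk, neg_neg]
    refine ⟨hfrac, (hP _ hfrac).2 ?_⟩
    rwa [smul_smul, inv_mul_cancel₀ hl, one_smul]
  · refine Prod.ext (smul_right_injective _ hl hxy) ?_
    rw [((mem_interiorIntersection hf hreg hH).1 hx).2.1,
      ((mem_interiorIntersection hf hreg hH).1 hy).2.1]
  · obtain ⟨⟨k, hk⟩, hyP⟩ := hy
    have hyV := (hP y ⟨k, hk⟩).1 hyP
    refine ⟨(l⁻¹ • y, 0), (mem_interiorIntersection hf hreg hH).2 ⟨hV _ hyV, rfl, -k, ?_⟩, ?_⟩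
    · change gradient H (l⁻¹ • y) = _
      rw [hHV _ hyV, vec_neg, ← hk, smul_smul, show -(2 * Real.pi * j * l) * l⁻¹ =
        -(2 * Real.pi * j) * (l * l⁻¹) by ring, mul_inv_cancel₀ hl]
      module
    · change l • l⁻¹ • y = y
      rw [smul_smul, mul_inv_cancel₀ hl, one_smul]

end Assembly
-- Positive orientation of the pair
section Positivity

lemma exists_pos_small {e₀ η L : ℝ} (he₀ : 0 < e₀) (hη : 0 < η) (c : ℝ) :
    ∃ e, 0 < e ∧ e < e₀ ∧ e < η ∧ e < 1 / 2 ∧ e * L < η ∧ c * e < 1 := by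
  have key : ∀ g : ℝ → ℝ, Continuous g → ∀ b, g 0 < b → ∀ᶠ e in 𝓝[>] (0 : ℝ), g e < b :=
    fun g hg b hb => mem_nhdsWithin_of_mem_nhds ((hg.tendsto 0).eventually_lt_const hb)
  have hpos : ∀ᶠ e in 𝓝[>] (0 : ℝ), 0 < e := self_mem_nhdsWithin
  exact (hpos.and <| (key (fun e => e) (by fun_prop) _ he₀).and <|
    (key (fun e => e) (by fun_prop) _ hη).and <|
    (key (fun e => e) (by fun_prop) _ (by norm_num)).and <|
    (key (fun e => e * L) (by fun_prop) _ (by simpa using hη)).and <|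
    key (fun e => c * e) (by fun_prop) _ (by simp)).exists

variable {R : Finset (Fin n → ℤ)} {w : (Fin n → ℤ) → Base n → ℝ}

lemma agreesWithTransport_zero (hw : ∀ α ∈ R, ContDiff ℝ ∞ (w α))
    (hpos : ∀ α ∈ R, ∀ u, 0 ≤ w α u) (hB : IsCompact {u | potBase R w u ≤ 0})
    (hnd : ∀ u, potBase R w u = 0 → 0 < inner ℝ (gradient (potBase R w) u) (potDir R w u)) :
    AgreesWithTransport (pot R w) (graphOver {u | potBase R w u ≤ 0} 0)
      (fun s => -(s : ℂ) * Complex.exp ((0 : ℝ) * Complex.I)) := by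
  refine agreesWithTransport_graphOver hw hpos hB hnd contDiff_const (by simp) isOpen_univ
    (fun u _ => mem_univ u) (fun u _ => ?_) fun u _ α _ _ => ⟨0, ?_⟩
  · simp [potIm, graphPt]
  · simp [graphPt]

/-- The zero section and a graph leaving the fibre over `0` at angle `ψ` form a positively
oriented pair. -/
lemma positivelyOriented_graphOver (hw : ∀ α ∈ R, ContDiff ℝ ∞ (w α))
    (hpos : ∀ α ∈ R, ∀ u, 0 ≤ w α u) (hB : IsCompact {u | potBase R w u ≤ 0})
    (hnd : ∀ u, potBase R w u = 0 → 0 < inner ℝ (gradient (potBase R w) u) (potDir R w u))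
    (hreg : ∀ u, potBase R w u = 0 → fderiv ℝ (potBase R w) u ≠ 0)
    {u₀ : Base n} (hu₀ : potBase R w u₀ = 0)
    {H : Base n → ℝ} (hH : ContDiff ℝ ∞ H)
    (hph : ∀ u, potBase R w u = 0 → PhasesTrivial R w (graphPt H u))
    {ψ : ℝ} (hψ : ψ ∈ Ioo 0 (Real.pi / 2))
    (hγ : AgreesWithTransport (pot R w) (graphOver {u | potBase R w u ≤ 0} H)
      (fun s => -(s : ℂ) * Complex.exp (ψ * Complex.I))) :
    PositivelyOriented (pot R w) (graphOver {u | potBase R w u ≤ 0} 0)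
      (graphOver {u | potBase R w u ≤ 0} H) := by
  have hz : ContDiff ℝ ∞ (0 : Base n → ℝ) := contDiff_const
  have hγ₀ := agreesWithTransport_zero hw hpos hB hnd
  have hf := contDiff_potBase hw
  refine ⟨isAdmissible_graphOver hw hB hreg hz (fun u _ α _ _ => ⟨0, ?_⟩) hγ₀,
    isAdmissible_graphOver hw hB hreg hH hph hγ, bdry_graphOver_nonempty hf hreg hz hu₀,
    bdry_graphOver_nonempty hf hreg hH hu₀, _, _, hγ₀, hγ, ?_⟩
  · simp [graphPt, gradient_zero]
  -- The velocities are `-1` and `-e^{iψ}`; their quotient has argument `ψ`.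
  · rw [deriv_ray, deriv_ray, Complex.ofReal_zero, zero_mul, Complex.exp_zero, neg_div_neg_eq,
      div_one, Complex.exp_mul_I, Complex.arg_cos_add_sin_mul_I]
    · exact hψ
    · exact ⟨by linarith [hψ.1, Real.pi_pos], by linarith [hψ.2, Real.pi_pos]⟩

end Positivity
end ToricMirror

/-! ### The proposition -/

open ToricMirror

theorem proposition5p7 (n : ℕ) (hn : 1 ≤ n) (F : ToricMirror.SmoothCompleteFan n)
    (ν : ToricMirror.Base n → ℝ) (hν : ToricMirror.IsAmple F ν)
    (h0 : (0 : ToricMirror.Base n) ∈ interior (ToricMirror.polytope F ν))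
    (j : ℤ) (η : ℝ) (hη : 0 < η) :
    ∃ ε' : ℝ, |ε'| < η ∧ (j ≠ 0 → 0 < j * ε') ∧
    ∃ ε₀ > 0, ∀ ε : ℝ, 0 < ε → ε < ε₀ → ∀ B : ℝ, ∃ T : ℝ, ∀ t : ℝ, T < t →
    ∀ χ : (Fin n → ℤ) → ToricMirror.Base n → ℝ, ToricMirror.IsCutoffFamily F ν ε B χ →
    ∃ Lj : Set (ToricMirror.Torus n),
      ToricMirror.IsAdmissible (ToricMirror.superpotential F ν t χ) Lj ∧
      ToricMirror.IsTwist F ν t χ j Lj ∧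
      ToricMirror.PositivelyOriented (ToricMirror.superpotential F ν t χ)
        (ToricMirror.zeroBall F ν t χ) Lj ∧
      (0 < j → Set.BijOn (fun x : ToricMirror.Torus n => (1 + ε') • x.1)
        (ToricMirror.interiorIntersection (ToricMirror.zeroBall F ν t χ) Lj)
        (ToricMirror.fracLattice n j ∩ ToricMirror.polytope F ν)) ∧
      (j < 0 → Set.BijOn (fun x : ToricMirror.Torus n => (1 + ε') • x.1)
        (ToricMirror.interiorIntersection (ToricMirror.zeroBall F ν t χ) Lj)
        (ToricMirror.fracLattice n j ∩
          (ToricMirror.polytope F ν \ frontier (ToricMirror.polytope F ν)))) ∧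
      ∃ V : Set (ToricMirror.Base n), IsOpen V ∧
        closure V ⊆ interior (ToricMirror.ballBase F ν t χ) ∧
        (∀ u ∈ ToricMirror.ballBase F ν t χ, u ∉ V →
          Metric.infDist u (frontier (ToricMirror.ballBase F ν t χ)) < η) ∧
        (∀ x ∈ ToricMirror.interiorIntersection (ToricMirror.zeroBall F ν t χ) Lj,
          x.1 ∈ closure V ∧ (j ≠ 0 → x.1 ∈ V)) ∧
        Lj ∩ {x | x.1 ∈ V} = ToricMirror.graphOver V
          (fun u => -(j * Real.pi * (1 + ε') * inner ℝ u u)) := by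
  obtain ⟨A, hA1, hA⟩ := exists_ray_bound F
  obtain ⟨L, hL1, hL⟩ := exists_polytope_bound hν
  obtain ⟨N, hN0, hN⟩ := exists_ample_bound F ν
  obtain ⟨s, hs, hsabs, e₀, he₀, htwist⟩ := exists_twistFunction_superpotential hν h0 j
  obtain ⟨e, he, hee₀, heη, he2, heL, hje⟩ :=
    exists_pos_small (L := L) he₀ hη (|(j : ℝ)| * (N + 1))
  have hje' : |(j : ℝ)| * (e * (N + 1)) < 1 := by linarith
  -- The sign of `ε'` is that of `j`. The bound `e / (8A)` keeps the supports of the monomials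
  -- within `e/8` of their facets, outside the transition region of `ρ`.
  refine ⟨s * e, by rwa [abs_mul, hsabs, one_mul, abs_of_pos he], fun hj => ?_,
    e / (8 * A), by positivity, fun ε hε hε₀ B => ?_⟩
  · rcases hs hj with ⟨rfl, h⟩ | ⟨rfl, h⟩ <;> nlinarith
  have hAε : A * ε < e / 8 := by
    rw [lt_div_iff₀ (by positivity)] at hε₀
    linarith
  obtain ⟨T, hT1, hT⟩ := exists_nondegenerate hν h0 hA hε (by linarith) B
  refine ⟨T, fun t hTt χ hχ => ?_⟩
  have ht1 : 1 < t := hT1.trans_lt hTt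
  have ht0 : 0 < t := one_pos.trans ht1
  have hnd := hT t hTt χ hχ
  have hpos := weight_nonneg hχ hν hε ht0
  have hw := contDiff_weight hχ ht0
  have hBQ : {u | potBase F.rays (weight ν t χ) u ≤ 0} ⊆ polytope F ν := fun u hu => by
    by_contra h
    exact not_lt.2 hu (potBase_pos hχ hν hε ht1 h)
  have hwf : ∀ α ∈ F.rays, ∀ u, weight ν t χ α u ≠ 0 → -(e / 8) < facet ν α u :=
    fun α hα u hu => by linarith [hχ.facet_gt hν hA hα ((weight_ne_zero_iff ht0).1 hu)]
  -- At the origin every facet function is at most `-1`, so all monomials are cut off and the ball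
  -- is nonempty.
  have hf0 : potBase F.rays (weight ν t χ) 0 ≤ 0 := by
    rw [potBase_eq_neg_one hχ hν ht0 hA fun α hα => ?_]
    · norm_num
    · rw [facet, inner_zero_right]
      linarith [one_le_ample hν h0 hα]
  rw [superpotential_eq_pot, zeroBall_eq]
  have hball := ballBase_eq hχ hν hε ht1
  have hχw : ∀ {α u}, χ α u ≠ 1 → weight ν t χ α u ≠ 0 := (weight_ne_zero_iff ht0).2
  simp only [IsTwist, hball]
  clear hball
  generalize weight ν t χ = w at *
  have hf := contDiff_potBase hw
  have hB : IsCompact {u | potBase F.rays w u ≤ 0} :=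
    (isCompact_polytope hν).of_isClosed_subset (isClosed_le hf.continuous continuous_const) hBQ
  have hreg : ∀ u, potBase F.rays w u = 0 → fderiv ℝ (potBase F.rays w) u ≠ 0 := by
    intro u hu h
    have h1 := hnd u hu
    rw [inner_gradient, h] at h1
    simp at h1
  obtain ⟨u₀, hu₀⟩ := exists_eq_zero_of_isCompact hn hf.continuous hB hf0
  have hpi := Real.pi_pos
  -- Any angle in this interval would do.
  have hψ : Real.pi / 4 ∈ Ioo 0 (Real.pi / 2) := ⟨by linarith, by linarith⟩
  have hcos : 0 < Real.cos (Real.pi / 4) := Real.cos_pos_of_mem_Ioo ⟨by linarith, hψ.2⟩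
  have hsin : 0 < Real.sin (Real.pi / 4) := Real.sin_pos_of_mem_Ioo ⟨hψ.1, by linarith⟩
  obtain ⟨H, N', V, hH⟩ := htwist e he hee₀ w hw hpos hBQ hnd hwf _ hcos hsin
  have hph : ∀ u, potBase F.rays w u = 0 → PhasesTrivial F.rays w (graphPt H u) := by
    intro u hu α hα hαu
    obtain ⟨k, hk⟩ := exists_int_ample hν hα
    refine ⟨-(j * k), ?_⟩
    change inner ℝ (vec α) (gradient H u) = _
    rw [hH.inner_gradient_bdry u hu α hα hαu, hk]
    push_cast
    ring
  have hγ := agreesWithTransport_graphOver hw hpos hB hnd hH.smooth hcos hH.isOpen_N hH.mem_N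
    hH.phase hph
  have hV : ∀ u ∈ V, potBase F.rays w u < 0 := fun u hu => hH.closure_V u (subset_closure hu)
  refine ⟨graphOver {u | potBase F.rays w u ≤ 0} H,
    isAdmissible_graphOver hw hB hreg hH.smooth hph hγ,
    ⟨H, hH.smooth, rfl, fun u hu α hα hαu => ?_⟩,
    positivelyOriented_graphOver hw hpos hB hnd hreg hu₀ hH.smooth hph hψ hγ,
    fun hj => ?_, fun hj => ?_, V, hH.isOpen_V, fun u hu => ?_, fun u hu huV => ?_,
    fun x hx => ?_, ?_⟩
  · exact hH.inner_gradient_bdry u (frontier_le_subset_eq hf.continuous continuous_const hu) α hα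
      (hχw hαu)
  · obtain ⟨rfl, -⟩ | ⟨-, h⟩ := hs hj.ne'
    · refine bijOn_fracLattice hf hreg hH.smooth (by linarith) hV hH.gradient_V
        (fun u h1 h2 => (hH.mem_of_lattice u h1 h2).2 hj.ne') fun y hy => ?_
      rw [hH.eq_V hj.ne', one_mul]
      exact fracLattice_mem_polytope_iff hν h0 hN hj he (by linarith) hje' hy
    · exact absurd (Int.cast_pos.2 hj) h.not_gt
  · obtain ⟨-, h⟩ | ⟨rfl, -⟩ := hs hj.ne
    · exact absurd (Int.cast_lt_zero.2 hj) h.not_gt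
    · refine bijOn_fracLattice hf hreg hH.smooth (by linarith) hV hH.gradient_V
        (fun u h1 h2 => (hH.mem_of_lattice u h1 h2).2 hj.ne) fun y hy => ?_
      rw [hH.eq_V hj.ne, neg_one_mul, ← sub_eq_add_neg]
      exact fracLattice_mem_interior_iff hν h0 hN hj he (by linarith) hje' hy
  · exact interior_maximal (fun v (hv : potBase F.rays w v < 0) => hv.le)
      (isOpen_lt hf.continuous continuous_const) (hH.closure_V u hu)
  · obtain ⟨α, hα, hαu⟩ := hH.near_bdry u hu huV
    exact infDist_frontier_lt hν h0 hL (by linarith) (by linarith) (by linarith) hBQ hu hα hαu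
  · obtain ⟨h1, -, h2⟩ := (mem_interiorIntersection hf hreg hH.smooth).1 hx
    exact hH.mem_of_lattice _ h1 h2
  · have hgrad : ∀ u ∈ V, gradient H u =
        gradient (fun u : Base n => -(j * Real.pi * (1 + s * e) * inner ℝ u u)) u := by
      intro u hu
      rw [hH.gradient_V u hu, gradient_quadratic]
      ring_nf
    ext x
    constructor
    · rintro ⟨⟨-, h2⟩, hxV : x.1 ∈ V⟩
      exact ⟨hxV, fun i => by rw [h2 i, hgrad _ hxV]⟩
    · rintro ⟨hxV, h2⟩
      exact ⟨⟨(hV _ hxV).le, fun i => by rw [h2 i, hgrad _ hxV]⟩, hxV⟩
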